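/- Let $n,m\ge 1$ and $p\in(1,\infty)$, $1/p+1/p'=1$. A rectangle is a product $R=I\times J$ of axis-parallel cubes $I\subset\mathbb R^n$, $J\subset\mathbb R^m$; $\langle g\rangle_A=|A|^{-1}\int_A g$. A weight is a locally integrable, a.e. positive function $w$ on $\mathbb R^n\times\mathbb R^m$, and $w\in A_p$ means $[w]_{A_p}:=\sup_R\langle w\rangle_R\langle w^{1-p'}\rangle_R^{p-1}<\infty$. $L^p(w)$ is taken with respect to $w\,dx$. A dyadic grid in $\mathbb R^n$ is a family of half-open cubes with side lengths in $\{2^k:k\in\mathbb Z\}$, any two of them nested or disjoint, such that for each $k\in\mathbb Z$ its cubes of side length $2^k$ partition $\mathbb R^n$. For a weight $w$, $b\in\mathrm{bmo}(w)$ means that $b\colon\mathbb R^{n}\times\mathbb R^m\to\mathbb C$ is locally integrable and $$\|b\|_{\mathrm{bmo}(w)}:=\sup_{\mathcal D^n,\mathcal D^m}\ \sup_{R\in\mathcal D^n\times\mathcal D^m}\frac1{w(R)}\int_R|b-\langle b\rangle_R|<\infty ,$$ the outer supremum being over all dyadic grids $\mathcal D^n$ in $\mathbb R^n$ and $\mathcal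 D^m$ in $\mathbb R^m$. For a cube $I=I_1\times\dots\times I_n$ and $\eta\in\{0,1\}^n$ let $h_I^\eta=h_{I_1}^{\eta_1}\otimes\dots\otimes h_{I_n}^{\eta_n}$, where $h^0_{I_i}=|I_i|^{-1/2}1_{I_i}$ and $h^1_{I_i}=|I_i|^{-1/2}(1_{I_{i,l}}-1_{I_{i,r}})$ with $I_{i,l},I_{i,r}$ the left and right halves of $I_i$. Write $\langle f,h\rangle_1(x_2)=\int_{\mathbb R^n}f(y_1,x_2)h(y_1)\,dy_1$, $\langle g\rangle_{I,1}(x_2)=|I|^{-1}\int_I g(y_1,x_2)\,dy_1$, and $M_{\mathcal D^m}g=\sup_{J\in\mathcal D^m}1_J\langle|g|\rangle_J$. Then there are constants $C_1([\nu]_{A_2})$ and $C_2([\mu]_{A_p},[\lambda]_{A_p})$, which depend only on $n,m,p$ and on the indicated quantities, such that the following holds. Let $\mathcal D^n,\mathcal D^m$ be dyadic grids in $\mathbb R^n,\mathbb R^m$, let $\mu,\lambda\in A_p$, and let $\nu=\mu^{1/p}\lambda^{-1/p}$. For each cube $I$ let $S_I\subset\{0,1\}^n\setminus\{0\}$ be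 any set of cancellative signatures (for example a single one, or all of them). Then for every $f\colon\mathbb R^n\times\mathbb R^m\to\mathbb C$ in $L^p(\mu)$ the series $$\varphi^{\nu,1}f=\sum_{I\in\mathcal D^n}\sum_{\eta\in S_I}h_I^\eta\otimes M_{\mathcal D^m}(\langle f,h_I^\eta\rangle_1)\,\langle\nu\rangle_{I,1}$$ converges unconditionally in $L^p(\lambda)$, and $$\|\varphi^{\nu,1}f\|_{L^p(\lambda)}\le C_2([\mu]_{A_p},[\lambda]_{A_p})\,\|f\|_{L^p(\mu)} .$$ Moreover, for every $b\in\mathrm{bmo}(\nu)$, $I\in\mathcal D^n$, $J\in\mathcal D^m$ and $\eta\in S_I$, the function $(\langle b\rangle_{I,1}-\langle b\rangle_{I\times J})\langle f,h_I^\eta\rangle_1$ is integrable on $J$ and $$\big|\big\langle(\langle b\rangle_{I,1}-\langle b\rangle_{I\times J})\langle f,h_I^\eta\rangle_1\big\rangle_J\big|\le C_1([\nu]_{A_2})\,\|b\|_{\mathrm{bmo}(\nu)}\int_{\mathbb R^n\times\mathbb R^m}\varphi^{\nu,1}f\cdot\Big(h_I^\eta\otimes\frac{1_J}{|J|}\Big).$$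 -/

import Mathlib

open MeasureTheory Filter Topology
open scoped ENNReal NNReal

noncomputable section

namespace BiParam

/-- A half-open cube in `ℝⁿ` with sides parallel to the axes: lower corner and side length. -/
@[ext]
structure Cube (n : ℕ) where
  corner : Fin n → ℝ
  side : ℝ
  side_pos : 0 < side

/-- The points of the cube: the product of the intervals `[corner i, corner i + side)`. -/
def Cube.toSet {n : ℕ} (I : Cube n) : Set (Fin n → ℝ) :=
  Set.univ.pi fun i => Set.Ico (I.corner i) (I.corner i + I.side)

/-- The rectangle `I × J` in `ℝⁿ × ℝᵐ`. -/
def rect {n m : ℕ} (I : Cube n) (J : Cube m) : Set ((Fin n → ℝ) × (Fin m → ℝ)) :=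
  I.toSet ×ˢ J.toSet

/-- A dyadic grid in `ℝⁿ`: a family of cubes whose side lengths are integer powers of two, such
that for each `k : ℤ` the cubes of side length `2 ^ k` partition `ℝⁿ`, and such that any two cubes
are nested or disjoint. -/
structure IsDyadicGrid {n : ℕ} (D : Set (Cube n)) : Prop where
  side_eq : ∀ I ∈ D, ∃ k : ℤ, I.side = (2 : ℝ) ^ k
  partition : ∀ (k : ℤ) (x : Fin n → ℝ),
    ∃! I : Cube n, I ∈ D ∧ I.side = (2 : ℝ) ^ k ∧ x ∈ I.toSet
  nested : ∀ I ∈ D, ∀ J ∈ D,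
    I.toSet ⊆ J.toSet ∨ J.toSet ⊆ I.toSet ∨ Disjoint I.toSet J.toSet

/-- The `L²`-normalised Haar functions of the interval `[a, a + s)`: for `ε = 0` the
non-cancellative one, for `ε = 1` the left half minus the right half. -/
def haarInterval (a s : ℝ) (ε : Fin 2) (t : ℝ) : ℝ :=
  (Real.sqrt s)⁻¹ *
    (if ε = 0 then (Set.Ico a (a + s)).indicator 1 t
     else (Set.Ico a (a + s / 2)).indicator 1 t - (Set.Ico (a + s / 2) (a + s)).indicator 1 t)

/-- The Haar function `h_I^η`, `η ∈ {0,1}ⁿ`; it is cancellative exactly if `η ≠ 0`. -/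
def haar {n : ℕ} (I : Cube n) (η : Fin n → Fin 2) (x : Fin n → ℝ) : ℝ :=
  ∏ i, haarInterval (I.corner i) I.side (η i) (x i)

/-- The partial pairing `⟨f, h⟩₁ (x₂) = ∫ f(y₁, x₂) h(y₁) dy₁`. -/
def pair₁ {n m : ℕ} (f : (Fin n → ℝ) × (Fin m → ℝ) → ℂ) (h : (Fin n → ℝ) → ℝ)
    (x₂ : Fin m → ℝ) : ℂ :=
  ∫ y₁, f (y₁, x₂) * (h y₁ : ℂ)

/-- The partial average `⟨g⟩_{I,1} (x₂) = |I|⁻¹ ∫_I g(y₁, x₂) dy₁`. -/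
def avg₁ {n m : ℕ} {F : Type*} [NormedAddCommGroup F] [NormedSpace ℝ F]
    (g : (Fin n → ℝ) × (Fin m → ℝ) → F) (I : Cube n) (x₂ : Fin m → ℝ) : F :=
  ⨍ y₁ in I.toSet, g (y₁, x₂)

/-- The average `|A|⁻¹ ∫_A g` of a `[0, ∞]`-valued function. -/
def lavg {α : Type*} [MeasureSpace α] (A : Set α) (g : α → ℝ≥0∞) : ℝ≥0∞ :=
  (∫⁻ x in A, g x) / volume A

/-- The dyadic maximal function `M_D g (x) = sup_{I ∈ D} 1_I(x) |I|⁻¹ ∫_I |g|`, with values in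
`[0, ∞]`. -/
def dyadicMax {n : ℕ} (D : Set (Cube n)) (g : (Fin n → ℝ) → ℂ) (x : Fin n → ℝ) : ℝ≥0∞ :=
  ⨆ I ∈ D, I.toSet.indicator (fun _ => lavg I.toSet fun y => ‖g y‖ₑ) x

/-- The measure `w dx`. -/
def wMeasure {n m : ℕ} (w : (Fin n → ℝ) × (Fin m → ℝ) → ℝ) :
    Measure ((Fin n → ℝ) × (Fin m → ℝ)) :=
  volume.withDensity fun x => ENNReal.ofReal (w x)

/-- The bi-parameter characteristic `[w]_{A_p} = sup_R ⟨w⟩_R ⟨w^{1-p'}⟩_R^{p-1}`, where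
`R` runs through all products of two cubes. -/
def apConst {n m : ℕ} (p : ℝ) (w : (Fin n → ℝ) × (Fin m → ℝ) → ℝ) : ℝ≥0∞ :=
  ⨆ (I : Cube n) (J : Cube m),
    lavg (rect I J) (fun x => ENNReal.ofReal (w x)) *
      lavg (rect I J) (fun x => ENNReal.ofReal (w x ^ (1 - p.conjExponent))) ^ (p - 1)

/-- `w ∈ A_p(ℝⁿ × ℝᵐ)`: a locally integrable, a.e. positive function of finite characteristic. -/
structure IsApWeight {n m : ℕ} (p : ℝ) (w : (Fin n → ℝ) × (Fin m → ℝ) → ℝ) : Prop where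
  locallyIntegrable : LocallyIntegrable w volume
  pos : ∀ᵐ x, 0 < w x
  apConst_lt_top : apConst p w < ∞

/-- The Bloom weight `ν = μ^{1/p} lam^{-1/p}`. -/
def bloomWeight {n m : ℕ} (p : ℝ) (μ lam : (Fin n → ℝ) × (Fin m → ℝ) → ℝ) :
    (Fin n → ℝ) × (Fin m → ℝ) → ℝ :=
  fun x => μ x ^ (1 / p) * lam x ^ (-(1 / p))

/-- The dyadic weighted little BMO norm
`sup_{R ∈ D × E} w(R)⁻¹ ∫_R |b - ⟨b⟩_R|`. -/
def bmoDyadicNorm {n m : ℕ} (D : Set (Cube n)) (E : Set (Cube m))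
    (w : (Fin n → ℝ) × (Fin m → ℝ) → ℝ) (b : (Fin n → ℝ) × (Fin m → ℝ) → ℂ) : ℝ≥0∞ :=
  ⨆ I ∈ D, ⨆ J ∈ E,
    (∫⁻ x in rect I J, ‖b x - ⨍ y in rect I J, b y‖ₑ) / wMeasure w (rect I J)

/-- The weighted little BMO norm: the supremum of the dyadic norms over all dyadic grids. -/
def bmoNorm {n m : ℕ} (w : (Fin n → ℝ) × (Fin m → ℝ) → ℝ)
    (b : (Fin n → ℝ) × (Fin m → ℝ) → ℂ) : ℝ≥0∞ :=
  ⨆ (D : Set (Cube n)) (_ : IsDyadicGrid D) (E : Set (Cube m)) (_ : IsDyadicGrid E),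
    bmoDyadicNorm D E w b

/-- `b ∈ bmo(w)`. -/
structure MemBmo {n m : ℕ} (w : (Fin n → ℝ) × (Fin m → ℝ) → ℝ)
    (b : (Fin n → ℝ) × (Fin m → ℝ) → ℂ) : Prop where
  locallyIntegrable : LocallyIntegrable b volume
  norm_lt_top : bmoNorm w b < ∞

/-- One summand `h_I^η ⊗ M_E(⟨f, h_I^η⟩₁) ⟨ν⟩_{I,1}` of `φ^{ν,1} f`. -/
def phiTerm {n m : ℕ} (E : Set (Cube m)) (ν : (Fin n → ℝ) × (Fin m → ℝ) → ℝ)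
    (f : (Fin n → ℝ) × (Fin m → ℝ) → ℂ) (I : Cube n) (η : Fin n → Fin 2)
    (x : (Fin n → ℝ) × (Fin m → ℝ)) : ℝ :=
  haar I η x.1 * ((dyadicMax E (pair₁ f (haar I η)) x.2).toReal * avg₁ ν I x.2)

/-- `φ` is the sum `φ^{ν,1} f = ∑_{I ∈ D} ∑_{η ∈ S I} h_I^η ⊗ M_E(⟨f, h_I^η⟩₁) ⟨ν⟩_{I,1}`, the
series converging unconditionally in `L^p(lam)` (which determines `φ` almost everywhere).
Here `S I` is the set of signatures used on `I`: a singleton if one Haar function is chosen on each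
cube, all of `{0,1}ⁿ ∖ {0}` if one sums over all cancellative Haar functions. -/
structure IsPhi {n m : ℕ} (D : Set (Cube n)) (E : Set (Cube m))
    (S : Cube n → Finset (Fin n → Fin 2)) (p : ℝ) (lam ν : (Fin n → ℝ) × (Fin m → ℝ) → ℝ)
    (f : (Fin n → ℝ) × (Fin m → ℝ) → ℂ) (φ : (Fin n → ℝ) × (Fin m → ℝ) → ℝ) : Prop where
  memLp : MemLp φ (ENNReal.ofReal p) (wMeasure lam)
  tendsto : Tendsto
    (fun s : Finset D =>
      eLpNorm (fun x => φ x - ∑ I ∈ s, ∑ η ∈ S I, phiTerm E ν f I η x)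
        (ENNReal.ofReal p) (wMeasure lam))
    atTop (𝓝 0)

end BiParam

end

/-! The norm bound is a duality argument. Write q = p' and λ for `lam`. Pairing a finite partial sum
of φ with g, moving the Haar functions onto g and using Cauchy–Schwarz over the pairs (I, η) at
every point bounds the pairing by ∫ A B ν. Here A and B are the square functions in the first
variable with coefficients M⟨f, h_I^η⟩₁ and |⟨g, h_I^η⟩₁|. Since ν = μ^{1/p} λ^{-1/p}, Hölder leaves
‖A‖ in L^p(μ) times ‖B‖ in L^q(λ^{1-q}), so everything rests on weighted bounds for these two square
functions.

Both come from Rubio de Francia extrapolation (`exists_extrapolation`), starting at exponent 2 with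
A₂ weights. There the weighted integral of the squared square function is a sum over I. For B a
Bellman function (`bellman_sum`) proves the one-variable estimate, applied on almost every fibre.
For A the maximal function is removed term by term with Muckenhoupt's theorem in the second variable
(`lintegral_sqFn_maxCoef_mul_le`), so no vector-valued maximal inequality is needed. The
extrapolation iterates the sum of the two one-variable maximal operators, and its weights are A₂ on
the fibres in both variables, which is all that the L² estimates use. In the other direction, the
A_p condition on rectangles passes to almost all fibres by Lebesgue differentiation
(`RectAp.fiberAp`).

For a finite set of cubes the duality bound involves only the square function over that set. The
full one has finite norm, so its tails vanish by dominated convergence and the series converges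
unconditionally (`exists_unconditional_sum`).

For the estimate with b, orthonormality of the Haar functions turns the integral on the right into
the average over J of M(⟨f, h_I^η⟩₁)⟨ν⟩_{I,1}. Put a = ⟨b⟩_{I,1}, V = ⟨ν⟩_{I,1} and F = |⟨f,
h_I^η⟩₁|. Little bmo gives ∫_{J'} |a - ⟨a⟩_{J'}| ≤ ‖b‖ ∫_{J'} V on all cubes J' of the grid, and the
claim becomes ∫_J |a - ⟨a⟩_J| F ≤ C ‖b‖ ∫_J MF · V. Stop at the dyadic subcubes on which the mean of
|a - ⟨a⟩_J| exceeds twice its mean over J. They cover at most half of J, and by A₂ the other half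
carries a fixed share of the V-mass of J, which pays for the unstopped part. The stopped cubes are
treated recursively. The charged sets are disjoint, so the constant does not grow with the number of
generations (`lintegral_level_sub_mul_le`). -/

namespace BiParam

/-! ### Cubes, dyadic grids and children. -/

section Cubes

variable {n : ℕ}

theorem Cube.mem_toSet {I : Cube n} {x : Fin n → ℝ} :
    x ∈ I.toSet ↔ ∀ i, I.corner i ≤ x i ∧ x i < I.corner i + I.side := by
  simp [Cube.toSet, Set.mem_pi]

theorem Cube.measurableSet_toSet (I : Cube n) : MeasurableSet I.toSet :=
  MeasurableSet.univ_pi fun _ => measurableSet_Ico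

theorem Cube.volume_toSet (I : Cube n) : volume I.toSet = ENNReal.ofReal (I.side ^ n) := by
  rw [Cube.toSet, Real.volume_pi_Ico]
  simp [ENNReal.ofReal_pow I.side_pos.le]

theorem Cube.volume_ne_zero (I : Cube n) : volume I.toSet ≠ 0 := by
  rw [I.volume_toSet]
  simpa using pow_pos I.side_pos n

theorem Cube.volume_ne_top (I : Cube n) : volume I.toSet ≠ ∞ := by
  rw [I.volume_toSet]
  exact ENNReal.ofReal_ne_top

theorem Cube.corner_mem (I : Cube n) : I.corner ∈ I.toSet :=
  Cube.mem_toSet.2 fun _ => ⟨le_rfl, by linarith [I.side_pos]⟩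

/-- Compare volumes. In dimension 0 all cubes are the same one-point set, whatever their side, hence
`0 < n`. -/
theorem Cube.side_le_of_subset (hn : 0 < n) {I J : Cube n} (h : I.toSet ⊆ J.toSet) :
    I.side ≤ J.side := by
  have h1 := measure_mono (μ := volume) h
  rw [I.volume_toSet, J.volume_toSet,
    ENNReal.ofReal_le_ofReal_iff (pow_pos J.side_pos n).le] at h1
  exact (pow_le_pow_iff_left₀ I.side_pos.le J.side_pos.le hn.ne').1 h1

/-- The cube `I` agrees up to a null set with a closed ball of the sup norm. -/
theorem Cube.toSet_ae_eq_closedBall (I : Cube n) :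
    I.toSet =ᵐ[volume] Metric.closedBall (fun i => I.corner i + I.side / 2) (I.side / 2) := by
  have h : Metric.closedBall (fun i => I.corner i + I.side / 2) (I.side / 2) =
      Set.Icc I.corner (fun i => I.corner i + I.side) := by
    rw [closedBall_pi _ (by linarith [I.side_pos]), ← Set.pi_univ_Icc]
    congr 1
    ext i : 1
    rw [Real.closedBall_eq_Icc]
    congr 1 <;> ring
  rw [h]
  exact Measure.univ_pi_Ico_ae_eq_Icc

theorem Cube.subset_closedBall (I : Cube n) :
    I.toSet ⊆ Metric.closedBall (fun i => I.corner i + I.side / 2) (I.side / 2) := by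
  intro x hx
  rw [closedBall_pi _ (by linarith [I.side_pos])]
  intro i _
  have := Cube.mem_toSet.1 hx i
  change x i ∈ Metric.closedBall _ _
  rw [Real.closedBall_eq_Icc]
  constructor <;> linarith [this.1, this.2]

theorem Cube.locallyIntegrable_integrableOn {F : Type*} [NormedAddCommGroup F]
    {a : (Fin n → ℝ) → F} (ha : LocallyIntegrable a volume) (I : Cube n) :
    IntegrableOn a I.toSet :=
  (ha.integrableOn_isCompact (isCompact_closedBall _ _)).mono_set I.subset_closedBall

namespace IsDyadicGrid

variable {D : Set (Cube n)} (hD : IsDyadicGrid D)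
include hD

theorem eq_of_mem {I J : Cube n} (hI : I ∈ D) (hJ : J ∈ D) (hs : I.side = J.side)
    {x : Fin n → ℝ} (hxI : x ∈ I.toSet) (hxJ : x ∈ J.toSet) : I = J := by
  obtain ⟨k, hk⟩ := hD.side_eq I hI
  exact (hD.partition k x).unique ⟨hI, hk, hxI⟩ ⟨hJ, hs ▸ hk, hxJ⟩

/-- If the larger cube J lay inside I, the sides would agree, and two cubes of one scale that share
a point are equal. -/
theorem subset_or_disjoint (hn : 0 < n) {I J : Cube n} (hI : I ∈ D) (hJ : J ∈ D)
    (hs : I.side ≤ J.side) : I.toSet ⊆ J.toSet ∨ Disjoint I.toSet J.toSet := by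
  rcases hD.nested I hI J hJ with h | h | h
  · exact Or.inl h
  · have : J = I := hD.eq_of_mem hJ hI (le_antisymm (Cube.side_le_of_subset hn h) hs)
      J.corner_mem (h J.corner_mem)
    exact Or.inl (this ▸ subset_rfl)
  · exact Or.inr h

theorem subset_of_mem (hn : 0 < n) {I J : Cube n} (hI : I ∈ D) (hJ : J ∈ D)
    (hs : I.side ≤ J.side) {x : Fin n → ℝ} (hxI : x ∈ I.toSet) (hxJ : x ∈ J.toSet) :
    I.toSet ⊆ J.toSet :=
  (hD.subset_or_disjoint hn hI hJ hs).resolve_right fun h => Set.disjoint_left.1 h hxI hxJ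

/-- A cube of the grid is determined by its scale and any one of its points, and every cube contains
a rational point. -/
theorem countable : D.Countable := by
  have hI : ∀ I : Cube n, ∃ q : Fin n → ℚ, (fun i => (q i : ℝ)) ∈ I.toSet := by
    intro I
    have : ∀ i, ∃ q : ℚ, I.corner i < q ∧ (q : ℝ) < I.corner i + I.side := fun i =>
      exists_rat_btwn (by linarith [I.side_pos])
    choose q hq using this
    exact ⟨q, Cube.mem_toSet.2 fun i => ⟨(hq i).1.le, (hq i).2⟩⟩
  choose q hq using hI
  choose! k hk using hD.side_eq
  refine Set.MapsTo.countable_of_injOn (f := fun I => (k I, q I))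
    (t := Set.univ) (fun _ _ => Set.mem_univ _) ?_ Set.countable_univ
  intro I hI J hJ hIJ
  simp only [Prod.mk.injEq] at hIJ
  refine hD.eq_of_mem hI hJ (by rw [hk I hI, hk J hJ, hIJ.1]) (hq I) ?_
  rw [hIJ.2]
  exact hq J

/-- The cube of side length `2 ^ k` of the grid containing `x`. -/
theorem exists_cube (k : ℤ) (x : Fin n → ℝ) :
    ∃ I ∈ D, I.side = (2 : ℝ) ^ k ∧ x ∈ I.toSet := by
  obtain ⟨I, ⟨h1, h2, h3⟩, -⟩ := hD.partition k x
  exact ⟨I, h1, h2, h3⟩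

end IsDyadicGrid

/-- The dyadic child of a cube `I` in the orthant given by `ε`. -/
noncomputable def Cube.child (I : Cube n) (ε : Fin n → Fin 2) : Cube n where
  corner i := I.corner i + if ε i = 0 then 0 else I.side / 2
  side := I.side / 2
  side_pos := half_pos I.side_pos

theorem Cube.child_subset (I : Cube n) (ε : Fin n → Fin 2) : (I.child ε).toSet ⊆ I.toSet := by
  intro x hx
  rw [Cube.mem_toSet] at hx ⊢
  intro i
  have h := hx i
  have hs := I.side_pos
  simp only [Cube.child] at h
  split_ifs at h <;> constructor <;> linarith [h.1, h.2]

theorem Cube.exists_mem_child {I : Cube n} {x : Fin n → ℝ} (hx : x ∈ I.toSet) :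
    ∃ ε, x ∈ (I.child ε).toSet := by
  refine ⟨fun i => if x i < I.corner i + I.side / 2 then 0 else 1, ?_⟩
  rw [Cube.mem_toSet] at hx ⊢
  intro i
  have h := hx i
  simp only [Cube.child]
  split_ifs with h1 h2 h2
  · constructor <;> linarith [h.1, h.2]
  · simp at h2
  · simp at h2
  · constructor <;> linarith [h.1, h.2]

theorem Cube.child_disjoint (I : Cube n) {ε ε' : Fin n → Fin 2} (h : ε ≠ ε') :
    Disjoint (I.child ε).toSet (I.child ε').toSet := by
  rw [Set.disjoint_left]
  intro x hx hx'
  refine h (funext fun i => ?_)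
  have h1 := Cube.mem_toSet.1 hx i
  have h2 := Cube.mem_toSet.1 hx' i
  simp only [Cube.child] at h1 h2
  have e1 : ε i = 0 ∨ ε i = 1 := by omega
  have e2 : ε' i = 0 ∨ ε' i = 1 := by omega
  rcases e1 with e1 | e1 <;> rcases e2 with e2 | e2 <;> rw [e1, e2] <;> exfalso <;>
    simp [e1, e2] at h1 h2 <;> linarith [h1.1, h1.2, h2.1, h2.2]

theorem Cube.iUnion_child (I : Cube n) : ⋃ ε, (I.child ε).toSet = I.toSet := by
  refine Set.Subset.antisymm (Set.iUnion_subset fun ε => I.child_subset ε) fun x hx => ?_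
  exact Set.mem_iUnion.2 (Cube.exists_mem_child hx)

theorem Cube.volume_child (I : Cube n) (ε : Fin n → Fin 2) :
    volume I.toSet = 2 ^ n * volume (I.child ε).toSet := by
  rw [Cube.volume_toSet, Cube.volume_toSet]
  have : I.side ^ n = 2 ^ n * (I.child ε).side ^ n := by
    simp only [Cube.child]
    rw [← mul_pow]
    congr 1
    ring
  rw [this, ENNReal.ofReal_mul (by positivity), ENNReal.ofReal_pow (by norm_num)]
  norm_num

theorem Cube.lintegral_eq_sum_child (I : Cube n) (f : (Fin n → ℝ) → ℝ≥0∞) :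
    ∫⁻ x in I.toSet, f x = ∑ ε, ∫⁻ x in (I.child ε).toSet, f x := by
  rw [← I.iUnion_child, lintegral_iUnion (fun ε => (I.child ε).measurableSet_toSet)
    (fun ε ε' h => I.child_disjoint h), tsum_fintype]

theorem Cube.integral_eq_sum_child {F : Type*} [NormedAddCommGroup F] [NormedSpace ℝ F]
    (I : Cube n) {f : (Fin n → ℝ) → F} (hf : IntegrableOn f I.toSet) :
    ∫ x in I.toSet, f x = ∑ ε, ∫ x in (I.child ε).toSet, f x := by
  rw [← integral_iUnion_fintype (fun ε => (I.child ε).measurableSet_toSet)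
    (fun ε ε' h => I.child_disjoint h) (fun ε => hf.mono_set (I.child_subset ε)), I.iUnion_child]

/-- The axioms of a grid only say that each scale partitions space and that cubes are nested or
disjoint; that a cube splits into its geometric halves has to be derived. Move `x` along the i-th
axis to the lower face of I: the half-size cube A found there has the i-th lower coordinate of I. A
cube C of the same size either contains points in the range of A, and then it equals A, or starts at
the midpoint. -/
theorem IsDyadicGrid.corner_eq_or {D : Set (Cube n)} (hD : IsDyadicGrid D) (hn : 0 < n)
    {I C : Cube n} (hI : I ∈ D) (hC : C ∈ D) (hs : C.side = I.side / 2) {x : Fin n → ℝ}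
    (hxI : x ∈ I.toSet) (hxC : x ∈ C.toSet) (i : Fin n) :
    C.corner i = I.corner i ∨ C.corner i = I.corner i + I.side / 2 := by
  have hpos := I.side_pos
  obtain ⟨k, hk⟩ := hD.side_eq C hC
  have key : ∀ z ∈ I.toSet, ∀ C' ∈ D, C'.side = I.side / 2 → z ∈ C'.toSet →
      ∀ i, I.corner i ≤ C'.corner i ∧ C'.corner i ≤ I.corner i + I.side / 2 := by
    intro z hz C' hC' hs' hzC' i
    have hsub : C'.toSet ⊆ I.toSet := hD.subset_of_mem hn hC' hI (by linarith) hzC' hz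
    refine ⟨(Cube.mem_toSet.1 (hsub C'.corner_mem) i).1, ?_⟩
    by_contra! hlt
    -- A half-size cube starting beyond the midpoint would contain a point on the excluded upper
    -- face of I, although it is contained in I.
    have hy : (fun j => if j = i then I.corner i + I.side else C'.corner j) ∈ C'.toSet := by
      rw [Cube.mem_toSet]
      intro j
      by_cases hj : j = i
      · subst hj
        have := (Cube.mem_toSet.1 (hsub C'.corner_mem) j).2
        simp only [if_true, hs']
        constructor <;> linarith
      · simp only [hj, if_false, hs']
        constructor <;> linarith
    have := (Cube.mem_toSet.1 (hsub hy) i).2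
    simp at this
  have hlow : ∀ z ∈ I.toSet, z i = I.corner i → ∀ C' ∈ D, C'.side = I.side / 2 →
      z ∈ C'.toSet → C'.corner i = I.corner i := by
    intro z hz hzi C' hC' hs' hzC'
    have h1 := (key z hz C' hC' hs' hzC' i).1
    have h2 := (Cube.mem_toSet.1 hzC' i).1
    linarith
  have hupd : ∀ z ∈ I.toSet, ∀ t, I.corner i ≤ t → t < I.corner i + I.side →
      Function.update z i t ∈ I.toSet := by
    intro z hz t h1 h2
    rw [Cube.mem_toSet] at hz ⊢
    intro j
    by_cases hj : j = i
    · subst hj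
      simpa using ⟨h1, h2⟩
    · simpa [hj] using hz j
  obtain ⟨A, hA, hAs, hxA⟩ := hD.exists_cube k (Function.update x i (I.corner i))
  have hxAI := hupd x hxI (I.corner i) le_rfl (by linarith)
  have hAs' : A.side = I.side / 2 := by rw [hAs, ← hk, hs]
  have hAc := hlow _ hxAI (by simp) A hA hAs' hxA
  by_cases hx : x i < I.corner i + I.side / 2
  · left
    have : x ∈ A.toSet := by
      rw [Cube.mem_toSet] at hxA ⊢
      intro j
      by_cases hj : j = i
      · subst hj
        rw [hAc, hAs']
        exact ⟨(Cube.mem_toSet.1 hxI j).1, hx⟩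
      · simpa [hj] using hxA j
    rw [← hAc, hD.eq_of_mem hC hA (by rw [hs, hAs']) hxC this]
  · right
    push Not at hx
    have h1 := (key x hxI C hC hs hxC i)
    by_contra hne
    have hlt : C.corner i < I.corner i + I.side / 2 := lt_of_le_of_ne h1.2 hne
    set t := C.corner i with ht
    have hz1 : Function.update x i t ∈ C.toSet := by
      rw [Cube.mem_toSet] at hxC ⊢
      intro j
      by_cases hj : j = i
      · subst hj
        simp only [Function.update_self]
        constructor <;> linarith [C.side_pos]
      · simpa [hj] using hxC j
    have hz2 : Function.update x i t ∈ A.toSet := by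
      rw [Cube.mem_toSet] at hxA ⊢
      intro j
      by_cases hj : j = i
      · subst hj
        simp only [Function.update_self]
        rw [hAc, hAs']
        exact ⟨h1.1, hlt⟩
      · simpa [hj] using hxA j
    have hCA := hD.eq_of_mem hC hA (by rw [hs, hAs']) hz1 hz2
    have := (Cube.mem_toSet.1 hxC i).2
    rw [hCA, hAc, hAs'] at this
    linarith

/-- Take the grid cube of half the side through the lower corner of the child. Each coordinate of
its own corner has only two possible values, and containing that point excludes the wrong one. -/
theorem IsDyadicGrid.child_mem {D : Set (Cube n)} (hD : IsDyadicGrid D) (hn : 0 < n)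
    {I : Cube n} (hI : I ∈ D) (ε : Fin n → Fin 2) : I.child ε ∈ D := by
  obtain ⟨k, hk⟩ := hD.side_eq I hI
  obtain ⟨C, hC, hCs, hxC⟩ := hD.exists_cube (k - 1) (I.child ε).corner
  have hs : C.side = I.side / 2 := by
    rw [hCs, hk, zpow_sub_one₀ (by norm_num)]
    ring
  have hxI := I.child_subset ε (I.child ε).corner_mem
  have : C = I.child ε := by
    refine Cube.ext (funext fun i => ?_) (by rw [hs]; rfl)
    have h1 := Cube.mem_toSet.1 hxC i
    have hpos := I.side_pos
    rcases hD.corner_eq_or hn hI hC hs hxI hxC i with h | h <;> rw [h, hs] at h1 <;> rw [h] <;>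
      simp only [Cube.child] at h1 ⊢ <;> split_ifs at h1 ⊢ <;> linarith [h1.1, h1.2]
  exact this ▸ hC

/-- **Lebesgue's differentiation theorem** along the cubes of a dyadic grid. -/
theorem ae_tendsto_average_cube {F : Type*} [NormedAddCommGroup F] [NormedSpace ℝ F]
    [CompleteSpace F] {a : (Fin n → ℝ) → F} (ha : LocallyIntegrable a volume) :
    ∀ᵐ x, ∀ Q : ℕ → Cube n, (∀ N, x ∈ (Q N).toSet) →
      Tendsto (fun N => (Q N).side) atTop (𝓝 0) →
      Tendsto (fun N => ⨍ y in (Q N).toSet, a y) atTop (𝓝 (a x)) := by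
  filter_upwards [IsUnifLocDoublingMeasure.ae_tendsto_average (μ := volume) ha 1]
    with x hx Q hxQ hQ
  have h := hx (l := atTop) (fun N i => (Q N).corner i + (Q N).side / 2)
    (fun N => (Q N).side / 2) ?_ ?_
  · refine h.congr fun N => ?_
    rw [setAverage_congr (Q N).toSet_ae_eq_closedBall]
  · refine tendsto_nhdsWithin_iff.2 ⟨by simpa using hQ.div_const 2, ?_⟩
    exact Eventually.of_forall fun N => half_pos (Q N).side_pos
  · refine Eventually.of_forall fun N => ?_
    rw [one_mul]
    exact (Q N).subset_closedBall (hxQ N)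

end Cubes

end BiParam

namespace BiParam

/-! ### The dyadic maximal function with respect to a measure. -/

section Maximal

variable {n : ℕ}

/-- The dyadic maximal function with respect to the measure `ω`. -/
noncomputable def maxM (ω : Measure (Fin n → ℝ)) (D : Set (Cube n)) (g : (Fin n → ℝ) → ℝ≥0∞)
    (x : Fin n → ℝ) : ℝ≥0∞ :=
  ⨆ I ∈ D, I.toSet.indicator (fun _ => (∫⁻ y in I.toSet, g y ∂ω) / ω I.toSet) x

theorem dyadicMax_eq (D : Set (Cube n)) (g : (Fin n → ℝ) → ℂ) :
    dyadicMax D g = maxM volume D (fun y => ‖g y‖ₑ) := rfl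

variable {ω : Measure (Fin n → ℝ)} {D : Set (Cube n)}

theorem le_maxM {I : Cube n} (hI : I ∈ D) {x : Fin n → ℝ} (hx : x ∈ I.toSet)
    (g : (Fin n → ℝ) → ℝ≥0∞) : (∫⁻ y in I.toSet, g y ∂ω) / ω I.toSet ≤ maxM ω D g x := by
  refine le_iSup₂_of_le I hI ?_
  simp [Set.indicator_of_mem hx]

theorem maxM_le {g : (Fin n → ℝ) → ℝ≥0∞} {x : Fin n → ℝ} {c : ℝ≥0∞}
    (h : ∀ I ∈ D, x ∈ I.toSet → (∫⁻ y in I.toSet, g y ∂ω) / ω I.toSet ≤ c) :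
    maxM ω D g x ≤ c := by
  refine iSup₂_le fun I hI => ?_
  by_cases hx : x ∈ I.toSet
  · simpa [hx] using h I hI hx
  · simp [hx]

theorem lt_maxM_iff {g : (Fin n → ℝ) → ℝ≥0∞} {x : Fin n → ℝ} {c : ℝ≥0∞} :
    c < maxM ω D g x ↔
      ∃ I ∈ D, x ∈ I.toSet ∧ c < (∫⁻ y in I.toSet, g y ∂ω) / ω I.toSet := by
  simp only [maxM, lt_iSup_iff]
  constructor
  · rintro ⟨I, hI, h⟩
    by_cases hx : x ∈ I.toSet
    · exact ⟨I, hI, hx, by simpa [hx] using h⟩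
    · simp [hx] at h
  · rintro ⟨I, hI, hx, h⟩
    exact ⟨I, hI, by simpa [hx] using h⟩

theorem measurable_maxM (hc : D.Countable) (g : (Fin n → ℝ) → ℝ≥0∞) :
    Measurable (maxM ω D g) := by
  have : Countable D := hc.to_subtype
  exact Measurable.biSup D hc fun I _ => measurable_const.indicator I.measurableSet_toSet

theorem maxM_mono {g g' : (Fin n → ℝ) → ℝ≥0∞} (h : g ≤ᵐ[ω] g') (x : Fin n → ℝ) :
    maxM ω D g x ≤ maxM ω D g' x := by
  refine maxM_le fun I hI hx => le_trans ?_ (le_maxM hI hx g')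
  exact ENNReal.div_le_div_right (lintegral_mono_ae (ae_restrict_of_ae h)) _

theorem maxM_congr {g g' : (Fin n → ℝ) → ℝ≥0∞} (h : g =ᵐ[ω] g') :
    maxM ω D g = maxM ω D g' :=
  funext fun x => le_antisymm (maxM_mono h.le x) (maxM_mono h.symm.le x)

/-- Weak type inequality for finitely many cubes. -/
theorem mul_measure_biUnion_le (hD : IsDyadicGrid D) (hn : 0 < n) (g : (Fin n → ℝ) → ℝ≥0∞)
    (t : ℝ≥0∞) (s : Finset (Cube n)) (hs : ∀ I ∈ s, I ∈ D ∧ t * ω I.toSet ≤ ∫⁻ y in I.toSet, g y ∂ω) :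
    t * ω (⋃ I ∈ s, I.toSet) ≤ ∫⁻ y in ⋃ I ∈ s, I.toSet, g y ∂ω := by
  classical
  -- The cube added last is the smallest, so it is either swallowed by an earlier cube or disjoint
  -- from all of them; no maximal cubes have to be selected.
  induction s using Finset.induction_on_min_value (fun I : Cube n => I.side) with
  | empty => simp
  | insert a s ha hmin ih =>
    have ih := ih fun I hI => hs I (Finset.mem_insert_of_mem hI)
    have haD := hs a (Finset.mem_insert_self a s)
    rw [Finset.set_biUnion_insert]
    by_cases h : ∃ J ∈ s, a.toSet ⊆ J.toSet
    · obtain ⟨J, hJ, hsub⟩ := h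
      rw [Set.union_eq_self_of_subset_left
        (fun x hx => Set.mem_iUnion₂.2 ⟨J, hJ, hsub hx⟩)]
      exact ih
    · push Not at h
      have hdisj : Disjoint a.toSet (⋃ I ∈ s, I.toSet) := by
        rw [Set.disjoint_iUnion₂_right]
        intro J hJ
        exact (hD.subset_or_disjoint hn haD.1 (hs J (Finset.mem_insert_of_mem hJ)).1
          (hmin J hJ)).resolve_left (h J hJ)
      have hmeas : MeasurableSet (⋃ I ∈ s, I.toSet) :=
        Finset.measurableSet_biUnion s fun I _ => I.measurableSet_toSet
      rw [measure_union hdisj hmeas, lintegral_union hmeas hdisj, mul_add]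
      exact add_le_add haD.2 ih

/-- The weak type `(1,1)` inequality of the dyadic maximal function. -/
theorem mul_measure_lt_maxM_le (hD : IsDyadicGrid D) (hn : 0 < n)
    (hω0 : ∀ I ∈ D, ω I.toSet ≠ 0) (hωt : ∀ I ∈ D, ω I.toSet ≠ ∞)
    (g : (Fin n → ℝ) → ℝ≥0∞) (t : ℝ≥0∞) :
    t * ω {x | t < maxM ω D g x} ≤ ∫⁻ y, g y ∂ω := by
  classical
  set G : Set (Cube n) := {I | I ∈ D ∧ t * ω I.toSet ≤ ∫⁻ y in I.toSet, g y ∂ω} with hG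
  have hGc : G.Countable := hD.countable.mono fun I hI => hI.1
  have hsub : {x | t < maxM ω D g x} ⊆ ⋃ I ∈ G, I.toSet := by
    intro x hx
    obtain ⟨I, hI, hxI, h⟩ := lt_maxM_iff.1 hx
    refine Set.mem_biUnion (show I ∈ G from ⟨hI, ?_⟩) hxI
    exact ((ENNReal.lt_div_iff_mul_lt (Or.inl (hω0 I hI)) (Or.inl (hωt I hI))).1 h).le
  refine (mul_le_mul_right (measure_mono hsub) t).trans ?_
  have : Countable G := hGc.to_subtype
  -- The countable union is a directed union of finite ones, so continuity from below reduces the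
  -- claim to finitely many cubes.
  rw [Set.biUnion_eq_iUnion, Set.iUnion_eq_iUnion_finset, Directed.measure_iUnion,
    ENNReal.mul_iSup]
  · refine iSup_le fun s => ?_
    have h := mul_measure_biUnion_le hD hn g t (s.image (fun I : G => (I : Cube n))) (ω := ω)
      (by
        intro I hI
        obtain ⟨J, -, rfl⟩ := Finset.mem_image.1 hI
        exact J.2)
    rw [Finset.set_biUnion_finset_image] at h
    exact h.trans (setLIntegral_le_lintegral _ _)
  · exact (Monotone.directed_le fun s t hst => Set.biUnion_subset_biUnion_left hst)

/-- The dyadic maximal function with respect to `ω` is bounded on `L^r(ω)`, `r > 1`. -/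
theorem lintegral_maxM_rpow_le (hD : IsDyadicGrid D) (hn : 0 < n) [SFinite ω]
    (hω0 : ∀ I ∈ D, ω I.toSet ≠ 0) (hωt : ∀ I ∈ D, ω I.toSet ≠ ∞) {r : ℝ} (hr : 1 < r)
    {g : (Fin n → ℝ) → ℝ≥0∞} (hg : Measurable g) :
    ∫⁻ x, maxM ω D g x ^ r ∂ω ≤
      ENNReal.ofReal (r * 2 * (2 ^ (r - 1) / (r - 1))) * ∫⁻ x, g x ^ r ∂ω := by
  have hMm : Measurable (maxM ω D g) := measurable_maxM hD.countable g
  -- Marcinkiewicz splitting at height t/2: the low part of `g` adds at most t/2 to the maximal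
  -- function, and the weak type bound at level t/2 is applied to the high part.
  have hweak : ∀ t : ℝ, 0 < t → ω {x | ENNReal.ofReal t < maxM ω D g x} ≤
      ENNReal.ofReal (2 / t) * ∫⁻ x, {x | ENNReal.ofReal (t / 2) < g x}.indicator g x ∂ω := by
    intro t ht
    set A := {x | ENNReal.ofReal (t / 2) < g x} with hA
    have hAm : MeasurableSet A := measurableSet_lt measurable_const hg
    have hle : ∀ x, maxM ω D g x ≤ ENNReal.ofReal (t / 2) + maxM ω D (A.indicator g) x := by
      intro x
      refine maxM_le fun I hI hx => ?_
      have h1 : ∫⁻ y in I.toSet, g y ∂ω ≤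
          ENNReal.ofReal (t / 2) * ω I.toSet + ∫⁻ y in I.toSet, A.indicator g y ∂ω := by
        rw [← setLIntegral_const, ← lintegral_add_left measurable_const]
        refine lintegral_mono fun y => ?_
        by_cases hy : y ∈ A
        · simp [hy]
        · simp only [hy, not_false_eq_true, Set.indicator_of_notMem, add_zero]
          simpa [hA] using hy
      calc (∫⁻ y in I.toSet, g y ∂ω) / ω I.toSet
          ≤ (ENNReal.ofReal (t / 2) * ω I.toSet + ∫⁻ y in I.toSet, A.indicator g y ∂ω) /
            ω I.toSet := by gcongr
        _ = ENNReal.ofReal (t / 2) + (∫⁻ y in I.toSet, A.indicator g y ∂ω) / ω I.toSet := by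
            rw [ENNReal.add_div, ENNReal.mul_div_cancel_right (hω0 I hI) (hωt I hI)]
        _ ≤ _ := by gcongr; exact le_maxM hI hx _
    have hsub : {x | ENNReal.ofReal t < maxM ω D g x} ⊆
        {x | ENNReal.ofReal (t / 2) < maxM ω D (A.indicator g) x} := by
      intro x hx
      simp only [Set.mem_ofPred_eq] at hx ⊢
      have h1 := hx.trans_le (hle x)
      have h2 : ENNReal.ofReal t = ENNReal.ofReal (t / 2) + ENNReal.ofReal (t / 2) := by
        rw [← ENNReal.ofReal_add (by positivity) (by positivity)]
        congr 1
        ring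
      rw [h2] at h1
      exact (ENNReal.add_lt_add_iff_left ENNReal.ofReal_ne_top).1 h1
    have h3 := mul_measure_lt_maxM_le hD hn hω0 hωt (A.indicator g) (ENNReal.ofReal (t / 2))
    calc ω {x | ENNReal.ofReal t < maxM ω D g x}
        ≤ ω {x | ENNReal.ofReal (t / 2) < maxM ω D (A.indicator g) x} := measure_mono hsub
      _ = ENNReal.ofReal (2 / t) * (ENNReal.ofReal (t / 2) *
            ω {x | ENNReal.ofReal (t / 2) < maxM ω D (A.indicator g) x}) := by
          rw [← mul_assoc, ← ENNReal.ofReal_mul (by positivity)]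
          rw [show 2 / t * (t / 2) = 1 by field_simp]
          simp
      _ ≤ _ := by gcongr
  -- This is the integral of (2/t) c t^{r-1} over 0 < t < 2c, which converges at 0 because r > 1.
  have hinner : ∀ c : ℝ≥0∞, ∫⁻ t in Set.Ioi (0 : ℝ), ENNReal.ofReal (2 / t) *
      (if ENNReal.ofReal (t / 2) < c then c else 0) * ENNReal.ofReal (t ^ (r - 1)) ≤
      ENNReal.ofReal (2 * (2 ^ (r - 1) / (r - 1))) * c ^ r := by
    intro c
    by_cases hc : c = ∞
    · have h0 : (0 : ℝ) < 2 * (2 ^ (r - 1) / (r - 1)) := by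
        have : 0 < r - 1 := by linarith
        positivity
      rw [hc, ENNReal.top_rpow_of_pos (by linarith), ENNReal.mul_top]
      · exact le_top
      · simpa using h0
    lift c to ℝ≥0 using hc
    have h1 : ∀ t ∈ Set.Ioi (0 : ℝ), ENNReal.ofReal (2 / t) *
        (if ENNReal.ofReal (t / 2) < (c : ℝ≥0∞) then (c : ℝ≥0∞) else 0) *
          ENNReal.ofReal (t ^ (r - 1)) =
        (Set.Ioo (0 : ℝ) (2 * c)).indicator
          (fun t => ENNReal.ofReal (2 * c) * ENNReal.ofReal (t ^ (r - 2))) t := by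
      intro t ht
      have ht0 : (0 : ℝ) < t := ht
      have hiff : ENNReal.ofReal (t / 2) < (c : ℝ≥0∞) ↔ t ∈ Set.Ioo (0 : ℝ) (2 * c) := by
        rw [ENNReal.ofReal_lt_coe_iff (by positivity), Set.mem_Ioo]
        constructor
        · intro h
          exact ⟨ht0, by linarith⟩
        · intro h
          linarith [h.2]
      by_cases h : t ∈ Set.Ioo (0 : ℝ) (2 * c)
      · rw [if_pos (hiff.2 h), Set.indicator_of_mem h, ← ENNReal.ofReal_coe_nnreal,
          ← ENNReal.ofReal_mul (by positivity), ← ENNReal.ofReal_mul (by positivity),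
          ← ENNReal.ofReal_mul (by positivity)]
        congr 1
        rw [show r - 1 = (r - 2) + 1 by ring, Real.rpow_add_one ht0.ne']
        field_simp
      · rw [if_neg (fun h' => h (hiff.1 h')), Set.indicator_of_notMem h]
        simp
    rw [setLIntegral_congr_fun measurableSet_Ioi h1, lintegral_indicator measurableSet_Ioo,
      Measure.restrict_restrict measurableSet_Ioo,
      Set.inter_eq_left.2 (fun t ht => ht.1), lintegral_const_mul' _ _ ENNReal.ofReal_ne_top]
    have hc0 : (0 : ℝ) ≤ 2 * c := by positivity
    have hint : IntegrableOn (fun t : ℝ => t ^ (r - 2)) (Set.Ioc 0 (2 * c)) :=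
      (intervalIntegrable_iff_integrableOn_Ioc_of_le hc0).1
        (intervalIntegral.intervalIntegrable_rpow' (by linarith))
    rw [Measure.restrict_congr_set Ioo_ae_eq_Ioc, ← ofReal_integral_eq_lintegral_ofReal hint
      ((ae_restrict_iff' measurableSet_Ioc).2
        (Eventually.of_forall fun t ht => Real.rpow_nonneg ht.1.le _)),
      ← intervalIntegral.integral_of_le hc0, integral_rpow (Or.inl (by linarith)),
      Real.zero_rpow (by linarith), sub_zero, show r - 2 + 1 = r - 1 by ring,
      ← ENNReal.ofReal_coe_nnreal, ENNReal.ofReal_rpow_of_nonneg c.coe_nonneg (by linarith),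
      ← ENNReal.ofReal_mul (by positivity), ← ENNReal.ofReal_mul (by
        have : 0 < r - 1 := by linarith
        positivity)]
    refine le_of_eq ?_
    congr 1
    rw [Real.mul_rpow (by norm_num) c.coe_nonneg]
    rcases eq_or_ne (c : ℝ) 0 with h0 | h0
    · rw [h0, Real.zero_rpow (by linarith : r ≠ 0)]
      simp
    · rw [show (c : ℝ) ^ r = (c : ℝ) ^ (r - 1) * c by
        rw [← Real.rpow_add_one h0]; congr 1; ring]
      ring
  -- The layer-cake formula is used for real-valued functions, hence the truncation at height N;
  -- monotone convergence removes it below.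
  have htrunc : ∀ N : ℕ, ∫⁻ x, (min (maxM ω D g x) N) ^ r ∂ω ≤
      ENNReal.ofReal (r * 2 * (2 ^ (r - 1) / (r - 1))) * ∫⁻ x, g x ^ r ∂ω := by
    intro N
    have hfin : ∀ x, min (maxM ω D g x) N ≠ ∞ := fun x =>
      ne_top_of_le_ne_top (ENNReal.natCast_ne_top N) (min_le_right _ _)
    have hmeas : Measurable fun x => (min (maxM ω D g x) N).toReal :=
      (hMm.min measurable_const).ennreal_toReal
    have h1 := lintegral_rpow_eq_lintegral_meas_lt_mul ω
      (f := fun x => (min (maxM ω D g x) N).toReal)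
      (Eventually.of_forall fun x => ENNReal.toReal_nonneg) hmeas.aemeasurable
      (show 0 < r by linarith)
    have h2 : ∫⁻ x, (min (maxM ω D g x) N) ^ r ∂ω =
        ∫⁻ x, ENNReal.ofReal ((min (maxM ω D g x) N).toReal ^ r) ∂ω := by
      refine lintegral_congr fun x => ?_
      rw [← ENNReal.ofReal_rpow_of_nonneg ENNReal.toReal_nonneg (by linarith),
        ENNReal.ofReal_toReal (hfin x)]
    rw [h2, h1, mul_assoc r, ENNReal.ofReal_mul (by linarith), mul_assoc]
    gcongr
    calc ∫⁻ t in Set.Ioi (0 : ℝ), ω {a | t < (min (maxM ω D g a) N).toReal} *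
          ENNReal.ofReal (t ^ (r - 1))
        ≤ ∫⁻ t in Set.Ioi (0 : ℝ), (∫⁻ x, ENNReal.ofReal (2 / t) *
            (if ENNReal.ofReal (t / 2) < g x then g x else 0) *
              ENNReal.ofReal (t ^ (r - 1)) ∂ω) := by
          refine setLIntegral_mono_ae' measurableSet_Ioi (Eventually.of_forall fun t ht => ?_)
          have ht0 : (0 : ℝ) < t := ht
          rw [lintegral_mul_const' _ _ ENNReal.ofReal_ne_top,
            lintegral_const_mul' _ _ ENNReal.ofReal_ne_top]
          gcongr
          refine le_trans (measure_mono ?_) ((hweak t ht0).trans_eq (by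
            simp only [Set.indicator_apply, Set.mem_ofPred_eq]))
          intro a ha
          simp only [Set.mem_ofPred_eq] at ha ⊢
          exact ((ENNReal.ofReal_lt_iff_lt_toReal ht0.le (hfin a)).2 ha).trans_le (min_le_left _ _)
      _ = ∫⁻ x, (∫⁻ t in Set.Ioi (0 : ℝ), ENNReal.ofReal (2 / t) *
            (if ENNReal.ofReal (t / 2) < g x then g x else 0) *
              ENNReal.ofReal (t ^ (r - 1))) ∂ω := by
          refine lintegral_lintegral_swap (Measurable.aemeasurable ?_)
          have e1 : Measurable fun z : ℝ × (Fin n → ℝ) => g z.2 := hg.comp measurable_snd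
          refine (Measurable.mul ?_ ?_).mul ?_
          · fun_prop
          · refine Measurable.ite (measurableSet_lt ?_ e1) e1 measurable_const
            fun_prop
          · fun_prop
      _ ≤ ∫⁻ x, ENNReal.ofReal (2 * (2 ^ (r - 1) / (r - 1))) * g x ^ r ∂ω :=
          lintegral_mono fun x => hinner (g x)
      _ = _ := lintegral_const_mul' _ _ ENNReal.ofReal_ne_top
  have hlim : ∫⁻ x, maxM ω D g x ^ r ∂ω = ⨆ N : ℕ, ∫⁻ x, (min (maxM ω D g x) N) ^ r ∂ω := by
    rw [← lintegral_iSup]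
    · refine lintegral_congr fun x => ?_
      have hmono : Monotone fun N : ℕ => (min (maxM ω D g x) N) := fun a b hab =>
        min_le_min le_rfl (by exact_mod_cast hab)
      have : maxM ω D g x = ⨆ N : ℕ, min (maxM ω D g x) N := by
        rw [← inf_iSup_eq, ENNReal.iSup_natCast]
        simp
      conv_lhs => rw [this]
      exact (ENNReal.monotone_rpow_of_nonneg (by linarith : 0 ≤ r)).map_iSup_of_continuousAt
        ENNReal.continuous_rpow_const.continuousAt (by simp; linarith)
    · intro N
      exact (hMm.min measurable_const).pow_const r
    · intro a b hab x
      exact ENNReal.rpow_le_rpow (min_le_min le_rfl (by exact_mod_cast hab)) (by linarith)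
  rw [hlim]
  exact iSup_le htrunc

end Maximal

end BiParam

namespace BiParam

/-! ### Muckenhoupt's theorem for the dyadic maximal function. -/

section WeightedMaximal

variable {n : ℕ}

/-- The joint dyadic `A_p` condition of a pair of weights. -/
def JointAp (D : Set (Cube n)) (p : ℝ) (Q : ℝ≥0∞) (w σ : (Fin n → ℝ) → ℝ≥0∞) : Prop :=
  ∀ I ∈ D, (∫⁻ x in I.toSet, w x) * (∫⁻ x in I.toSet, σ x) ^ (p - 1) ≤ Q * volume I.toSet ^ p

/-- Raise the condition to the power q - 1 and use (p - 1)(q - 1) = 1. -/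
theorem JointAp.symm {D : Set (Cube n)} {p q : ℝ} (hpq : p.HolderConjugate q) {Q : ℝ≥0∞}
    {w σ : (Fin n → ℝ) → ℝ≥0∞} (h : JointAp D p Q w σ) : JointAp D q (Q ^ (q - 1)) σ w := by
  intro I hI
  have h1 := ENNReal.rpow_le_rpow (h I hI) hpq.symm.sub_one_pos.le
  have e1 : (p - 1) * (q - 1) = 1 := by
    have := hpq.mul_eq_add
    linarith
  have e2 : p * (q - 1) = q := by
    have := hpq.mul_eq_add
    linarith
  rw [ENNReal.mul_rpow_of_nonneg _ _ hpq.symm.sub_one_pos.le,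
    ENNReal.mul_rpow_of_nonneg _ _ hpq.symm.sub_one_pos.le, ← ENNReal.rpow_mul,
    ← ENNReal.rpow_mul, e1, e2, ENNReal.rpow_one] at h1
  rwa [mul_comm]

theorem setLIntegral_cube_ne_zero {w : (Fin n → ℝ) → ℝ≥0∞} (hw : Measurable w)
    (hw0 : ∀ x, w x ≠ 0) (I : Cube n) : ∫⁻ x in I.toSet, w x ≠ 0 := by
  rw [← pos_iff_ne_zero, setLIntegral_pos_iff hw]
  have : Function.support w = Set.univ := Set.eq_univ_of_forall hw0
  rw [this, Set.univ_inter]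
  exact pos_iff_ne_zero.2 I.volume_ne_zero

/-- The dual weight has positive mass on I, so infinite mass of `w` would make the left side of the
A_p condition infinite. -/
theorem JointAp.left_ne_top {D : Set (Cube n)} {p : ℝ} (hp : 1 < p) {Q : ℝ≥0∞} (hQ : Q ≠ ∞)
    {w σ : (Fin n → ℝ) → ℝ≥0∞} (hσ : Measurable σ) (hσ0 : ∀ x, σ x ≠ 0)
    (h : JointAp D p Q w σ) {I : Cube n} (hI : I ∈ D) : ∫⁻ x in I.toSet, w x ≠ ∞ := by
  intro htop
  have h1 := h I hI
  have h2 : (∫⁻ x in I.toSet, σ x) ^ (p - 1) ≠ 0 := by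
    intro h0
    rcases ENNReal.rpow_eq_zero_iff.1 h0 with h0 | h0
    · exact setLIntegral_cube_ne_zero hσ hσ0 I h0.1
    · linarith [h0.2]
  rw [htop, ENNReal.top_mul h2, top_le_iff] at h1
  exact ENNReal.mul_ne_top hQ
    (ENNReal.rpow_ne_top_of_nonneg (by linarith) I.volume_ne_top) h1

/-- The constant in the weighted inequality for the dyadic maximal function. -/
noncomputable def maxConst (p q : ℝ) (Q : ℝ≥0∞) : ℝ≥0∞ :=
  Q ^ q * ENNReal.ofReal (q * 2 * (2 ^ (q - 1) / (q - 1))) *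
    ENNReal.ofReal (p * 2 * (2 ^ (p - 1) / (p - 1)))

theorem maxConst_ne_top {p q : ℝ} (hpq : p.HolderConjugate q) {Q : ℝ≥0∞} (hQ : Q ≠ ∞) :
    maxConst p q Q ≠ ∞ :=
  ENNReal.mul_ne_top (ENNReal.mul_ne_top
    (ENNReal.rpow_ne_top_of_nonneg hpq.symm.nonneg hQ) ENNReal.ofReal_ne_top)
    ENNReal.ofReal_ne_top

/-- Muckenhoupt's theorem for the dyadic maximal function. -/
theorem lintegral_maxM_rpow_mul_le {D : Set (Cube n)} (hD : IsDyadicGrid D) (hn : 0 < n)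
    {p q : ℝ} (hpq : p.HolderConjugate q) {Q : ℝ≥0∞} (hQ : Q ≠ ∞)
    {w : (Fin n → ℝ) → ℝ≥0∞} (hw : Measurable w) (hw0 : ∀ x, w x ≠ 0) (hwt : ∀ x, w x ≠ ∞)
    (hAp : JointAp D p Q w (fun x => w x ^ (1 - q)))
    {g : (Fin n → ℝ) → ℝ≥0∞} (hg : Measurable g) :
    ∫⁻ x, maxM volume D g x ^ p * w x ≤ maxConst p q Q * ∫⁻ x, g x ^ p * w x := by
  have hp := hpq.lt
  have hq := hpq.symm.lt
  have hmul := hpq.mul_eq_add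
  set σ : (Fin n → ℝ) → ℝ≥0∞ := fun x => w x ^ (1 - q) with hσdef
  have hσ : Measurable σ := hw.pow_const _
  have hσ0 : ∀ x, σ x ≠ 0 := fun x => by
    simp [hσdef, ENNReal.rpow_eq_zero_iff, hw0 x, hwt x]
  have hσt : ∀ x, σ x ≠ ∞ := fun x => by
    simp [hσdef, ENNReal.rpow_eq_top_iff, hw0 x, hwt x]
  set ωw := (volume : Measure (Fin n → ℝ)).withDensity w with hωw
  set ωσ := (volume : Measure (Fin n → ℝ)).withDensity σ with hωσ
  have evw : ∀ I : Cube n, ωw I.toSet = ∫⁻ x in I.toSet, w x := fun I =>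
    withDensity_apply _ I.measurableSet_toSet
  have evσ : ∀ I : Cube n, ωσ I.toSet = ∫⁻ x in I.toSet, σ x := fun I =>
    withDensity_apply _ I.measurableSet_toSet
  have hw_ne0 : ∀ I ∈ D, ωw I.toSet ≠ 0 := fun I _ => by
    rw [evw]; exact setLIntegral_cube_ne_zero hw hw0 I
  have hσ_ne0 : ∀ I ∈ D, ωσ I.toSet ≠ 0 := fun I _ => by
    rw [evσ]; exact setLIntegral_cube_ne_zero hσ hσ0 I
  have hw_net : ∀ I ∈ D, ωw I.toSet ≠ ∞ := fun I hI => by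
    rw [evw]; exact hAp.left_ne_top hp hQ hσ hσ0 hI
  have hσ_net : ∀ I ∈ D, ωσ I.toSet ≠ ∞ := fun I hI => by
    rw [evσ]
    exact (hAp.symm hpq).left_ne_top hq
      (ENNReal.rpow_ne_top_of_nonneg (by linarith) hQ) hw hw0 hI
  set fσ : (Fin n → ℝ) → ℝ≥0∞ := fun x => g x * (σ x)⁻¹ with hfσ
  have hfσm : Measurable fσ := hg.mul hσ.inv
  set Φ : (Fin n → ℝ) → ℝ≥0∞ := fun x => maxM ωσ D fσ x ^ (p - 1) with hΦ
  have hΦm : Measurable Φ := (measurable_maxM hD.countable _).pow_const _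
  set Ψ : (Fin n → ℝ) → ℝ≥0∞ := fun x => Φ x * (w x)⁻¹ with hΨ
  have hΨm : Measurable Ψ := hΦm.mul hw.inv
  -- Lerner's pointwise bound. Let A be the σ-average of g/σ over I, so that ⟨g⟩_I = A σ(I)/|I|. The
  -- A_p condition bounds (σ(I)/|I|)^{p-1} by Q|I|/w(I), and A^{p-1} is at most Φ everywhere on I.
  -- Hence ⟨g⟩_I^{p-1} is at most Q times the w-average of Φ/w.
  have hpt : ∀ x, maxM volume D g x ≤ (Q * maxM ωw D Ψ x) ^ (q - 1) := by
    intro x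
    refine maxM_le fun I hI hx => ?_
    have hL0 := I.volume_ne_zero
    have hLt := I.volume_ne_top
    set L := volume I.toSet with hL
    have e1 : ∫⁻ y in I.toSet, fσ y ∂ωσ = ∫⁻ y in I.toSet, g y := by
      rw [hωσ, setLIntegral_withDensity_eq_setLIntegral_mul _ hσ hfσm I.measurableSet_toSet]
      refine lintegral_congr fun y => ?_
      simp only [Pi.mul_apply, hfσ]
      rw [mul_comm, mul_assoc, ENNReal.inv_mul_cancel (hσ0 y) (hσt y), mul_one]
    have e2 : ∫⁻ y in I.toSet, Ψ y ∂ωw = ∫⁻ y in I.toSet, Φ y := by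
      rw [hωw, setLIntegral_withDensity_eq_setLIntegral_mul _ hw hΨm I.measurableSet_toSet]
      refine lintegral_congr fun y => ?_
      simp only [Pi.mul_apply, hΨ]
      rw [mul_comm, mul_assoc, ENNReal.inv_mul_cancel (hw0 y) (hwt y), mul_one]
    set A := (∫⁻ y in I.toSet, fσ y ∂ωσ) / ωσ I.toSet with hA
    have h1 : A ^ (p - 1) * L ≤ ∫⁻ y in I.toSet, Φ y := by
      rw [hL, ← setLIntegral_const]
      refine setLIntegral_mono hΦm fun y hy => ?_
      exact ENNReal.rpow_le_rpow (le_maxM hI hy fσ) (by linarith)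
    have h2 : (∫⁻ y in I.toSet, Ψ y ∂ωw) / ωw I.toSet ≤ maxM ωw D Ψ x := le_maxM hI hx Ψ
    have h3 : (∫⁻ y in I.toSet, g y) / L = A * (ωσ I.toSet / L) := by
      rw [hA, e1, ← mul_div_assoc, ENNReal.div_mul_cancel (hσ_ne0 I hI) (hσ_net I hI)]
    have h4 : (ωσ I.toSet / L) ^ (p - 1) ≤ Q * L / ωw I.toSet := by
      have := hAp I hI
      rw [← evw, ← evσ, ← hL] at this
      rw [ENNReal.le_div_iff_mul_le (Or.inl (hw_ne0 I hI)) (Or.inl (hw_net I hI)),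
        ENNReal.div_rpow_of_nonneg _ _ (by linarith), ENNReal.div_eq_inv_mul, mul_assoc,
        mul_comm _ (ωw I.toSet)]
      calc (L ^ (p - 1))⁻¹ * (ωw I.toSet * ωσ I.toSet ^ (p - 1))
          ≤ (L ^ (p - 1))⁻¹ * (Q * L ^ p) := by gcongr
        _ = Q * L := by
            rw [show p = (p - 1) + 1 by ring, ENNReal.rpow_add _ _ hL0 hLt, ENNReal.rpow_one,
              show p - 1 + 1 - 1 = p - 1 by ring, mul_left_comm, ← mul_assoc (_⁻¹),
              ENNReal.inv_mul_cancel, one_mul]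
            · simp [ENNReal.rpow_eq_zero_iff, hL0, hLt]
            · exact ENNReal.rpow_ne_top_of_nonneg (by linarith) hLt
    have h5 : ((∫⁻ y in I.toSet, g y) / L) ^ (p - 1) ≤ Q * maxM ωw D Ψ x := by
      calc ((∫⁻ y in I.toSet, g y) / L) ^ (p - 1)
          = A ^ (p - 1) * (ωσ I.toSet / L) ^ (p - 1) := by
            rw [h3, ENNReal.mul_rpow_of_nonneg _ _ (by linarith)]
        _ ≤ A ^ (p - 1) * (Q * L / ωw I.toSet) := by gcongr
        _ = Q * (A ^ (p - 1) * L / ωw I.toSet) := by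
            simp only [ENNReal.div_eq_inv_mul]
            ring
        _ ≤ Q * ((∫⁻ y in I.toSet, Φ y) / ωw I.toSet) := by gcongr
        _ ≤ _ := by rw [← e2]; gcongr
    calc (∫⁻ y in I.toSet, g y) / L
        = (((∫⁻ y in I.toSet, g y) / L) ^ (p - 1)) ^ (q - 1) := by
          rw [← ENNReal.rpow_mul, show (p - 1) * (q - 1) = 1 by linarith, ENNReal.rpow_one]
      _ ≤ _ := ENNReal.rpow_le_rpow h5 (by linarith)
  -- Two maximal functions remain, one bounded on L^q(w) and one on L^p(σ), each with respect to its
  -- own measure and hence with constants that do not depend on the weight. They fit together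
  -- because Ψ^q w = (M_σ(g/σ))^p σ.
  calc ∫⁻ x, maxM volume D g x ^ p * w x
      ≤ ∫⁻ x, (Q ^ q * maxM ωw D Ψ x ^ q) * w x := by
        refine lintegral_mono fun x => ?_
        gcongr
        calc maxM volume D g x ^ p ≤ ((Q * maxM ωw D Ψ x) ^ (q - 1)) ^ p :=
              ENNReal.rpow_le_rpow (hpt x) (by linarith)
          _ = _ := by
              rw [← ENNReal.rpow_mul, show (q - 1) * p = q by linarith,
                ENNReal.mul_rpow_of_nonneg _ _ (by linarith)]
    _ = Q ^ q * ∫⁻ x, maxM ωw D Ψ x ^ q ∂ωw := by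
        rw [hωw, lintegral_withDensity_eq_lintegral_mul _ hw
          ((measurable_maxM hD.countable _).pow_const _), ← lintegral_const_mul' _ _
          (ENNReal.rpow_ne_top_of_nonneg (by linarith) hQ)]
        refine lintegral_congr fun x => ?_
        simp only [Pi.mul_apply]
        ring
    _ ≤ Q ^ q * (ENNReal.ofReal (q * 2 * (2 ^ (q - 1) / (q - 1))) * ∫⁻ x, Ψ x ^ q ∂ωw) := by
        gcongr
        exact lintegral_maxM_rpow_le hD hn hw_ne0 hw_net hq hΨm
    _ = Q ^ q * (ENNReal.ofReal (q * 2 * (2 ^ (q - 1) / (q - 1))) *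
          ∫⁻ x, maxM ωσ D fσ x ^ p ∂ωσ) := by
        congr 2
        rw [hωw, lintegral_withDensity_eq_lintegral_mul _ hw (hΨm.pow_const _), hωσ,
          lintegral_withDensity_eq_lintegral_mul _ hσ
          ((measurable_maxM hD.countable _).pow_const _)]
        refine lintegral_congr fun x => ?_
        simp only [Pi.mul_apply, hΨ, hΦ, hσdef]
        rw [ENNReal.mul_rpow_of_nonneg _ _ (by linarith), ← ENNReal.rpow_mul,
          show (p - 1) * q = p by linarith, ENNReal.rpow_sub _ _ (hw0 x) (hwt x),
          ENNReal.rpow_one, ENNReal.inv_rpow, ENNReal.div_eq_inv_mul]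
        ring
    _ ≤ Q ^ q * (ENNReal.ofReal (q * 2 * (2 ^ (q - 1) / (q - 1))) *
          (ENNReal.ofReal (p * 2 * (2 ^ (p - 1) / (p - 1))) * ∫⁻ x, fσ x ^ p ∂ωσ)) := by
        gcongr
        exact lintegral_maxM_rpow_le hD hn hσ_ne0 hσ_net hp hfσm
    _ = _ := by
        have e : ∫⁻ x, fσ x ^ p ∂ωσ = ∫⁻ x, g x ^ p * w x := by
          rw [hωσ, lintegral_withDensity_eq_lintegral_mul _ hσ (hfσm.pow_const _)]
          refine lintegral_congr fun x => ?_
          simp only [Pi.mul_apply, hfσ, hσdef]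
          rw [ENNReal.mul_rpow_of_nonneg _ _ (by linarith), ENNReal.inv_rpow, ← ENNReal.rpow_mul,
            ← ENNReal.rpow_neg, mul_left_comm, ← ENNReal.rpow_add _ _ (hw0 x) (hwt x),
            show 1 - q + -((1 - q) * p) = 1 by linarith, ENNReal.rpow_one]
        rw [e, maxConst]
        ring

end WeightedMaximal

end BiParam

namespace BiParam

/-! ### The Bellman function of the weighted square function. -/

section Bellman

/-- With r = √a, log a ≤ 2(r - 1) gives a - 1 - log a ≥ (r - 1)², while (a - 1)² = (r - 1)²(r + 1)²
and (r + 1)² ≤ 4N. -/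
theorem sq_div_le_sub_one_sub_log {a N : ℝ} (ha : 0 < a) (haN : a ≤ N) (hN : 1 ≤ N) :
    (a - 1) ^ 2 / (4 * N) ≤ a - 1 - Real.log a := by
  set r := √a with hr
  have hr0 : 0 < r := Real.sqrt_pos.2 ha
  have hra : r ^ 2 = a := Real.sq_sqrt ha.le
  have h1 : Real.log a ≤ 2 * (r - 1) := by
    rw [← hra, Real.log_pow]
    have := Real.log_le_sub_one_of_pos hr0
    push_cast
    linarith
  have h2 : (r + 1) ^ 2 ≤ 4 * N := by
    nlinarith [sq_nonneg (r - 1)]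
  have h3 : (a - 1) ^ 2 / (4 * N) ≤ (r - 1) ^ 2 := by
    rw [div_le_iff₀ (by linarith), ← hra]
    calc (r ^ 2 - 1) ^ 2 = (r - 1) ^ 2 * (r + 1) ^ 2 := by ring
      _ ≤ _ := by gcongr
  nlinarith

/-- Quantitative convexity: the function 1/(ab²) lies above its tangent plane at (1, 1) by a
quadratic amount. Use y ≥ 1 + log y for y = 1/(ab²), then the quadratic bound for the two
logarithms. -/
theorem tangent_le_inv {a b N : ℝ} (ha : 0 < a) (hb : 0 < b) (haN : a ≤ N) (hbN : b ≤ N)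
    (hN : 1 ≤ N) :
    1 - (a - 1) - 2 * (b - 1) + ((a - 1) ^ 2 + (b - 1) ^ 2) / (4 * N) ≤ 1 / (a * b ^ 2) := by
  have h1 := sq_div_le_sub_one_sub_log ha haN hN
  have h2 := sq_div_le_sub_one_sub_log hb hbN hN
  have h0 : 0 ≤ (b - 1) ^ 2 / (4 * N) := by positivity
  have h3 := Real.log_le_sub_one_of_pos (show 0 < 1 / (a * b ^ 2) by positivity)
  rw [one_div, Real.log_inv, Real.log_mul ha.ne' (by positivity), Real.log_pow] at h3
  push_cast at h3
  rw [one_div, add_div]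
  linarith

/-- A squared Lipschitz bound for 1/(ab²) at (1, 1). The lower bound on ab together with a ≤ N keeps
b away from 0. -/
theorem abs_inv_sub_one_le {a b N Q : ℝ} (ha : 0 < a) (hb : 0 < b) (haN : a ≤ N) (hbN : b ≤ N)
    (hN : 1 ≤ N) (hQ : 1 ≤ Q) (hab : 1 ≤ Q * (a * b)) :
    (1 / (a * b ^ 2) - 1) ^ 2 ≤ (N * Q) ^ 4 * (8 * N ^ 4) * ((a - 1) ^ 2 + (b - 1) ^ 2) := by
  have hb1 : 1 ≤ N * Q * b := by
    calc (1 : ℝ) ≤ Q * (a * b) := hab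
      _ ≤ Q * (N * b) := by gcongr
      _ = _ := by ring
  have h1 : 1 / (a * b ^ 2) ≤ (N * Q) ^ 2 := by
    rw [div_le_iff₀ (by positivity)]
    calc (1 : ℝ) = 1 * 1 := by ring
      _ ≤ (Q * (a * b)) * (N * Q * b) := by gcongr
      _ = N * Q ^ 2 * (a * b ^ 2) := by ring
      _ ≤ (N * N) * Q ^ 2 * (a * b ^ 2) := by
        gcongr
        nlinarith
      _ = _ := by ring
  have h2 : 1 / (a * b ^ 2) - 1 = -(1 / (a * b ^ 2)) * ((a - 1) * b ^ 2 + (b - 1) * (b + 1)) := by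
    field_simp
    ring
  rw [h2, mul_pow, neg_sq]
  have h3 : (1 / (a * b ^ 2)) ^ 2 ≤ (N * Q) ^ 4 := by
    calc (1 / (a * b ^ 2)) ^ 2 ≤ ((N * Q) ^ 2) ^ 2 := by gcongr
      _ = _ := by ring
  have h4 : ((a - 1) * b ^ 2 + (b - 1) * (b + 1)) ^ 2 ≤
      8 * N ^ 4 * ((a - 1) ^ 2 + (b - 1) ^ 2) := by
    have e1 : ((a - 1) * b ^ 2 + (b - 1) * (b + 1)) ^ 2 ≤
        2 * ((a - 1) ^ 2 * (b ^ 2) ^ 2) + 2 * ((b - 1) ^ 2 * (b + 1) ^ 2) := by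
      nlinarith [sq_nonneg ((a - 1) * b ^ 2 - (b - 1) * (b + 1))]
    have e2 : (b ^ 2) ^ 2 ≤ N ^ 4 := by
      rw [← pow_mul]
      gcongr
    have e3 : (b + 1) ^ 2 ≤ 4 * N ^ 4 := by
      have : b + 1 ≤ 2 * N ^ 2 := by nlinarith
      calc (b + 1) ^ 2 ≤ (2 * N ^ 2) ^ 2 := by gcongr
        _ = _ := by ring
    have e4 : (a - 1) ^ 2 * (b ^ 2) ^ 2 ≤ (a - 1) ^ 2 * N ^ 4 := by gcongr
    have e5 : (b - 1) ^ 2 * (b + 1) ^ 2 ≤ (b - 1) ^ 2 * (4 * N ^ 4) := by gcongr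
    have e6 : 0 ≤ (a - 1) ^ 2 * N ^ 4 := by positivity
    nlinarith
  calc _ ≤ (N * Q) ^ 4 * (8 * N ^ 4 * ((a - 1) ^ 2 + (b - 1) ^ 2)) := by gcongr
    _ = _ := by ring

/-- The denominator of the Bellman function of the weighted square function. -/
noncomputable def bellX (s w : ℝ) : ℝ := 2 * s - 1 / (s * w ^ 2)

/-- On the domain 1 ≤ sw the denominator lies between s and 2s, so f²/X is comparable to f²/s; the
correction -1/(sw²) supplies the strict concavity in s and w that 2s lacks. -/
theorem le_bellX {s w : ℝ} (hs : 0 < s) (hw : 0 < w) (h : 1 ≤ s * w) : s ≤ bellX s w := by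
  have : 1 / (s * w ^ 2) ≤ s := by
    rw [div_le_iff₀ (by positivity)]
    nlinarith
  rw [bellX]
  linarith

theorem bellX_le {s w : ℝ} (hs : 0 < s) (hw : 0 < w) : bellX s w ≤ 2 * s := by
  have : 0 < 1 / (s * w ^ 2) := by positivity
  rw [bellX]
  linarith

theorem sq_sub_le_two_mul (x y : ℝ) : (x - y) ^ 2 ≤ 2 * x ^ 2 + 2 * y ^ 2 := by
  nlinarith [sq_nonneg (x + y)]

/-- The tangent plane of f²/X at the parent lies below the value at each child, with a quadratic
gain in the jump of f. The coefficients α, β, γ do not depend on the child, so the linear terms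
vanish when the children are summed. -/
theorem bellman_child {N Q : ℝ} (hN : 1 ≤ N) (hQ : 1 ≤ Q) : ∃ c : ℝ, 0 < c ∧
    ∀ s w : ℝ, 0 < s → 0 < w → 1 ≤ s * w → s * w ≤ Q → ∀ f : ℝ, ∃ α β γ : ℝ,
    ∀ si wi : ℝ, 0 < si → 0 < wi → si ≤ N * s → wi ≤ N * w → 1 ≤ si * wi → ∀ fi : ℝ,
      f ^ 2 / bellX s w + α * (fi - f) + β * (si - s) + γ * (wi - w) + c * (w * (fi - f) ^ 2) ≤
        fi ^ 2 / bellX si wi := by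
  set L : ℝ := 8 + 2 * ((N * Q) ^ 4 * (8 * N ^ 4)) with hL
  have hN0 : 0 < N := by linarith
  have hQ0 : 0 < Q := by linarith
  have hL0 : 0 < L := by positivity
  -- The jump of f splits as (fi - θXi) + θ(Xi - X); the first entry of the minimum serves the first
  -- part, the second entry the other.
  set c := min (1 / (4 * N * Q)) (1 / (8 * N * Q ^ 3 * L)) with hc
  have hc0 : 0 < c := lt_min (by positivity) (by positivity)
  refine ⟨c, hc0, fun s w hs hw h1 hQsw f => ?_⟩
  set X := bellX s w with hX
  have hX0 : 0 < X := hs.trans_le (le_bellX hs hw h1)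
  set θ := f / X with hθ
  set t := 1 / (s * w) ^ 2 with ht
  have ht0 : 0 < t := by positivity
  -- The gradient of f²/X at (f, s, w): the derivatives of X are 2 + t in s and 2ts/w in w.
  refine ⟨2 * θ, -(θ ^ 2 * (2 + t)), -(θ ^ 2 * (2 * t * s / w)), ?_⟩
  intro si wi hsi hwi hsN hwN hi fi
  set Xi := bellX si wi with hXi
  have hXi0 : 0 < Xi := hsi.trans_le (le_bellX hsi hwi hi)
  set a := si / s with ha
  set b := wi / w with hb
  have ha0 : 0 < a := by positivity
  have hb0 : 0 < b := by positivity
  have esi : si = s * a := by rw [ha]; field_simp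
  have ewi : wi = w * b := by rw [hb]; field_simp
  have haN : a ≤ N := by rw [ha, div_le_iff₀ hs]; exact hsN
  have hbN : b ≤ N := by rw [hb, div_le_iff₀ hw]; exact hwN
  have hab : 1 ≤ Q * (a * b) := by
    calc (1 : ℝ) ≤ si * wi := hi
      _ = (s * w) * (a * b) := by rw [esi, ewi]; ring
      _ ≤ _ := by gcongr
  have eX : X = s * (2 - t) := by
    rw [hX, bellX, ht]
    field_simp
  have eXi : Xi = s * (2 * a - t * (1 / (a * b ^ 2))) := by
    rw [hXi, bellX, ht, esi, ewi]
    field_simp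
  have htan := tangent_le_inv ha0 hb0 haN hbN hN
  have habs := abs_inv_sub_one_le ha0 hb0 haN hbN hN hQ hab
  set z := 1 / (a * b ^ 2) with hz
  set U := (a - 1) ^ 2 + (b - 1) ^ 2 with hU
  have hU0 : 0 ≤ U := by positivity
  have ht1 : t ≤ 1 := by
    rw [ht, div_le_one (by positivity)]
    exact one_le_pow₀ h1
  have htQ : 1 ≤ Q ^ 2 * t := by
    rw [ht, mul_one_div, one_le_div (by positivity)]
    gcongr
  have hdiff : (Xi - X) ^ 2 ≤ L * (s ^ 2 * U) := by
    have e : Xi - X = s * (2 * (a - 1) - t * (z - 1)) := by rw [eX, eXi]; ring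
    have h2 : (2 * (a - 1) - t * (z - 1)) ^ 2 ≤ 8 * (a - 1) ^ 2 + 2 * (z - 1) ^ 2 := by
      have := sq_sub_le_two_mul (2 * (a - 1)) (t * (z - 1))
      have h3 : (t * (z - 1)) ^ 2 ≤ (z - 1) ^ 2 := by
        rw [mul_pow]
        exact mul_le_of_le_one_left (sq_nonneg _) (pow_le_one₀ ht0.le ht1)
      linarith
    have h4 : 8 * (a - 1) ^ 2 ≤ 8 * U := by
      rw [hU]
      linarith [sq_nonneg (b - 1)]
    rw [e, mul_pow]
    calc s ^ 2 * (2 * (a - 1) - t * (z - 1)) ^ 2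
        ≤ s ^ 2 * (8 * U + 2 * ((N * Q) ^ 4 * (8 * N ^ 4) * U)) := by
          gcongr
          linarith
      _ = _ := by rw [hL]; ring
  -- Two surpluses are available: the strict concavity of X controls θ²(Xi - X)², and the square
  -- completed in fi controls (fi - θXi)².
  have hgain : c * (w * (fi - f) ^ 2) ≤
      θ ^ 2 * (s * t * (U / (4 * N))) + (fi - θ * Xi) ^ 2 / Xi := by
    have ef : f = θ * X := by rw [hθ]; field_simp
    have h2 : (fi - f) ^ 2 ≤ 2 * (fi - θ * Xi) ^ 2 + 2 * (θ ^ 2 * (Xi - X) ^ 2) := by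
      have := sq_sub_le_two_mul (fi - θ * Xi) (-(θ * (Xi - X)))
      rw [neg_sq, mul_pow] at this
      rw [ef]
      refine le_trans (le_of_eq ?_) this
      ring
    have h3 : c * (w * (2 * (fi - θ * Xi) ^ 2)) ≤ (fi - θ * Xi) ^ 2 / Xi := by
      rw [le_div_iff₀ hXi0]
      have hXiN : Xi ≤ 2 * (N * s) := (bellX_le hsi hwi).trans (by linarith)
      have : c * w * 2 * Xi ≤ 1 := by
        calc c * w * 2 * Xi ≤ (1 / (4 * N * Q)) * w * 2 * (2 * (N * s)) := by
              gcongr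
              exact min_le_left _ _
          _ = (s * w) / Q := by field_simp; ring
          _ ≤ 1 := by rw [div_le_one hQ0]; exact hQsw
      calc c * (w * (2 * (fi - θ * Xi) ^ 2)) * Xi = (c * w * 2 * Xi) * (fi - θ * Xi) ^ 2 := by ring
        _ ≤ _ := mul_le_of_le_one_left (sq_nonneg _) this
    have h4 : c * (w * (2 * (θ ^ 2 * (Xi - X) ^ 2))) ≤ θ ^ 2 * (s * t * (U / (4 * N))) := by
      have h5 : c * w * 2 * (L * s ^ 2) ≤ s * t / (4 * N) := by
        calc c * w * 2 * (L * s ^ 2) ≤ (1 / (8 * N * Q ^ 3 * L)) * w * 2 * (L * s ^ 2) := by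
              gcongr
              exact min_le_right _ _
          _ = (s * w) * s / (4 * N * Q ^ 3) := by field_simp; ring
          _ ≤ Q * s / (4 * N * Q ^ 3) := by gcongr
          _ = s * 1 / (4 * N * Q ^ 2) := by field_simp
          _ ≤ s * (Q ^ 2 * t) / (4 * N * Q ^ 2) := by gcongr
          _ = _ := by field_simp
      calc c * (w * (2 * (θ ^ 2 * (Xi - X) ^ 2)))
          = θ ^ 2 * (c * w * 2 * (Xi - X) ^ 2) := by ring
        _ ≤ θ ^ 2 * (c * w * 2 * (L * (s ^ 2 * U))) := by gcongr
        _ = θ ^ 2 * (c * w * 2 * (L * s ^ 2) * U) := by ring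
        _ ≤ θ ^ 2 * (s * t / (4 * N) * U) := by gcongr
        _ = _ := by ring
    calc c * (w * (fi - f) ^ 2)
        ≤ c * (w * (2 * (fi - θ * Xi) ^ 2 + 2 * (θ ^ 2 * (Xi - X) ^ 2))) := by gcongr
      _ = c * (w * (2 * (θ ^ 2 * (Xi - X) ^ 2))) + c * (w * (2 * (fi - θ * Xi) ^ 2)) := by ring
      _ ≤ _ := add_le_add h4 h3
  have eV : f ^ 2 / X = 2 * θ * f - θ ^ 2 * X := by rw [hθ]; field_simp; ring
  have eVi : fi ^ 2 / Xi = 2 * θ * fi - θ ^ 2 * Xi + (fi - θ * Xi) ^ 2 / Xi := by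
    field_simp
    ring
  have hXle : Xi ≤ X + (2 + t) * (si - s) + (2 * t * s / w) * (wi - w) -
      s * t * (U / (4 * N)) := by
    have e1 : (2 * t * s / w) * (wi - w) = s * t * (2 * (b - 1)) := by
      rw [ewi]; field_simp
    have e2 : (2 + t) * (si - s) = s * ((2 + t) * (a - 1)) := by rw [esi]; ring
    rw [e1, e2, eX, eXi]
    have := mul_le_mul_of_nonneg_left htan (show 0 ≤ s * t by positivity)
    linarith
  have := mul_le_mul_of_nonneg_left hXle (sq_nonneg θ)
  rw [eV, eVi]
  linarith

/-- The dyadic concavity of the Bellman function of the weighted square function. -/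
theorem bellman_sum {N Q : ℝ} (hN : 1 ≤ N) (hQ : 1 ≤ Q) : ∃ c : ℝ, 0 < c ∧
    ∀ (ι : Type) [Fintype ι], (Fintype.card ι : ℝ) = N →
    ∀ s w : ℝ, 0 < s → 0 < w → 1 ≤ s * w → s * w ≤ Q → ∀ f : ℝ,
    ∀ si wi fi : ι → ℝ, (∀ i, 0 < si i) → (∀ i, 0 < wi i) → (∀ i, 1 ≤ si i * wi i) →
      ∑ i, si i = N * s → ∑ i, wi i = N * w → ∑ i, fi i = N * f →
      N * (f ^ 2 / bellX s w) + c * (w * ∑ i, (fi i - f) ^ 2) ≤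
        ∑ i, fi i ^ 2 / bellX (si i) (wi i) := by
  obtain ⟨c, hc, h⟩ := bellman_child hN hQ
  refine ⟨c, hc, fun ι _ hcard s w hs hw h1 h2 f si wi fi hsi hwi hi es ew ef => ?_⟩
  obtain ⟨α, β, γ, H⟩ := h s w hs hw h1 h2 f
  have hle : ∀ g : ι → ℝ, (∀ i, 0 < g i) → ∀ i, g i ≤ ∑ j, g j := fun g hg i =>
    Finset.single_le_sum (fun j _ => (hg j).le) (Finset.mem_univ i)
  -- The parameters of a child are at most N times those of the parent, since they are positive and
  -- N times the parent's value is their sum.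
  have hsum := Finset.sum_le_sum fun i (_ : i ∈ Finset.univ) =>
    H (si i) (wi i) (hsi i) (hwi i) (es ▸ hle si hsi i) (ew ▸ hle wi hwi i) (hi i) (fi i)
  refine le_trans (le_of_eq ?_) hsum
  simp only [Finset.sum_add_distrib, ← Finset.mul_sum, Finset.sum_sub_distrib, es, ew, ef,
    Finset.sum_const, Finset.card_univ, nsmul_eq_mul, hcard]
  ring

end Bellman

end BiParam

namespace BiParam

/-! ### Haar functions on one cube. -/

section Haar

variable {n : ℕ}

/-- The sign of the Haar function of signature `η` on the child `ε`. -/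
noncomputable def haarSign (η ε : Fin n → Fin 2) : ℝ :=
  ∏ i, if η i = 0 then 1 else if ε i = 0 then 1 else -1

theorem abs_haarSign (η ε : Fin n → Fin 2) : |haarSign η ε| = 1 := by
  rw [haarSign, Finset.abs_prod]
  refine Finset.prod_eq_one fun i _ => ?_
  split_ifs <;> simp

/-- The sum over ε factors over the coordinates, and a coordinate with η i ≠ 0 contributes 1 - 1. -/
theorem sum_haarSign {η : Fin n → Fin 2} (hη : η ≠ 0) : ∑ ε, haarSign η ε = 0 := by
  have h := Finset.prod_univ_sum (fun _ : Fin n => (Finset.univ : Finset (Fin 2)))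
    (fun i e => (if η i = 0 then 1 else if e = 0 then 1 else -1 : ℝ))
  rw [Fintype.piFinset_univ] at h
  simp only [haarSign]
  rw [← h]
  obtain ⟨i, hi⟩ := Function.ne_iff.1 hη
  refine Finset.prod_eq_zero (Finset.mem_univ i) ?_
  simp only [Pi.zero_apply] at hi
  simp [hi]

theorem haar_eq_zero {I : Cube n} (η : Fin n → Fin 2) {x : Fin n → ℝ} (hx : x ∉ I.toSet) :
    haar I η x = 0 := by
  rw [Cube.mem_toSet] at hx
  push Not at hx
  obtain ⟨i, hi⟩ := hx
  have hs := I.side_pos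
  refine Finset.prod_eq_zero (Finset.mem_univ i) ?_
  rw [haarInterval, mul_eq_zero]
  right
  have h1 : x i ∉ Set.Ico (I.corner i) (I.corner i + I.side) := fun h =>
    absurd h.2 (not_lt.2 (hi h.1))
  have h2 : x i ∉ Set.Ico (I.corner i) (I.corner i + I.side / 2) := fun h =>
    h1 ⟨h.1, by linarith [h.2]⟩
  have h3 : x i ∉ Set.Ico (I.corner i + I.side / 2) (I.corner i + I.side) := fun h =>
    h1 ⟨by linarith [h.1], h.2⟩
  split_ifs
  · simp [h1]
  · simp [h2, h3]

theorem haar_eq_of_mem_child {I : Cube n} (η ε : Fin n → Fin 2) {x : Fin n → ℝ}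
    (hx : x ∈ (I.child ε).toSet) : haar I η x = (√I.side)⁻¹ ^ n * haarSign η ε := by
  rw [haar, haarSign, show (√I.side)⁻¹ ^ n = ∏ _i : Fin n, (√I.side)⁻¹ by simp,
    ← Finset.prod_mul_distrib]
  refine Finset.prod_congr rfl fun i _ => ?_
  have hs := I.side_pos
  have h := Cube.mem_toSet.1 hx i
  simp only [Cube.child] at h
  rw [haarInterval]
  congr 1
  by_cases h1 : η i = 0
  · have : x i ∈ Set.Ico (I.corner i) (I.corner i + I.side) :=
      Cube.mem_toSet.1 (I.child_subset ε hx) i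
    simp [h1, this]
  · by_cases h2 : ε i = 0
    · simp only [h2, if_true, add_zero] at h
      have m1 : x i ∈ Set.Ico (I.corner i) (I.corner i + I.side / 2) := h
      have m2 : x i ∉ Set.Ico (I.corner i + I.side / 2) (I.corner i + I.side) := fun h' =>
        absurd h.2 (not_lt.2 h'.1)
      simp [h1, h2, m1, m2]
    · simp only [h2, if_false] at h
      have m1 : x i ∉ Set.Ico (I.corner i) (I.corner i + I.side / 2) := fun h' =>
        absurd h.1 (not_le.2 h'.2)
      have m2 : x i ∈ Set.Ico (I.corner i + I.side / 2) (I.corner i + I.side) :=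
        ⟨h.1, by linarith [h.2]⟩
      simp [h1, h2, m1, m2]

theorem measurable_haar (I : Cube n) (η : Fin n → Fin 2) : Measurable (haar I η) := by
  refine Finset.measurable_prod _ fun i _ => ?_
  refine Measurable.comp (g := haarInterval (I.corner i) I.side (η i)) ?_
    (show Measurable fun x : Fin n → ℝ => x i from measurable_pi_apply i)
  unfold haarInterval
  refine Measurable.const_mul ?_ _
  have h1 : ∀ a b : ℝ, Measurable ((Set.Ico a b).indicator (1 : ℝ → ℝ)) := fun a b =>
    measurable_one.indicator measurableSet_Ico
  by_cases h : η i = 0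
  · simpa only [h, if_true] using h1 _ _
  · simp only [h, if_false]
    exact (h1 _ _).sub (h1 _ _)

theorem abs_haar_of_mem {I : Cube n} (η : Fin n → Fin 2) {x : Fin n → ℝ} (hx : x ∈ I.toSet) :
    |haar I η x| = (√I.side)⁻¹ ^ n := by
  obtain ⟨ε, hε⟩ := Cube.exists_mem_child hx
  rw [haar_eq_of_mem_child η ε hε, abs_mul, abs_haarSign, mul_one, abs_of_nonneg (by positivity)]

theorem sq_haar_of_mem {I : Cube n} (η : Fin n → Fin 2) {x : Fin n → ℝ} (hx : x ∈ I.toSet) :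
    haar I η x ^ 2 = (I.side ^ n)⁻¹ := by
  rw [← sq_abs, abs_haar_of_mem η hx, ← pow_mul, mul_comm, pow_mul, inv_pow,
    Real.sq_sqrt I.side_pos.le, inv_pow]

theorem abs_haar_le (I : Cube n) (η : Fin n → Fin 2) (x : Fin n → ℝ) :
    |haar I η x| ≤ (√I.side)⁻¹ ^ n := by
  by_cases hx : x ∈ I.toSet
  · exact (abs_haar_of_mem η hx).le
  · rw [haar_eq_zero η hx, abs_zero]
    positivity

theorem integrable_mul_haar {I : Cube n} {f : (Fin n → ℝ) → ℂ} (hf : IntegrableOn f I.toSet)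
    (η : Fin n → Fin 2) : Integrable (fun x => f x * (haar I η x : ℂ)) := by
  have h1 : (fun x => f x * (haar I η x : ℂ)) =
      I.toSet.indicator (fun x => (haar I η x : ℂ) * f x) := by
    ext x
    by_cases hx : x ∈ I.toSet
    · simp [hx, mul_comm]
    · simp [hx, haar_eq_zero η hx]
  rw [h1, integrable_indicator_iff I.measurableSet_toSet]
  refine hf.bdd_mul (c := (√I.side)⁻¹ ^ n) ?_ ?_
  · exact (Complex.measurable_ofReal.comp (measurable_haar I η)).aestronglyMeasurable
  · refine Eventually.of_forall fun x => ?_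
    rw [Complex.norm_real]
    exact abs_haar_le I η x

theorem integral_mul_haar {I : Cube n} {f : (Fin n → ℝ) → ℂ} (hf : IntegrableOn f I.toSet)
    (η : Fin n → Fin 2) : ∫ x, f x * (haar I η x : ℂ) =
      ∑ ε, (((√I.side)⁻¹ ^ n * haarSign η ε : ℝ) : ℂ) * ∫ x in (I.child ε).toSet, f x := by
  have h0 : ∫ x, f x * (haar I η x : ℂ) = ∫ x in I.toSet, f x * (haar I η x : ℂ) := by
    refine (setIntegral_eq_integral_of_forall_compl_eq_zero fun x hx => ?_).symm
    simp [haar_eq_zero η hx]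
  rw [h0, I.integral_eq_sum_child (integrable_mul_haar hf η).integrableOn]
  refine Finset.sum_congr rfl fun ε _ => ?_
  rw [← integral_const_mul]
  refine setIntegral_congr_fun (I.child ε).measurableSet_toSet fun x hx => ?_
  rw [haar_eq_of_mem_child η ε hx, mul_comm]

theorem Cube.volume_real (I : Cube n) : volume.real I.toSet = I.side ^ n := by
  rw [Measure.real, I.volume_toSet, ENNReal.toReal_ofReal (pow_pos I.side_pos n).le]

theorem Cube.volume_real_pos (I : Cube n) : 0 < volume.real I.toSet := by
  rw [I.volume_real]
  exact pow_pos I.side_pos n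

theorem Cube.volume_real_child (I : Cube n) (ε : Fin n → Fin 2) :
    volume.real I.toSet = 2 ^ n * volume.real (I.child ε).toSet := by
  rw [Measure.real, Measure.real, I.volume_child ε]
  simp

/-- The coefficient is a signed sum of child averages. Cancellation allows the average over I to be
subtracted from each, and Cauchy–Schwarz over the 2^n children gives the constant. -/
theorem sq_norm_integral_mul_haar_le {I : Cube n} {f : (Fin n → ℝ) → ℂ}
    (hf : IntegrableOn f I.toSet) {η : Fin n → Fin 2} (hη : η ≠ 0) :
    ‖∫ x, f x * (haar I η x : ℂ)‖ ^ 2 ≤ volume.real I.toSet / 2 ^ n *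
      ∑ ε, ‖(⨍ x in (I.child ε).toSet, f x) - ⨍ x in I.toSet, f x‖ ^ 2 := by
  set v := volume.real I.toSet with hv
  have hv0 : 0 < v := I.volume_real_pos
  set r : ℝ := (√I.side)⁻¹ ^ n with hr
  have hr2 : r ^ 2 = v⁻¹ := by
    rw [hr, ← pow_mul, mul_comm, pow_mul, inv_pow, Real.sq_sqrt I.side_pos.le, inv_pow, hv,
      I.volume_real]
  have h1 : ∫ x, f x * (haar I η x : ℂ) = ∑ ε, ((r * (v / 2 ^ n) * haarSign η ε : ℝ) : ℂ) *
      ((⨍ x in (I.child ε).toSet, f x) - ⨍ x in I.toSet, f x) := by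
    have e0 : ∑ ε, ((r * (v / 2 ^ n) * haarSign η ε : ℝ) : ℂ) * (⨍ x in I.toSet, f x) = 0 := by
      rw [← Finset.sum_mul, ← Complex.ofReal_sum, ← Finset.mul_sum, sum_haarSign hη]
      simp
    simp only [mul_sub, Finset.sum_sub_distrib]
    rw [e0, sub_zero, integral_mul_haar hf]
    refine Finset.sum_congr rfl fun ε _ => ?_
    rw [setAverage_eq, Complex.real_smul]
    have hc := I.volume_real_child ε
    have hc0 := (I.child ε).volume_real_pos
    rw [← mul_assoc, ← Complex.ofReal_mul]
    congr 2
    rw [hv, hc, ← hr]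
    field_simp
  rw [h1]
  calc ‖∑ ε, ((r * (v / 2 ^ n) * haarSign η ε : ℝ) : ℂ) *
        ((⨍ x in (I.child ε).toSet, f x) - ⨍ x in I.toSet, f x)‖ ^ 2
      ≤ (∑ ε, r * (v / 2 ^ n) *
          ‖(⨍ x in (I.child ε).toSet, f x) - ⨍ x in I.toSet, f x‖) ^ 2 := by
        gcongr
        refine (norm_sum_le _ _).trans (Finset.sum_le_sum fun ε _ => ?_)
        rw [norm_mul, Complex.norm_real, Real.norm_eq_abs, abs_mul, abs_haarSign, mul_one,
          abs_of_nonneg (by positivity)]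
    _ = (r * (v / 2 ^ n)) ^ 2 * (∑ ε,
          ‖(⨍ x in (I.child ε).toSet, f x) - ⨍ x in I.toSet, f x‖) ^ 2 := by
        rw [← Finset.mul_sum, mul_pow]
    _ ≤ (r * (v / 2 ^ n)) ^ 2 * (2 ^ n * ∑ ε,
          ‖(⨍ x in (I.child ε).toSet, f x) - ⨍ x in I.toSet, f x‖ ^ 2) := by
        gcongr
        refine (sq_sum_le_card_mul_sum_sq).trans (le_of_eq ?_)
        simp
    _ = _ := by
        rw [mul_pow, hr2]
        field_simp

end Haar

end BiParam

namespace BiParam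

/-! ### Bellman energy of an A₂ weight on one cube. -/

section SquareFunction

variable {n : ℕ}

/-- The average of a `[0, ∞]`-valued function over a cube, as a real number. -/
noncomputable def realAvg (w : (Fin n → ℝ) → ℝ≥0∞) (I : Cube n) : ℝ :=
  (∫⁻ x in I.toSet, w x).toReal / volume.real I.toSet

/-- The Bellman functional of the weighted square function. -/
noncomputable def bellV (w : (Fin n → ℝ) → ℝ≥0∞) (f : (Fin n → ℝ) → ℂ) (I : Cube n) : ℝ :=
  ‖⨍ x in I.toSet, f x‖ ^ 2 / bellX (realAvg (fun x => w x ^ (1 - (2 : ℝ))) I) (realAvg w I)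

/-- The weighted energy of the martingale difference of `f` on the cube `I`. -/
noncomputable def energy (w : (Fin n → ℝ) → ℝ≥0∞) (f : (Fin n → ℝ) → ℂ) (I : Cube n) : ℝ :=
  volume.real I.toSet / 2 ^ n * (realAvg w I *
    ∑ ε, ‖(⨍ x in (I.child ε).toSet, f x) - ⨍ x in I.toSet, f x‖ ^ 2)

theorem realAvg_nonneg (w : (Fin n → ℝ) → ℝ≥0∞) (I : Cube n) : 0 ≤ realAvg w I :=
  div_nonneg ENNReal.toReal_nonneg I.volume_real_pos.le

theorem energy_nonneg (w : (Fin n → ℝ) → ℝ≥0∞) (f : (Fin n → ℝ) → ℂ) (I : Cube n) :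
    0 ≤ energy w f I := by
  have := realAvg_nonneg w I
  unfold energy
  positivity

theorem sum_realAvg_child {w : (Fin n → ℝ) → ℝ≥0∞} {I : Cube n}
    (hw : ∫⁻ x in I.toSet, w x ≠ ∞) : ∑ ε, realAvg w (I.child ε) = 2 ^ n * realAvg w I := by
  have h : ∀ ε, realAvg w (I.child ε) =
      2 ^ n * ((∫⁻ x in (I.child ε).toSet, w x).toReal / volume.real I.toSet) := by
    intro ε
    have hc := (I.child ε).volume_real_pos
    rw [realAvg, I.volume_real_child ε]
    field_simp
  have hfin : ∀ ε ∈ Finset.univ, ∫⁻ x in (I.child ε).toSet, w x ≠ ∞ := fun ε _ =>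
    ne_top_of_le_ne_top hw (lintegral_mono_set (I.child_subset ε))
  simp only [h, ← Finset.mul_sum, ← Finset.sum_div]
  rw [← ENNReal.toReal_sum hfin, ← I.lintegral_eq_sum_child, realAvg]

theorem sum_average_child {F : Type*} [NormedAddCommGroup F] [NormedSpace ℝ F]
    {f : (Fin n → ℝ) → F} {I : Cube n} (hf : IntegrableOn f I.toSet) :
    ∑ ε, ⨍ x in (I.child ε).toSet, f x = (2 ^ n : ℝ) • ⨍ x in I.toSet, f x := by
  rw [setAverage_eq, I.integral_eq_sum_child hf, Finset.smul_sum, Finset.smul_sum]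
  refine Finset.sum_congr rfl fun ε _ => ?_
  have hc := (I.child ε).volume_real_pos
  rw [setAverage_eq, I.volume_real_child ε, smul_smul]
  congr 1
  field_simp

variable {w : (Fin n → ℝ) → ℝ≥0∞} (hw : Measurable w) (hw0 : ∀ x, w x ≠ 0) (hwt : ∀ x, w x ≠ ∞)

include hw hw0 hwt

/-- Cauchy–Schwarz after inserting w^{1/2} w^{-1/2}. The exponent is written 1 - 2 to match the dual
weight w^{1-q} at q = 2. -/
theorem lintegral_sq_le {I : Cube n} {g : (Fin n → ℝ) → ℝ≥0∞} (hg : Measurable g) :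
    (∫⁻ x in I.toSet, g x) ^ 2 ≤
      (∫⁻ x in I.toSet, g x ^ 2 * w x) * ∫⁻ x in I.toSet, w x ^ (1 - (2 : ℝ)) := by
  have h := ENNReal.lintegral_mul_le_Lp_mul_Lq (volume.restrict I.toSet) Real.HolderConjugate.two_two
    (f := fun x => g x * w x ^ (1 / 2 : ℝ)) (g := fun x => w x ^ (-(1 / 2) : ℝ))
    (hg.mul (hw.pow_const _)).aemeasurable (hw.pow_const _).aemeasurable
  have e1 : ∀ x, ((fun x => g x * w x ^ (1 / 2 : ℝ)) * fun x => w x ^ (-(1 / 2) : ℝ)) x = g x := by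
    intro x
    simp only [Pi.mul_apply]
    rw [mul_assoc, ← ENNReal.rpow_add _ _ (hw0 x) (hwt x)]
    simp
  have e2 : ∀ x, (g x * w x ^ (1 / 2 : ℝ)) ^ (2 : ℝ) = g x ^ 2 * w x := by
    intro x
    rw [ENNReal.mul_rpow_of_nonneg _ _ (by norm_num), ← ENNReal.rpow_mul]
    norm_num
  have e3 : ∀ x, (w x ^ (-(1 / 2) : ℝ)) ^ (2 : ℝ) = w x ^ (1 - (2 : ℝ)) := by
    intro x
    rw [← ENNReal.rpow_mul]
    norm_num
  simp only [e1, e2, e3] at h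
  have h2 := ENNReal.rpow_le_rpow h (show (0 : ℝ) ≤ 2 by norm_num)
  rw [ENNReal.mul_rpow_of_nonneg _ _ (by norm_num), ← ENNReal.rpow_mul, ← ENNReal.rpow_mul] at h2
  norm_num at h2 ⊢
  exact h2

section

variable {D : Set (Cube n)} {Q : ℝ} (hA : JointAp D 2 (ENNReal.ofReal Q) w
  (fun x => w x ^ (1 - (2 : ℝ))))

include hA

theorem JointAp.two_ne_top {I : Cube n} (hI : I ∈ D) :
    ∫⁻ x in I.toSet, w x ≠ ∞ ∧ ∫⁻ x in I.toSet, w x ^ (1 - (2 : ℝ)) ≠ ∞ := by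
  have hσ : Measurable fun x => w x ^ (1 - (2 : ℝ)) := hw.pow_const _
  refine ⟨hA.left_ne_top (by norm_num) ENNReal.ofReal_ne_top hσ (fun x => ?_) hI,
    (hA.symm Real.HolderConjugate.two_two).left_ne_top (by norm_num) ?_ hw hw0 hI⟩
  · simp [ENNReal.rpow_eq_zero_iff, hw0 x, hwt x]
  · exact ENNReal.rpow_ne_top_of_nonneg (by norm_num) ENNReal.ofReal_ne_top

theorem JointAp.integrableOn {f : (Fin n → ℝ) → ℂ} (hf : Measurable f)
    (hB : ∫⁻ x, ‖f x‖ₑ ^ 2 * w x ≠ ∞) {I : Cube n} (hI : I ∈ D) : IntegrableOn f I.toSet := by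
  refine ⟨hf.aestronglyMeasurable, ?_⟩
  have h := lintegral_sq_le hw hw0 hwt (I := I) (g := fun x => ‖f x‖ₑ) hf.enorm
  have h2 : (∫⁻ x in I.toSet, ‖f x‖ₑ ^ 2 * w x) *
      ∫⁻ x in I.toSet, w x ^ (1 - (2 : ℝ)) ≠ ∞ :=
    ENNReal.mul_ne_top (ne_top_of_le_ne_top hB (setLIntegral_le_lintegral _ _))
      (hA.two_ne_top hw hw0 hwt hI).2
  have h3 := ne_top_of_le_ne_top h2 h
  exact lt_top_iff_ne_top.2 fun h4 => h3 (by rw [h4]; simp)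

/-- The pair of averages of w⁻¹ and w lies in the domain of the Bellman function: the lower bound 1
is Cauchy–Schwarz, the upper bound is A₂. The maximum with 1 meets the requirement 1 ≤ Q of
`bellman_sum`. -/
theorem JointAp.realAvg_facts {I : Cube n} (hI : I ∈ D) :
    0 < realAvg w I ∧ 0 < realAvg (fun x => w x ^ (1 - (2 : ℝ))) I ∧
    1 ≤ realAvg (fun x => w x ^ (1 - (2 : ℝ))) I * realAvg w I ∧
    realAvg (fun x => w x ^ (1 - (2 : ℝ))) I * realAvg w I ≤ max Q 1 := by
  have hσ : Measurable fun x => w x ^ (1 - (2 : ℝ)) := hw.pow_const _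
  have hσ0 : ∀ x, w x ^ (1 - (2 : ℝ)) ≠ 0 := fun x => by
    simp [ENNReal.rpow_eq_zero_iff, hw0 x, hwt x]
  obtain ⟨h1, h2⟩ := hA.two_ne_top hw hw0 hwt hI
  have hv := I.volume_real_pos
  have p1 := ENNReal.toReal_pos (setLIntegral_cube_ne_zero hw hw0 I) h1
  have p2 := ENNReal.toReal_pos (setLIntegral_cube_ne_zero hσ hσ0 I) h2
  refine ⟨div_pos p1 hv, div_pos p2 hv, ?_, ?_⟩
  · have h := lintegral_sq_le hw hw0 hwt (I := I) (g := fun _ => 1) measurable_const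
    simp only [one_pow, one_mul, setLIntegral_const] at h
    have h3 := ENNReal.toReal_mono (ENNReal.mul_ne_top h1 h2) h
    rw [ENNReal.toReal_pow, ENNReal.toReal_mul] at h3
    rw [realAvg, realAvg, div_mul_div_comm, one_le_div (by positivity)]
    rw [Measure.real]
    linarith
  · refine le_max_of_le_left ?_
    have h := hA I hI
    norm_num at h
    have hv2 : volume I.toSet ^ 2 ≠ ∞ := ENNReal.pow_ne_top I.volume_ne_top
    have h3 := ENNReal.toReal_mono (ENNReal.mul_ne_top ENNReal.ofReal_ne_top hv2) h
    have hQ : 0 ≤ Q := by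
      by_contra! hneg
      rw [ENNReal.ofReal_of_nonpos hneg.le, zero_mul, nonpos_iff_eq_zero, mul_eq_zero] at h
      rcases h with h | h
      · exact setLIntegral_cube_ne_zero hw hw0 I h
      · refine setLIntegral_cube_ne_zero hσ hσ0 I ?_
        norm_num
        exact h
    rw [ENNReal.toReal_mul, ENNReal.toReal_mul, ENNReal.toReal_pow, ENNReal.toReal_ofReal hQ] at h3
    rw [realAvg, realAvg, div_mul_div_comm, div_le_iff₀ (by positivity), Measure.real]
    norm_num
    linarith

/-- The size bound of the Bellman function: X is at least the average of w⁻¹, and Cauchy–Schwarz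
compares |⟨f⟩_I|² with the weighted mass of |f|². -/
theorem JointAp.bellV_le {f : (Fin n → ℝ) → ℂ} (hf : Measurable f)
    (hB : ∫⁻ x, ‖f x‖ₑ ^ 2 * w x ≠ ∞) {I : Cube n} (hI : I ∈ D) :
    ENNReal.ofReal (volume.real I.toSet * bellV w f I) ≤ ∫⁻ x in I.toSet, ‖f x‖ₑ ^ 2 * w x := by
  obtain ⟨p1, p2, p3, -⟩ := hA.realAvg_facts hw hw0 hwt hI
  obtain ⟨-, h2⟩ := hA.two_ne_top hw hw0 hwt hI
  have hv := I.volume_real_pos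
  have hfin : ∫⁻ x in I.toSet, ‖f x‖ₑ ^ 2 * w x ≠ ∞ :=
    ne_top_of_le_ne_top hB (setLIntegral_le_lintegral _ _)
  refine ENNReal.ofReal_le_of_le_toReal ?_
  have hnorm : ‖∫ x in I.toSet, f x‖ ^ 2 ≤ (∫⁻ x in I.toSet, ‖f x‖ₑ ^ 2 * w x).toReal *
      (∫⁻ x in I.toSet, w x ^ (1 - (2 : ℝ))).toReal := by
    rw [← ENNReal.toReal_mul]
    have h := lintegral_sq_le hw hw0 hwt (I := I) (g := fun x => ‖f x‖ₑ) hf.enorm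
    have h3 : ‖∫ x in I.toSet, f x‖ₑ ^ 2 ≤ _ :=
      (pow_le_pow_left' (enorm_integral_le_lintegral_enorm _) 2).trans h
    have h4 := ENNReal.toReal_mono (ENNReal.mul_ne_top hfin h2) h3
    rwa [ENNReal.toReal_pow, toReal_enorm] at h4
  have hX := le_bellX p2 p1 p3
  rw [bellV, setAverage_eq, norm_smul, mul_pow, norm_inv, Real.norm_of_nonneg hv.le]
  rw [← mul_div_assoc, div_le_iff₀ (p2.trans_le hX)]
  have h5 : (∫⁻ x in I.toSet, w x ^ (1 - (2 : ℝ))).toReal ≤ volume.real I.toSet *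
      bellX (realAvg (fun x => w x ^ (1 - (2 : ℝ))) I) (realAvg w I) := by
    have : (∫⁻ x in I.toSet, w x ^ (1 - (2 : ℝ))).toReal =
        volume.real I.toSet * realAvg (fun x => w x ^ (1 - (2 : ℝ))) I := by
      rw [realAvg]
      field_simp
    rw [this]
    gcongr
  set X := bellX (realAvg (fun x => w x ^ (1 - (2 : ℝ))) I) (realAvg w I)
  set B := (∫⁻ x in I.toSet, ‖f x‖ₑ ^ 2 * w x).toReal with hBdef
  have hB0 : 0 ≤ B := ENNReal.toReal_nonneg
  have h6 : ‖∫ x in I.toSet, f x‖ ^ 2 ≤ B * (volume.real I.toSet * X) :=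
    hnorm.trans (by gcongr)
  calc volume.real I.toSet * ((volume.real I.toSet)⁻¹ ^ 2 * ‖∫ x in I.toSet, f x‖ ^ 2)
      ≤ volume.real I.toSet * ((volume.real I.toSet)⁻¹ ^ 2 * (B * (volume.real I.toSet * X))) := by
        gcongr
    _ = B * X := by field_simp

end

end SquareFunction

/-- One step of the Bellman induction for the weighted square function. -/
theorem exists_energy_add_bellV_le (n : ℕ) (Q : ℝ) : ∃ c : ℝ, 0 < c ∧
    ∀ (w : (Fin n → ℝ) → ℝ≥0∞), Measurable w → (∀ x, w x ≠ 0) → (∀ x, w x ≠ ∞) →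
    ∀ D : Set (Cube n), JointAp D 2 (ENNReal.ofReal Q) w (fun x => w x ^ (1 - (2 : ℝ))) →
    ∀ f : (Fin n → ℝ) → ℂ, ∀ I ∈ D, (∀ ε, I.child ε ∈ D) → IntegrableOn f I.toSet →
      c * energy w f I + volume.real I.toSet * bellV w f I ≤
        ∑ ε, volume.real (I.child ε).toSet * bellV w f (I.child ε) := by
  obtain ⟨c, hc, H⟩ := bellman_sum (N := 2 ^ n) (Q := max Q 1) (one_le_pow₀ (by norm_num))
    (le_max_right _ _)
  refine ⟨c, hc, fun w hw hw0 hwt D hA f I hI hch hf => ?_⟩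
  obtain ⟨p1, p2, p3, p4⟩ := hA.realAvg_facts hw hw0 hwt hI
  obtain ⟨t1, t2⟩ := hA.two_ne_top hw hw0 hwt hI
  have hchild := fun ε => hA.realAvg_facts hw hw0 hwt (hch ε)
  have hsum := sum_average_child hf
  set s := realAvg (fun x => w x ^ (1 - (2 : ℝ))) I with hs
  set si := fun ε => realAvg (fun x => w x ^ (1 - (2 : ℝ))) (I.child ε) with hsi
  set wi := fun ε => realAvg w (I.child ε) with hwi
  set a := ⨍ x in I.toSet, f x with ha
  set ai := fun ε => ⨍ x in (I.child ε).toSet, f x with hai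
  -- The Bellman inequality is for real f; it is applied to real and imaginary parts and added,
  -- since |z|² splits.
  have hre := H (Fin n → Fin 2) (by simp) s (realAvg w I) p2 p1 p3 p4 a.re si wi
    (fun ε => (ai ε).re) (fun ε => (hchild ε).2.1) (fun ε => (hchild ε).1)
    (fun ε => (hchild ε).2.2.1) (sum_realAvg_child t2) (sum_realAvg_child t1) (by
      have := congrArg Complex.re hsum
      rw [Complex.re_sum, Complex.smul_re] at this
      exact this)
  have him := H (Fin n → Fin 2) (by simp) s (realAvg w I) p2 p1 p3 p4 a.im si wi
    (fun ε => (ai ε).im) (fun ε => (hchild ε).2.1) (fun ε => (hchild ε).1)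
    (fun ε => (hchild ε).2.2.1) (sum_realAvg_child t2) (sum_realAvg_child t1) (by
      have := congrArg Complex.im hsum
      rw [Complex.im_sum, Complex.smul_im] at this
      exact this)
  have hv := I.volume_real_pos
  have hN : (0 : ℝ) < 2 ^ n := by positivity
  have hsq : ∀ z : ℂ, ‖z‖ ^ 2 = z.re ^ 2 + z.im ^ 2 := fun z => by
    rw [Complex.sq_norm, Complex.normSq_apply]
    ring
  have key : c * (realAvg w I * ∑ ε, ‖ai ε - a‖ ^ 2) + 2 ^ n * (‖a‖ ^ 2 / bellX s (realAvg w I)) ≤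
      ∑ ε, ‖ai ε‖ ^ 2 / bellX (si ε) (wi ε) := by
    simp only [hsq, add_div, Finset.sum_add_distrib, Complex.sub_re, Complex.sub_im]
    linarith
  have hvc : ∀ ε, volume.real (I.child ε).toSet = volume.real I.toSet / 2 ^ n := fun ε => by
    rw [I.volume_real_child ε]
    field_simp
  simp only [hvc, ← Finset.mul_sum]
  have := mul_le_mul_of_nonneg_left key (show 0 ≤ volume.real I.toSet / 2 ^ n by positivity)
  calc c * energy w f I + volume.real I.toSet * bellV w f I
      = volume.real I.toSet / 2 ^ n * (c * (realAvg w I * ∑ ε, ‖ai ε - a‖ ^ 2) +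
          2 ^ n * (‖a‖ ^ 2 / bellX s (realAvg w I))) := by
        rw [energy, bellV]
        field_simp
        rfl
    _ ≤ _ := this

end BiParam

namespace BiParam

/-! ### Summation over the scales of a grid, and the weighted L² square function estimate. -/

section Levels

variable {n : ℕ}

/-- The cubes of side length `2 ^ k` of a grid. -/
abbrev gridLevel (D : Set (Cube n)) (k : ℤ) : Type :=
  {I : Cube n // I ∈ D ∧ I.side = (2 : ℝ) ^ k}

variable {D : Set (Cube n)} (hD : IsDyadicGrid D)
include hD

theorem tsum_gridLevel_lintegral_le (k : ℤ) (g : (Fin n → ℝ) → ℝ≥0∞) :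
    ∑' I : gridLevel D k, ∫⁻ x in I.1.toSet, g x ≤ ∫⁻ x, g x := by
  have : Countable (gridLevel D k) :=
    (hD.countable.mono (fun I (hI : I ∈ D ∧ I.side = (2 : ℝ) ^ k) => hI.1)).to_subtype
  rw [← lintegral_iUnion (fun I => I.1.measurableSet_toSet)]
  · exact setLIntegral_le_lintegral _ _
  · intro I J hIJ
    rw [Function.onFun, Set.disjoint_left]
    intro x hx hx'
    exact hIJ (Subtype.ext (hD.eq_of_mem I.2.1 J.2.1 (I.2.2.trans J.2.2.symm) hx hx'))

/-- Every finite set of scales lies in a window of consecutive scales, so bounds on all windows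
bound the full sum. -/
theorem tsum_le_of_gridLevel {g : Cube n → ℝ≥0∞} {B : ℝ≥0∞}
    (h : ∀ (a : ℤ) (N : ℕ),
      ∑ j ∈ Finset.range N, ∑' I : gridLevel D (a - j), g I.1 ≤ B) :
    ∑' I : D, g I ≤ B := by
  choose k hk using fun I : D => hD.side_eq I.1 I.2
  let F : D → Σ k : ℤ, gridLevel D k := fun I => ⟨k I, ⟨I.1, I.2, hk I⟩⟩
  have hF : Function.Injective F := by
    intro I J hIJ
    have : (F I).2.1 = (F J).2.1 := by rw [hIJ]
    exact Subtype.ext this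
  have h1 := ENNReal.tsum_comp_le_tsum_of_injective hF (fun x => g x.2.1)
  refine h1.trans ?_
  rw [ENNReal.tsum_sigma', ENNReal.tsum_eq_iSup_sum]
  refine iSup_le fun s => ?_
  obtain ⟨a, ha⟩ := s.bddAbove
  obtain ⟨b, hb⟩ := s.bddBelow
  refine le_trans ?_ (h a ((a - b).toNat + 1))
  rw [← Finset.sum_image (s := Finset.range ((a - b).toNat + 1)) (g := fun j : ℕ => a - (j : ℤ))
    (f := fun k : ℤ => ∑' I : gridLevel D k, g I.1) (by
      intro x _ y _ hxy
      simpa using hxy)]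
  refine Finset.sum_le_sum_of_subset fun z hz => ?_
  have h1 := ha hz
  have h2 := hb hz
  refine Finset.mem_image.2 ⟨(a - z).toNat, ?_, ?_⟩
  · rw [Finset.mem_range]
    omega
  · omega

/-- Passing to children is injective from the pairs of a cube of scale k and an orthant into the
cubes of scale k - 1. -/
theorem sum_tsum_child_le (hn : 0 < n) (k : ℤ) (g : Cube n → ℝ≥0∞) :
    ∑' I : gridLevel D k, ∑ ε, g (I.1.child ε) ≤ ∑' I : gridLevel D (k - 1), g I.1 := by
  let F : (Σ _ : gridLevel D k, Fin n → Fin 2) → gridLevel D (k - 1) := fun x =>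
    ⟨x.1.1.child x.2, hD.child_mem hn x.1.2.1 x.2, by
      rw [zpow_sub_one₀ (by norm_num), ← div_eq_mul_inv]
      exact congrArg (· / 2) x.1.2.2⟩
  have hF : Function.Injective F := by
    rintro ⟨I, ε⟩ ⟨J, δ⟩ h
    have h' : I.1.child ε = J.1.child δ := congrArg Subtype.val h
    have hx := I.1.child_subset ε (I.1.child ε).corner_mem
    have hx' := J.1.child_subset δ (J.1.child δ).corner_mem
    rw [← h'] at hx'
    have hIJ : I = J :=
      Subtype.ext (hD.eq_of_mem I.2.1 J.2.1 (I.2.2.trans J.2.2.symm) hx hx')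
    subst hIJ
    have : ε = δ := by
      by_contra hne
      have hdis := I.1.child_disjoint hne
      rw [h'] at hdis
      exact Set.disjoint_left.1 hdis (I.1.child δ).corner_mem (I.1.child δ).corner_mem
    rw [this]
  have h1 := ENNReal.tsum_comp_le_tsum_of_injective hF (fun x => g x.1)
  rw [ENNReal.tsum_sigma'] at h1
  simpa only [tsum_fintype] using h1

end Levels

/-- The weighted `L²` inequality for the dyadic square function, for dyadic `A₂` weights. -/
theorem exists_tsum_haar_le (n : ℕ) (hn : 0 < n) (Q : ℝ) : ∃ C : ℝ≥0, 0 < C ∧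
    ∀ (w : (Fin n → ℝ) → ℝ≥0∞), Measurable w → (∀ x, w x ≠ 0) → (∀ x, w x ≠ ∞) →
    ∀ D : Set (Cube n), IsDyadicGrid D →
    JointAp D 2 (ENNReal.ofReal Q) w (fun x => w x ^ (1 - (2 : ℝ))) →
    ∀ f : (Fin n → ℝ) → ℂ, Measurable f →
    ∀ S : Cube n → Finset (Fin n → Fin 2), (∀ I, 0 ∉ S I) →
      ∑' I : D, ∑ η ∈ S I, ‖∫ x, f x * (haar I.1 η x : ℂ)‖ₑ ^ 2 *
        ((∫⁻ x in I.1.toSet, w x) / volume I.1.toSet) ≤ C * ∫⁻ x, ‖f x‖ₑ ^ 2 * w x := by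
  obtain ⟨c, hc, H⟩ := exists_energy_add_bellV_le n Q
  refine ⟨Real.toNNReal (2 ^ n / c), by simpa using by positivity, ?_⟩
  intro w hw hw0 hwt D hD hA f hf S hS
  set B := ∫⁻ x, ‖f x‖ₑ ^ 2 * w x with hBdef
  by_cases hB : B = ∞
  · rw [hB, ENNReal.mul_top]
    · exact le_top
    · simpa using by positivity
  have hint : ∀ I ∈ D, IntegrableOn f I.toSet := fun I hI =>
    hA.integrableOn hw hw0 hwt hf hB hI
  have hVnn : ∀ I ∈ D, 0 ≤ volume.real I.toSet * bellV w f I := by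
    intro I hI
    obtain ⟨p1, p2, p3, -⟩ := hA.realAvg_facts hw hw0 hwt hI
    have := p2.trans_le (le_bellX p2 p1 p3)
    have := I.volume_real_pos
    unfold bellV
    positivity
  set V : Cube n → ℝ≥0∞ := fun I => ENNReal.ofReal (volume.real I.toSet * bellV w f I)
  set e : Cube n → ℝ≥0∞ := fun I => ENNReal.ofReal (c * energy w f I) with he
  have hstep : ∀ k : ℤ, (∑' I : gridLevel D k, e I.1) + ∑' I : gridLevel D k, V I.1 ≤
      ∑' I : gridLevel D (k - 1), V I.1 := by
    intro k
    rw [← ENNReal.tsum_add]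
    refine le_trans (ENNReal.tsum_le_tsum fun I => ?_) (sum_tsum_child_le hD hn k V)
    have h1 := H w hw hw0 hwt D hA f I.1 I.2.1 (fun ε => hD.child_mem hn I.2.1 ε) (hint _ I.2.1)
    rw [he, ← ENNReal.ofReal_add (mul_nonneg hc.le (energy_nonneg w f I.1)) (hVnn _ I.2.1),
      ← ENNReal.ofReal_sum_of_nonneg fun ε _ => hVnn _ (hD.child_mem hn I.2.1 ε)]
    exact ENNReal.ofReal_le_ofReal h1
  have hVB : ∀ k : ℤ, ∑' I : gridLevel D k, V I.1 ≤ B := fun k =>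
    (ENNReal.tsum_le_tsum fun I => hA.bellV_le hw hw0 hwt hf hB I.2.1).trans
      (tsum_gridLevel_lintegral_le hD k _)
  -- Telescoping: the Bellman sums increase from one generation to the next by at least the energy,
  -- yet never exceed `B`, so the total energy is at most `B` over every window of scales.
  have htel : ∀ (a : ℤ) (N : ℕ), (∑ j ∈ Finset.range N, ∑' I : gridLevel D (a - j), e I.1) +
      ∑' I : gridLevel D a, V I.1 ≤ ∑' I : gridLevel D (a - N), V I.1 := by
    intro a N
    induction N with
    | zero =>
      rw [Finset.sum_range_zero, zero_add, Nat.cast_zero, sub_zero]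
    | succ N ih =>
      rw [Finset.sum_range_succ, add_right_comm, add_comm]
      refine (add_le_add_right ih _).trans ?_
      have := hstep (a - N)
      rwa [show a - (N : ℤ) - 1 = a - ((N + 1 : ℕ) : ℤ) by push_cast; ring] at this
  have htot : ∑' I : D, e I ≤ B := tsum_le_of_gridLevel hD fun a N =>
    (le_self_add.trans (htel a N)).trans (hVB _)
  calc _ ≤ ∑' I : D, ENNReal.ofReal (2 ^ n / c) * e I := by
        refine ENNReal.tsum_le_tsum fun I => ?_
        have hI := I.2
        obtain ⟨p1, p2, p3, -⟩ := hA.realAvg_facts hw hw0 hwt hI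
        obtain ⟨t1, -⟩ := hA.two_ne_top hw hw0 hwt hI
        have hterm : ∀ η ∈ S I, ‖∫ x, f x * (haar I.1 η x : ℂ)‖ₑ ^ 2 *
            ((∫⁻ x in I.1.toSet, w x) / volume I.1.toSet) ≤ ENNReal.ofReal (energy w f I.1) := by
          intro η hη
          have hη0 : η ≠ 0 := fun h => hS I.1 (h ▸ hη)
          have e1 : (∫⁻ x in I.1.toSet, w x) / volume I.1.toSet =
              ENNReal.ofReal (realAvg w I.1) := by
            rw [realAvg, ENNReal.ofReal_div_of_pos I.1.volume_real_pos, ENNReal.ofReal_toReal t1,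
              Measure.real, ENNReal.ofReal_toReal I.1.volume_ne_top]
          rw [e1, ← ofReal_norm, ← ENNReal.ofReal_pow (norm_nonneg _),
            ← ENNReal.ofReal_mul (by positivity)]
          refine ENNReal.ofReal_le_ofReal ?_
          rw [energy]
          have := mul_le_mul_of_nonneg_right (sq_norm_integral_mul_haar_le (hint _ hI) hη0) p1.le
          linarith
        refine (Finset.sum_le_sum hterm).trans ?_
        rw [Finset.sum_const, nsmul_eq_mul, he]
        simp only
        rw [← ENNReal.ofReal_mul (by positivity), show 2 ^ n / c * (c * energy w f I.1) =
          2 ^ n * energy w f I.1 by field_simp, ENNReal.ofReal_mul (by positivity)]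
        gcongr
        -- Every signature is bounded by the same energy; the number of signatures is the factor 2^n
        -- in the constant.
        have hcard : (S I).card ≤ 2 ^ n := by
          simpa using Finset.card_le_univ (S I)
        rw [ENNReal.ofReal_pow (by norm_num), ENNReal.ofReal_ofNat]
        exact_mod_cast hcard
    _ = ENNReal.ofReal (2 ^ n / c) * ∑' I : D, e I := ENNReal.tsum_mul_left
    _ ≤ _ := by
        rw [ENNReal.ofReal]
        gcongr

end BiParam

namespace BiParam

/-! ### The Rubio de Francia algorithm for the sum of the two maximal functions. -/

section RubioDeFrancia

variable {n m : ℕ}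

/-- The sum of the dyadic maximal functions in the two variables. -/
noncomputable def sumMax (D : Set (Cube n)) (E : Set (Cube m))
    (g : (Fin n → ℝ) × (Fin m → ℝ) → ℝ≥0∞) (z : (Fin n → ℝ) × (Fin m → ℝ)) : ℝ≥0∞ :=
  maxM volume D (fun x => g (x, z.2)) z.1 + maxM volume E (fun y => g (z.1, y)) z.2

/-- The dyadic `A_p` condition, uniformly on almost all fibres in both variables. -/
def FiberAp (D : Set (Cube n)) (E : Set (Cube m)) (p q : ℝ) (Q : ℝ≥0∞)
    (w : (Fin n → ℝ) × (Fin m → ℝ) → ℝ≥0∞) : Prop :=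
  (∀ᵐ y, JointAp D p Q (fun x => w (x, y)) (fun x => w (x, y) ^ (1 - q))) ∧
  (∀ᵐ x, JointAp E p Q (fun y => w (x, y)) (fun y => w (x, y) ^ (1 - q)))

theorem measurable_maxM_fst {D : Set (Cube n)} (hc : D.Countable)
    {g : (Fin n → ℝ) × (Fin m → ℝ) → ℝ≥0∞} (hg : Measurable g) :
    Measurable fun z : (Fin n → ℝ) × (Fin m → ℝ) => maxM volume D (fun x => g (x, z.2)) z.1 := by
  refine Measurable.biSup D hc fun I _ => ?_
  have h1 : Measurable fun z : (Fin n → ℝ) × (Fin m → ℝ) =>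
      (∫⁻ x in I.toSet, g (x, z.2)) / volume I.toSet :=
    ((Measurable.lintegral_prod_left' hg).comp measurable_snd).div_const _
  exact h1.indicator (measurable_fst I.measurableSet_toSet)

theorem measurable_maxM_snd {E : Set (Cube m)} (hc : E.Countable)
    {g : (Fin n → ℝ) × (Fin m → ℝ) → ℝ≥0∞} (hg : Measurable g) :
    Measurable fun z : (Fin n → ℝ) × (Fin m → ℝ) => maxM volume E (fun y => g (z.1, y)) z.2 := by
  refine Measurable.biSup E hc fun J _ => ?_
  have h1 : Measurable fun z : (Fin n → ℝ) × (Fin m → ℝ) =>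
      (∫⁻ y in J.toSet, g (z.1, y)) / volume J.toSet :=
    ((Measurable.lintegral_prod_right' hg).comp measurable_fst).div_const _
  exact h1.indicator (measurable_snd J.measurableSet_toSet)

theorem measurable_sumMax {D : Set (Cube n)} {E : Set (Cube m)} (hD : D.Countable)
    (hE : E.Countable) {g : (Fin n → ℝ) × (Fin m → ℝ) → ℝ≥0∞} (hg : Measurable g) :
    Measurable (sumMax D E g) :=
  (measurable_maxM_fst hD hg).add (measurable_maxM_snd hE hg)

/-- Countable sublinearity, which lets the operator be applied to the series of the algorithm. -/
theorem maxM_tsum_le {D : Set (Cube n)} {c : ℕ → ℝ≥0∞} (hc : ∀ k, c k ≠ ∞)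
    {g : ℕ → (Fin n → ℝ) → ℝ≥0∞} (hg : ∀ k, Measurable (g k)) (x : Fin n → ℝ) :
    maxM volume D (fun y => ∑' k, c k * g k y) x ≤ ∑' k, c k * maxM volume D (g k) x := by
  refine maxM_le fun I hI hx => ?_
  rw [lintegral_tsum fun k => ((hg k).const_mul _).aemeasurable, ENNReal.div_eq_inv_mul,
    ← ENNReal.tsum_mul_left]
  refine ENNReal.tsum_le_tsum fun k => ?_
  rw [lintegral_const_mul' _ _ (hc k), mul_left_comm, ← ENNReal.div_eq_inv_mul]
  gcongr
  exact le_maxM hI hx (g k)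

theorem sumMax_tsum_le {D : Set (Cube n)} {E : Set (Cube m)} {c : ℕ → ℝ≥0∞} (hc : ∀ k, c k ≠ ∞)
    {g : ℕ → (Fin n → ℝ) × (Fin m → ℝ) → ℝ≥0∞} (hg : ∀ k, Measurable (g k))
    (z : (Fin n → ℝ) × (Fin m → ℝ)) :
    sumMax D E (fun y => ∑' k, c k * g k y) z ≤ ∑' k, c k * sumMax D E (g k) z := by
  simp only [sumMax, mul_add, ENNReal.tsum_add]
  exact add_le_add (maxM_tsum_le hc (fun k => (hg k).comp measurable_prodMk_right) z.1)
    (maxM_tsum_le hc (fun k => (hg k).comp measurable_prodMk_left) z.2)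

theorem lintegral_eq_lintegral_fst_snd {F : (Fin n → ℝ) × (Fin m → ℝ) → ℝ≥0∞}
    (hF : Measurable F) : ∫⁻ z, F z = ∫⁻ x, ∫⁻ y, F (x, y) :=
  lintegral_prod F hF.aemeasurable

theorem lintegral_eq_lintegral_snd_fst {F : (Fin n → ℝ) × (Fin m → ℝ) → ℝ≥0∞}
    (hF : Measurable F) : ∫⁻ z, F z = ∫⁻ y, ∫⁻ x, F (x, y) :=
  lintegral_prod_symm F hF.aemeasurable

/-- Fubini and Muckenhoupt's theorem on almost every fibre, once in each variable, joined by (u +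
v)^p ≤ 2^{p-1}(u^p + v^p). -/
theorem lintegral_sumMax_rpow_mul_le {D : Set (Cube n)} {E : Set (Cube m)} (hD : IsDyadicGrid D)
    (hE : IsDyadicGrid E) (hn : 0 < n) (hm : 0 < m) {p q : ℝ} (hpq : p.HolderConjugate q)
    {Q : ℝ≥0∞} (hQ : Q ≠ ∞) {w : (Fin n → ℝ) × (Fin m → ℝ) → ℝ≥0∞} (hw : Measurable w)
    (hw0 : ∀ z, w z ≠ 0) (hwt : ∀ z, w z ≠ ∞) (hA : FiberAp D E p q Q w)
    {g : (Fin n → ℝ) × (Fin m → ℝ) → ℝ≥0∞} (hg : Measurable g) :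
    ∫⁻ z, sumMax D E g z ^ p * w z ≤ 2 ^ (p - 1) * (2 * maxConst p q Q) * ∫⁻ z, g z ^ p * w z := by
  have hm1 := measurable_maxM_fst hD.countable hg
  have hm2 := measurable_maxM_snd hE.countable hg
  have hgw : Measurable fun z => g z ^ p * w z := (hg.pow_const _).mul hw
  have hw1 : Measurable fun z : (Fin n → ℝ) × (Fin m → ℝ) =>
      maxM volume D (fun x => g (x, z.2)) z.1 ^ p * w z := (hm1.pow_const _).mul hw
  have hw2 : Measurable fun z : (Fin n → ℝ) × (Fin m → ℝ) =>
      maxM volume E (fun y => g (z.1, y)) z.2 ^ p * w z := (hm2.pow_const _).mul hw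
  have b1 : ∫⁻ z : (Fin n → ℝ) × (Fin m → ℝ), maxM volume D (fun x => g (x, z.2)) z.1 ^ p * w z ≤
      maxConst p q Q * ∫⁻ z, g z ^ p * w z := by
    rw [lintegral_eq_lintegral_snd_fst hw1, lintegral_eq_lintegral_snd_fst hgw, ← lintegral_const_mul' _ _ (maxConst_ne_top hpq hQ)]
    refine lintegral_mono_ae (hA.1.mono fun y hy => ?_)
    exact lintegral_maxM_rpow_mul_le (w := fun x => w (x, y)) (g := fun x => g (x, y))
      hD hn hpq hQ (hw.comp measurable_prodMk_right)
      (fun x => hw0 _) (fun x => hwt _) hy (hg.comp measurable_prodMk_right)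
  have b2 : ∫⁻ z : (Fin n → ℝ) × (Fin m → ℝ), maxM volume E (fun y => g (z.1, y)) z.2 ^ p * w z ≤
      maxConst p q Q * ∫⁻ z, g z ^ p * w z := by
    rw [lintegral_eq_lintegral_fst_snd hw2, lintegral_eq_lintegral_fst_snd hgw, ← lintegral_const_mul' _ _ (maxConst_ne_top hpq hQ)]
    refine lintegral_mono_ae (hA.2.mono fun x hx => ?_)
    exact lintegral_maxM_rpow_mul_le (w := fun y => w (x, y)) (g := fun y => g (x, y))
      hE hm hpq hQ (hw.comp measurable_prodMk_left)
      (fun x => hw0 _) (fun x => hwt _) hx (hg.comp measurable_prodMk_left)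
  have h2t : (2 : ℝ≥0∞) ^ (p - 1) ≠ ∞ :=
    ENNReal.rpow_ne_top_of_nonneg hpq.sub_one_pos.le (by norm_num)
  calc ∫⁻ z, sumMax D E g z ^ p * w z
      ≤ ∫⁻ z, 2 ^ (p - 1) * (maxM volume D (fun x => g (x, z.2)) z.1 ^ p * w z +
          maxM volume E (fun y => g (z.1, y)) z.2 ^ p * w z) := by
        refine lintegral_mono fun z => ?_
        simp only
        rw [← add_mul, ← mul_assoc]
        gcongr
        exact ENNReal.rpow_add_le_mul_rpow_add_rpow _ _ hpq.lt.le
    _ = 2 ^ (p - 1) * ((∫⁻ z, maxM volume D (fun x => g (x, z.2)) z.1 ^ p * w z) +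
          ∫⁻ z, maxM volume E (fun y => g (z.1, y)) z.2 ^ p * w z) := by
        rw [lintegral_const_mul' _ _ h2t, lintegral_add_left hw1]
    _ ≤ 2 ^ (p - 1) * ((maxConst p q Q * ∫⁻ z, g z ^ p * w z) +
          maxConst p q Q * ∫⁻ z, g z ^ p * w z) := by gcongr
    _ = _ := by ring

/-- The Rubio de Francia algorithm. -/
noncomputable def rubio (D : Set (Cube n)) (E : Set (Cube m)) (a : ℝ≥0∞)
    (g : (Fin n → ℝ) × (Fin m → ℝ) → ℝ≥0∞) (z : (Fin n → ℝ) × (Fin m → ℝ)) : ℝ≥0∞ :=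
  ∑' k : ℕ, ((2 * a)⁻¹) ^ k * (sumMax D E)^[k] g z

section

variable {D : Set (Cube n)} {E : Set (Cube m)} {a : ℝ≥0∞}
  {g : (Fin n → ℝ) × (Fin m → ℝ) → ℝ≥0∞}

theorem le_rubio (z : (Fin n → ℝ) × (Fin m → ℝ)) : g z ≤ rubio D E a g z := by
  have h := ENNReal.le_tsum (f := fun k : ℕ => ((2 * a)⁻¹) ^ k * (sumMax D E)^[k] g z) 0
  simpa [rubio] using h

theorem measurable_iterate_sumMax (hD : D.Countable) (hE : E.Countable) (hg : Measurable g)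
    (k : ℕ) : Measurable ((sumMax D E)^[k] g) := by
  induction k with
  | zero => simpa using hg
  | succ k ih =>
    rw [Function.iterate_succ_apply']
    exact measurable_sumMax hD hE ih

theorem measurable_rubio (hD : D.Countable) (hE : E.Countable) (hg : Measurable g) :
    Measurable (rubio D E a g) :=
  Measurable.tsum fun k => (measurable_iterate_sumMax hD hE hg k).const_mul _

/-- Applying the operator shifts the series by one index at the cost of the factor 2a. This is a
dyadic A₁ condition on every fibre in both variables. -/
theorem sumMax_rubio_le (hD : D.Countable) (hE : E.Countable) (ha0 : a ≠ 0) (ha : a ≠ ∞)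
    (hg : Measurable g) (z : (Fin n → ℝ) × (Fin m → ℝ)) :
    sumMax D E (rubio D E a g) z ≤ 2 * a * rubio D E a g z := by
  have h2a : 2 * a ≠ 0 := by simpa using ha0
  have h2t : 2 * a ≠ ∞ := ENNReal.mul_ne_top (by norm_num) ha
  refine (sumMax_tsum_le (fun k => ENNReal.pow_ne_top (ENNReal.inv_ne_top.2 h2a))
    (fun k => measurable_iterate_sumMax hD hE hg k) z).trans ?_
  rw [rubio, ← ENNReal.tsum_mul_left]
  have h1 : ∀ k : ℕ, ((2 * a)⁻¹) ^ k * sumMax D E ((sumMax D E)^[k] g) z =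
      2 * a * (((2 * a)⁻¹) ^ (k + 1) * (sumMax D E)^[k + 1] g z) := by
    intro k
    rw [Function.iterate_succ_apply', pow_succ, ← mul_assoc, mul_comm _ (2 * a)⁻¹,
      ← mul_assoc (2 * a), ENNReal.mul_inv_cancel h2a h2t, one_mul]
  simp only [h1]
  exact ENNReal.tsum_comp_le_tsum_of_injective (add_left_injective 1)
    (fun k : ℕ => 2 * a * (((2 * a)⁻¹) ^ k * (sumMax D E)^[k] g z))

/-- Hölder with respect to the weights 2^{-k}, whose total mass is 2. It takes the place of
Minkowski's inequality. -/
theorem tsum_two_inv_pow_mul_rpow_le {p q : ℝ} (hpq : p.HolderConjugate q) (b : ℕ → ℝ≥0∞) :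
    (∑' k, (2⁻¹ : ℝ≥0∞) ^ k * b k) ^ p ≤ 2 ^ (p - 1) * ∑' k, (2⁻¹ : ℝ≥0∞) ^ k * b k ^ p := by
  have h := ENNReal.lintegral_mul_le_Lp_mul_Lq (Measure.count : Measure ℕ) hpq
    (f := fun k => ((2⁻¹ : ℝ≥0∞) ^ k) ^ (1 / p) * b k) (g := fun k => ((2⁻¹ : ℝ≥0∞) ^ k) ^ (1 / q))
    (measurable_of_countable _).aemeasurable (measurable_of_countable _).aemeasurable
  have hp0 := hpq.ne_zero
  have hq0 := hpq.symm.ne_zero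
  have e1 : ∀ k : ℕ, ((2⁻¹ : ℝ≥0∞) ^ k) ^ (1 / p) * b k * ((2⁻¹ : ℝ≥0∞) ^ k) ^ (1 / q) =
      (2⁻¹ : ℝ≥0∞) ^ k * b k := by
    intro k
    rw [mul_right_comm, ← ENNReal.rpow_add_of_nonneg _ _ (by simpa using hpq.nonneg)
      (by simpa using hpq.symm.nonneg), one_div, one_div, hpq.inv_add_inv_eq_one, ENNReal.rpow_one]
  have e2 : ∀ k, (((2⁻¹ : ℝ≥0∞) ^ k) ^ (1 / p) * b k) ^ p = (2⁻¹ : ℝ≥0∞) ^ k * b k ^ p := by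
    intro k
    rw [ENNReal.mul_rpow_of_nonneg _ _ hpq.nonneg, ← ENNReal.rpow_mul, one_div_mul_cancel hp0,
      ENNReal.rpow_one]
  have e3 : ∀ k : ℕ, (((2⁻¹ : ℝ≥0∞) ^ k) ^ (1 / q)) ^ q = (2⁻¹ : ℝ≥0∞) ^ k := by
    intro k
    rw [← ENNReal.rpow_mul, one_div_mul_cancel hq0, ENNReal.rpow_one]
  simp only [lintegral_count, Pi.mul_apply, e1, e2, e3, ENNReal.tsum_geometric, ENNReal.one_sub_inv_two,
    inv_inv] at h
  have h2 := ENNReal.rpow_le_rpow h hpq.nonneg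
  rw [ENNReal.mul_rpow_of_nonneg _ _ hpq.nonneg, ← ENNReal.rpow_mul, one_div_mul_cancel hp0,
    ENNReal.rpow_one, ← ENNReal.rpow_mul, mul_comm] at h2
  have e4 : 1 / q * p = p - 1 := by
    have := hpq.mul_eq_add
    field_simp
    linarith
  rwa [e4] at h2

/-- The k-th iterate divided by a^k has norm at most that of `g`, which leaves the geometric weights
2^{-k}; the constant is 2^{p-1} · 2. -/
theorem lintegral_rubio_rpow_mul_le (hD : D.Countable) (hE : E.Countable) (ha0 : a ≠ 0)
    (ha : a ≠ ∞) {p q : ℝ} (hpq : p.HolderConjugate q)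
    {w : (Fin n → ℝ) × (Fin m → ℝ) → ℝ≥0∞} (hw : Measurable w)
    (hT : ∀ h : (Fin n → ℝ) × (Fin m → ℝ) → ℝ≥0∞, Measurable h →
      ∫⁻ z, sumMax D E h z ^ p * w z ≤ a ^ p * ∫⁻ z, h z ^ p * w z)
    (hg : Measurable g) :
    ∫⁻ z, rubio D E a g z ^ p * w z ≤ 2 ^ p * ∫⁻ z, g z ^ p * w z := by
  have hap0 : a ^ p ≠ 0 := by
    simp [ENNReal.rpow_eq_zero_iff, ha0, ha]
  have hapt : a ^ p ≠ ∞ := ENNReal.rpow_ne_top_of_nonneg hpq.nonneg ha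
  have hit : ∀ k : ℕ, ∫⁻ z, ((a⁻¹) ^ k * (sumMax D E)^[k] g z) ^ p * w z ≤
      ∫⁻ z, g z ^ p * w z := by
    intro k
    have h1 : ∫⁻ z, (sumMax D E)^[k] g z ^ p * w z ≤ (a ^ p) ^ k * ∫⁻ z, g z ^ p * w z := by
      induction k with
      | zero => simp
      | succ k ih =>
        simp only [Function.iterate_succ_apply']
        refine (hT _ (measurable_iterate_sumMax hD hE hg k)).trans ?_
        rw [pow_succ', mul_assoc]
        gcongr
    have h2 : ∀ z, ((a⁻¹) ^ k * (sumMax D E)^[k] g z) ^ p * w z =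
        ((a ^ p) ^ k)⁻¹ * ((sumMax D E)^[k] g z ^ p * w z) := by
      intro z
      rw [ENNReal.mul_rpow_of_nonneg _ _ hpq.nonneg, mul_assoc]
      congr 1
      rw [← ENNReal.rpow_natCast, ← ENNReal.rpow_natCast, ← ENNReal.rpow_mul, ENNReal.inv_rpow,
        ← ENNReal.rpow_mul, mul_comm]
    have h3 : (a ^ p) ^ k ≠ 0 := pow_ne_zero _ hap0
    have h4 : (a ^ p) ^ k ≠ ∞ := ENNReal.pow_ne_top hapt
    simp only [h2]
    rw [lintegral_const_mul' _ _ (ENNReal.inv_ne_top.2 h3)]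
    calc _ ≤ ((a ^ p) ^ k)⁻¹ * ((a ^ p) ^ k * ∫⁻ z, g z ^ p * w z) := by gcongr
      _ = _ := by rw [← mul_assoc, ENNReal.inv_mul_cancel h3 h4, one_mul]
  have hrub : ∀ z, rubio D E a g z =
      ∑' k : ℕ, (2⁻¹ : ℝ≥0∞) ^ k * ((a⁻¹) ^ k * (sumMax D E)^[k] g z) := by
    intro z
    refine tsum_congr fun k => ?_
    rw [ENNReal.mul_inv (by simp) (by simp), mul_pow, mul_assoc]
  have h2t : (2 : ℝ≥0∞) ^ (p - 1) ≠ ∞ :=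
    ENNReal.rpow_ne_top_of_nonneg hpq.sub_one_pos.le (by norm_num)
  calc ∫⁻ z, rubio D E a g z ^ p * w z
      ≤ ∫⁻ z, 2 ^ (p - 1) * ∑' k : ℕ, (2⁻¹ : ℝ≥0∞) ^ k *
          (((a⁻¹) ^ k * (sumMax D E)^[k] g z) ^ p * w z) := by
        refine lintegral_mono fun z => ?_
        simp only
        rw [hrub]
        refine (mul_le_mul_left (tsum_two_inv_pow_mul_rpow_le hpq _) (w z)).trans (le_of_eq ?_)
        rw [mul_assoc, ← ENNReal.tsum_mul_right]
        congr 2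
        ext k
        ring
    _ = 2 ^ (p - 1) * ∑' k : ℕ, (2⁻¹ : ℝ≥0∞) ^ k *
          ∫⁻ z, (((a⁻¹) ^ k * (sumMax D E)^[k] g z) ^ p * w z) := by
        have hmk : ∀ k : ℕ, Measurable fun z =>
            ((a⁻¹) ^ k * (sumMax D E)^[k] g z) ^ p * w z := fun k =>
          (((measurable_iterate_sumMax hD hE hg k).const_mul _).pow_const _).mul hw
        rw [lintegral_const_mul' _ _ h2t, lintegral_tsum fun k =>
          ((hmk k).const_mul _).aemeasurable]
        congr 2
        ext k
        rw [lintegral_const_mul _ (hmk k)]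
    _ ≤ 2 ^ (p - 1) * ∑' k : ℕ, (2⁻¹ : ℝ≥0∞) ^ k * ∫⁻ z, g z ^ p * w z := by
        exact mul_le_mul_right (ENNReal.tsum_le_tsum fun k => mul_le_mul_right (hit k) _) _
    _ = _ := by
        rw [ENNReal.tsum_mul_right, ENNReal.tsum_geometric, ENNReal.one_sub_inv_two, inv_inv,
          ← mul_assoc]
        congr 1
        conv_lhs => rw [← ENNReal.rpow_one 2, ← ENNReal.rpow_mul, one_mul,
          ← ENNReal.rpow_add _ _ (by norm_num) (by norm_num)]
        congr 1
        ring

end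

/-- The quotient of two dyadic `A₁` weights is a dyadic `A₂` weight. -/
theorem jointAp_two_of_maxM_le {D : Set (Cube n)} {b : ℝ≥0∞} {h₁ h₂ W : (Fin n → ℝ) → ℝ≥0∞}
    (hb : b ≠ ∞) (hh₁ : Measurable h₁) (hh₂ : Measurable h₂)
    (h₁0 : ∀ x, h₁ x ≠ 0) (h₂0 : ∀ x, h₂ x ≠ 0)
    (h₁t : ∀ᵐ x, h₁ x ≠ ∞) (h₂t : ∀ᵐ x, h₂ x ≠ ∞)
    (hM₁ : ∀ x, maxM volume D h₁ x ≤ b * h₁ x) (hM₂ : ∀ x, maxM volume D h₂ x ≤ b * h₂ x)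
    (hW : ∀ᵐ x, W x = h₂ x / h₁ x) :
    JointAp D 2 (b ^ 2) W (fun x => W x ^ (1 - (2 : ℝ))) := by
  intro I hI
  have hL0 := I.volume_ne_zero
  have hLt := I.volume_ne_top
  -- The A₁ condition in the form of an upper bound for 1/h on I by b|I|/∫_I h. It pulls the
  -- denominators out of the integrals of h₂/h₁ and h₁/h₂, and the remaining masses cancel in the
  -- product.
  have aux : ∀ h : (Fin n → ℝ) → ℝ≥0∞, Measurable h → (∀ x, h x ≠ 0) → (∀ᵐ x, h x ≠ ∞) →
      (∀ x, maxM volume D h x ≤ b * h x) → ∫⁻ x in I.toSet, h x ≠ 0 ∧ ∫⁻ x in I.toSet, h x ≠ ∞ ∧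
      ∀ x ∈ I.toSet, (h x)⁻¹ ≤ b * volume I.toSet / ∫⁻ x in I.toSet, h x := by
    intro h hh h0 ht hM
    have hle : ∀ x ∈ I.toSet, ∫⁻ x in I.toSet, h x ≤ b * h x * volume I.toSet := fun x hx =>
      (ENNReal.div_le_iff hL0 hLt).1 ((le_maxM hI hx h).trans (hM x))
    have hne0 := setLIntegral_cube_ne_zero hh h0 I
    have hnet : ∫⁻ x in I.toSet, h x ≠ ∞ := by
      obtain ⟨x, hx, hxt⟩ : ∃ x ∈ I.toSet, h x ≠ ∞ := by
        by_contra! hcon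
        refine hL0 (measure_mono_null (fun x hx => ?_) (ae_iff.1 ht))
        simpa using hcon x hx
      exact ne_top_of_le_ne_top (ENNReal.mul_ne_top (ENNReal.mul_ne_top hb hxt) hLt) (hle x hx)
    refine ⟨hne0, hnet, fun x hx => ?_⟩
    rw [ENNReal.le_div_iff_mul_le (Or.inl hne0) (Or.inl hnet)]
    by_cases hxt : h x = ∞
    · simp [hxt]
    calc (h x)⁻¹ * ∫⁻ x in I.toSet, h x ≤ (h x)⁻¹ * (b * h x * volume I.toSet) := by
          gcongr
          exact hle x hx
      _ = ((h x)⁻¹ * h x) * (b * volume I.toSet) := by ring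
      _ = _ := by rw [ENNReal.inv_mul_cancel (h0 x) hxt, one_mul]
  obtain ⟨z1, t1, k1⟩ := aux h₁ hh₁ h₁0 h₁t hM₁
  obtain ⟨z2, t2, k2⟩ := aux h₂ hh₂ h₂0 h₂t hM₂
  set L := volume I.toSet with hL
  have c1 : ∫⁻ x in I.toSet, W x ≤ (b * L / ∫⁻ x in I.toSet, h₁ x) * ∫⁻ x in I.toSet, h₂ x := by
    rw [← lintegral_const_mul _ hh₂]
    refine lintegral_mono_ae ?_
    filter_upwards [ae_restrict_of_ae hW, ae_restrict_mem I.measurableSet_toSet] with x hx hxI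
    rw [hx, ENNReal.div_eq_inv_mul]
    gcongr
    exact k1 x hxI
  have c2 : ∫⁻ x in I.toSet, W x ^ (1 - (2 : ℝ)) ≤
      (b * L / ∫⁻ x in I.toSet, h₂ x) * ∫⁻ x in I.toSet, h₁ x := by
    rw [← lintegral_const_mul _ hh₁]
    refine lintegral_mono_ae ?_
    filter_upwards [ae_restrict_of_ae hW, ae_restrict_of_ae h₁t, ae_restrict_of_ae h₂t,
      ae_restrict_mem I.measurableSet_toSet] with x hx hx1 hx2 hxI
    rw [hx, show (1 : ℝ) - 2 = -1 by norm_num, ENNReal.rpow_neg_one,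
      ENNReal.inv_div (Or.inl hx1) (Or.inl (h₁0 x)), ENNReal.div_eq_inv_mul]
    gcongr
    exact k2 x hxI
  rw [show (2 : ℝ) - 1 = 1 by norm_num, ENNReal.rpow_one, ENNReal.rpow_two]
  refine (mul_le_mul' c1 c2).trans (le_of_eq ?_)
  set u := ∫⁻ x in I.toSet, h₁ x
  set v := ∫⁻ x in I.toSet, h₂ x
  calc b * L / u * v * (b * L / v * u) = b ^ 2 * L ^ 2 * (u⁻¹ * u) * (v⁻¹ * v) := by
        simp only [ENNReal.div_eq_inv_mul]
        ring
    _ = _ := by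
        rw [ENNReal.inv_mul_cancel z1 t1, ENNReal.inv_mul_cancel z2 t2, mul_one, mul_one]

end RubioDeFrancia

end BiParam

namespace BiParam

/-! ### Extrapolation from L² to L^p. -/

section Extrapolation

variable {n m : ℕ}

theorem FiberAp.symm {D : Set (Cube n)} {E : Set (Cube m)} {p q : ℝ} (hpq : p.HolderConjugate q)
    {Q : ℝ≥0∞} {w : (Fin n → ℝ) × (Fin m → ℝ) → ℝ≥0∞} (h : FiberAp D E p q Q w) :
    FiberAp D E q p (Q ^ (q - 1)) (fun z => w z ^ (1 - q)) := by
  have e : ∀ z, (w z ^ (1 - q)) ^ (1 - p) = w z := by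
    intro z
    have := hpq.mul_eq_add
    rw [← ENNReal.rpow_mul, show (1 - q) * (1 - p) = 1 by linarith, ENNReal.rpow_one]
  simp only [FiberAp, e]
  exact ⟨h.1.mono fun y hy => hy.symm hpq, h.2.mono fun x hx => hx.symm hpq⟩

/-- Hölder after inserting w^{1/p} w^{-1/p}: under the unweighted pairing the dual of L^p(w) is
L^q(w^{1-q}). -/
theorem lintegral_mul_le_weight {α : Type*} [MeasurableSpace α] {μ : Measure α} {p q : ℝ}
    (hpq : p.HolderConjugate q)
    {w u v : α → ℝ≥0∞} (hw : Measurable w) (hw0 : ∀ z, w z ≠ 0) (hwt : ∀ z, w z ≠ ∞)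
    (hu : Measurable u) (hv : Measurable v) :
    ∫⁻ z, u z * v z ∂μ ≤
      (∫⁻ z, u z ^ p * w z ∂μ) ^ (1 / p) * (∫⁻ z, v z ^ q * w z ^ (1 - q) ∂μ) ^ (1 / q) := by
  have h := ENNReal.lintegral_mul_le_Lp_mul_Lq μ hpq
    (f := fun z => u z * w z ^ (1 / p)) (g := fun z => v z * w z ^ (-(1 / p)))
    (hu.mul (hw.pow_const _)).aemeasurable (hv.mul (hw.pow_const _)).aemeasurable
  have hp0 := hpq.ne_zero
  have e1 : ∀ z, u z * w z ^ (1 / p) * (v z * w z ^ (-(1 / p))) = u z * v z := by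
    intro z
    rw [mul_mul_mul_comm, ← ENNReal.rpow_add _ _ (hw0 z) (hwt z), add_neg_cancel,
      ENNReal.rpow_zero, mul_one]
  have e2 : ∀ z, (u z * w z ^ (1 / p)) ^ p = u z ^ p * w z := by
    intro z
    rw [ENNReal.mul_rpow_of_nonneg _ _ hpq.nonneg, ← ENNReal.rpow_mul, one_div_mul_cancel hp0,
      ENNReal.rpow_one]
  have e3 : ∀ z, (v z * w z ^ (-(1 / p))) ^ q = v z ^ q * w z ^ (1 - q) := by
    intro z
    have := hpq.mul_eq_add
    rw [ENNReal.mul_rpow_of_nonneg _ _ hpq.symm.nonneg, ← ENNReal.rpow_mul,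
      show -(1 / p) * q = 1 - q by field_simp; linarith]
  simpa only [Pi.mul_apply, e1, e2, e3] using h

/-- Each one-variable maximal function is at most their sum, so H₁ and H₂ are A₁ on all fibres of
both families, and A₁ quotients are A₂. -/
theorem fiberAp_two_of_sumMax_le {D : Set (Cube n)} {E : Set (Cube m)} {b : ℝ≥0∞}
    {H₁ H₂ W : (Fin n → ℝ) × (Fin m → ℝ) → ℝ≥0∞}
    (hb : b ≠ ∞) (hH₁ : Measurable H₁) (hH₂ : Measurable H₂)
    (h₁0 : ∀ z, H₁ z ≠ 0) (h₂0 : ∀ z, H₂ z ≠ 0)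
    (h₁t : ∀ᵐ z, H₁ z ≠ ∞) (h₂t : ∀ᵐ z, H₂ z ≠ ∞)
    (hM₁ : ∀ z, sumMax D E H₁ z ≤ b * H₁ z) (hM₂ : ∀ z, sumMax D E H₂ z ≤ b * H₂ z)
    (hW : ∀ᵐ z, W z = H₂ z / H₁ z) : FiberAp D E 2 2 (b ^ 2) W := by
  have hsw : ∀ {P : (Fin n → ℝ) × (Fin m → ℝ) → Prop}, (∀ᵐ z, P z) →
      ∀ᵐ y : Fin m → ℝ, ∀ᵐ x : Fin n → ℝ, P (x, y) := by
    intro P hP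
    have : ∀ᵐ z : (Fin m → ℝ) × (Fin n → ℝ), P z.swap :=
      (Measure.measurePreserving_swap (μ := (volume : Measure (Fin m → ℝ)))
        (ν := (volume : Measure (Fin n → ℝ)))).quasiMeasurePreserving.ae hP
    exact Measure.ae_ae_of_ae_prod this
  constructor
  · filter_upwards [hsw h₁t, hsw h₂t, hsw hW] with y k1 k2 k3
    exact jointAp_two_of_maxM_le hb (hH₁.comp measurable_prodMk_right)
      (hH₂.comp measurable_prodMk_right) (fun x => h₁0 _) (fun x => h₂0 _) k1 k2
      (fun x => le_self_add.trans (hM₁ (x, y))) (fun x => le_self_add.trans (hM₂ (x, y))) k3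
  · filter_upwards [Measure.ae_ae_of_ae_prod h₁t, Measure.ae_ae_of_ae_prod h₂t,
      Measure.ae_ae_of_ae_prod hW] with x k1 k2 k3
    exact jointAp_two_of_maxM_le hb (hH₁.comp measurable_prodMk_left)
      (hH₂.comp measurable_prodMk_left) (fun y => h₁0 _) (fun y => h₂0 _) k1 k2
      (fun y => le_add_self.trans (hM₁ (x, y))) (fun y => le_add_self.trans (hM₂ (x, y))) k3

/-- The core of the extrapolation argument, for a function `f ≤ F` of finite norm. -/
theorem lintegral_rpow_mul_le_of_two {D : Set (Cube n)} {E : Set (Cube m)} (hD : D.Countable)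
    (hE : E.Countable) {p q : ℝ} (hpq : p.HolderConjugate q) {a K : ℝ≥0∞} (ha0 : a ≠ 0)
    (ha : a ≠ ∞) {w : (Fin n → ℝ) × (Fin m → ℝ) → ℝ≥0∞} (hw : Measurable w)
    (hw0 : ∀ z, w z ≠ 0) (hwt : ∀ z, w z ≠ ∞)
    (hT : ∀ h : (Fin n → ℝ) × (Fin m → ℝ) → ℝ≥0∞, Measurable h →
      ∫⁻ z, sumMax D E h z ^ p * w z ≤ a ^ p * ∫⁻ z, h z ^ p * w z)
    (hT' : ∀ h : (Fin n → ℝ) × (Fin m → ℝ) → ℝ≥0∞, Measurable h →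
      ∫⁻ z, sumMax D E h z ^ q * w z ^ (1 - q) ≤ a ^ q * ∫⁻ z, h z ^ q * w z ^ (1 - q))
    {F G f : (Fin n → ℝ) × (Fin m → ℝ) → ℝ≥0∞} (hF : Measurable F) (hG : Measurable G)
    (hf : Measurable f) (hG0 : ∀ z, G z ≠ 0) (hf0 : ∀ z, f z ≠ 0) (hft : ∀ z, f z ≠ ∞)
    (hfF : ∀ z, f z ≤ F z)
    (hGt : ∫⁻ z, G z ^ p * w z ≠ ∞) (hfi : ∫⁻ z, f z ^ p * w z ≠ ∞)
    (H : ∀ W : (Fin n → ℝ) × (Fin m → ℝ) → ℝ≥0∞, Measurable W → (∀ z, W z ≠ 0) →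
      (∀ z, W z ≠ ∞) → FiberAp D E 2 2 ((2 * a) ^ 2) W →
      ∫⁻ z, F z ^ 2 * W z ≤ K * ∫⁻ z, G z ^ 2 * W z) :
    ∫⁻ z, f z ^ p * w z ≤ (4 * K ^ (1 / 2 : ℝ)) ^ p * ∫⁻ z, G z ^ p * w z := by
  have hp0 := hpq.ne_zero
  have hq0 := hpq.symm.ne_zero
  have hmul := hpq.mul_eq_add
  set σ : (Fin n → ℝ) × (Fin m → ℝ) → ℝ≥0∞ := fun z => w z ^ (1 - q) with hσ
  have hσm : Measurable σ := hw.pow_const _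
  -- The function that is extremal for `f` in the duality of L^p(w): ∫ f k = ∫ f^p w, and its dual
  -- norm to the power q equals the same integral.
  set k : (Fin n → ℝ) × (Fin m → ℝ) → ℝ≥0∞ := fun z => f z ^ (p - 1) * w z with hk
  have hkm : Measurable k := (hf.pow_const _).mul hw
  have hk0 : ∀ z, k z ≠ 0 := fun z => mul_ne_zero
    (by simp [ENNReal.rpow_eq_zero_iff, hf0 z, hft z]) (hw0 z)
  set I := ∫⁻ z, f z ^ p * w z with hI
  set J := ∫⁻ z, G z ^ p * w z with hJ
  have hkI : ∫⁻ z, k z ^ q * σ z = I := by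
    refine lintegral_congr fun z => ?_
    simp only [hk, hσ]
    rw [ENNReal.mul_rpow_of_nonneg _ _ hpq.symm.nonneg, mul_assoc,
      ← ENNReal.rpow_add _ _ (hw0 z) (hwt z), ← ENNReal.rpow_mul,
      show (p - 1) * q = p by linarith, show q + (1 - q) = 1 by ring, ENNReal.rpow_one]
  set H₁ := rubio D E a G with hH₁
  set H₂ := rubio D E a k with hH₂
  have hm₁ : Measurable H₁ := measurable_rubio hD hE hG
  have hm₂ : Measurable H₂ := measurable_rubio hD hE hkm
  have hle₁ : ∀ z, G z ≤ H₁ z := fun z => le_rubio z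
  have hle₂ : ∀ z, k z ≤ H₂ z := fun z => le_rubio z
  have hH₁0 : ∀ z, H₁ z ≠ 0 := fun z h => hG0 z (le_zero_iff.1 (h ▸ hle₁ z))
  have hH₂0 : ∀ z, H₂ z ≠ 0 := fun z h => hk0 z (le_zero_iff.1 (h ▸ hle₂ z))
  have hn₁ : ∫⁻ z, H₁ z ^ p * w z ≤ 2 ^ p * J :=
    lintegral_rubio_rpow_mul_le hD hE ha0 ha hpq hw hT hG
  have hn₂ : ∫⁻ z, H₂ z ^ q * σ z ≤ 2 ^ q * I := by
    rw [← hkI]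
    exact lintegral_rubio_rpow_mul_le hD hE ha0 ha hpq.symm hσm hT' hkm
  have h2pt : (2 : ℝ≥0∞) ^ p ≠ ∞ := ENNReal.rpow_ne_top_of_nonneg hpq.nonneg (by norm_num)
  have h2qt : (2 : ℝ≥0∞) ^ q ≠ ∞ := ENNReal.rpow_ne_top_of_nonneg hpq.symm.nonneg (by norm_num)
  have hfin₁ : ∀ᵐ z, H₁ z ≠ ∞ := by
    filter_upwards [ae_lt_top ((hm₁.pow_const p).mul hw)
      (ne_top_of_le_ne_top (ENNReal.mul_ne_top h2pt hGt) hn₁)] with z hz h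
    simp only [Pi.mul_apply, h, ENNReal.top_rpow_of_pos hpq.pos, ENNReal.top_mul (hw0 z)] at hz
    exact lt_irrefl _ hz
  have hfin₂ : ∀ᵐ z, H₂ z ≠ ∞ := by
    filter_upwards [ae_lt_top ((hm₂.pow_const q).mul hσm)
      (ne_top_of_le_ne_top (ENNReal.mul_ne_top h2qt hfi) hn₂)] with z hz h
    have : σ z ≠ 0 := by simp [hσ, ENNReal.rpow_eq_zero_iff, hw0 z, hwt z]
    simp only [Pi.mul_apply, h, ENNReal.top_rpow_of_pos hpq.symm.pos, ENNReal.top_mul this] at hz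
    exact lt_irrefl _ hz
  set T : Set ((Fin n → ℝ) × (Fin m → ℝ)) := {z | H₁ z = ∞ ∨ H₂ z = ∞} with hTdef
  have hTm : MeasurableSet T := (hm₁ (measurableSet_singleton _)).union
    (hm₂ (measurableSet_singleton _))
  classical
  -- The value 1 on the null set T makes the weight positive and finite at every point.
  set W : (Fin n → ℝ) × (Fin m → ℝ) → ℝ≥0∞ := fun z => if z ∈ T then 1 else H₂ z / H₁ z with hWdef
  have hWm : Measurable W := Measurable.ite hTm measurable_const (hm₂.div hm₁)
  have hW0 : ∀ z, W z ≠ 0 := by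
    intro z
    by_cases hz : z ∈ T
    · simp [hWdef, hz]
    · have h1 : H₁ z ≠ ∞ := fun h => hz (Or.inl h)
      simp [hWdef, hz, ENNReal.div_eq_zero_iff, hH₂0 z, h1]
  have hWt : ∀ z, W z ≠ ∞ := by
    intro z
    by_cases hz : z ∈ T
    · simp [hWdef, hz]
    · have h1 : H₂ z ≠ ∞ := fun h => hz (Or.inr h)
      simp only [hWdef, hz, if_false]
      exact ENNReal.div_ne_top h1 (hH₁0 z)
  have hWae : ∀ᵐ z, W z = H₂ z / H₁ z := by
    filter_upwards [hfin₁, hfin₂] with z h1 h2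
    have : z ∉ T := fun h => h.elim h1 h2
    simp [hWdef, this]
  have hWA : FiberAp D E 2 2 ((2 * a) ^ 2) W :=
    fiberAp_two_of_sumMax_le (ENNReal.mul_ne_top (by norm_num) ha) hm₁ hm₂ hH₁0 hH₂0 hfin₁ hfin₂
      (sumMax_rubio_le hD hE ha0 ha hG) (sumMax_rubio_le hD hE ha0 ha hkm) hWae
  -- Both quantities in the L² argument reduce to P: G ≤ H₁ gives ∫ G²W ≤ P, and ∫ H₂²W⁻¹ = P. Then
  -- I ≤ ∫ F H₂ ≤ K^{1/2} P, while Hölder and the norm bounds for H₁, H₂ give P ≤ 4 J^{1/p} I^{1/q}.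
  set P := ∫⁻ z, H₁ z * H₂ z with hP
  have hGP : ∫⁻ z, G z ^ 2 * W z ≤ P := by
    refine lintegral_mono_ae ?_
    filter_upwards [hfin₁, hWae] with z h1 h2
    rw [h2]
    calc G z ^ 2 * (H₂ z / H₁ z) ≤ H₁ z ^ 2 * (H₂ z / H₁ z) := by gcongr; exact hle₁ z
      _ = H₁ z * H₂ z * (H₁ z * (H₁ z)⁻¹) := by rw [ENNReal.div_eq_inv_mul]; ring
      _ = _ := by rw [ENNReal.mul_inv_cancel (hH₁0 z) h1, mul_one]
  have hIP : I ≤ K ^ (1 / 2 : ℝ) * P := by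
    have h1 := lintegral_mul_le_weight (μ := volume) Real.HolderConjugate.two_two hWm hW0 hWt hF hm₂
    have h2 : ∫⁻ z, H₂ z ^ (2 : ℝ) * W z ^ (1 - (2 : ℝ)) = P := by
      refine lintegral_congr_ae ?_
      filter_upwards [hfin₁, hfin₂, hWae] with z h1 h2 h3
      rw [h3, show (1 : ℝ) - 2 = -1 by norm_num, ENNReal.rpow_neg_one,
        ENNReal.inv_div (Or.inl h1) (Or.inl (hH₁0 z)), ENNReal.rpow_two, ENNReal.div_eq_inv_mul]
      calc H₂ z ^ 2 * ((H₂ z)⁻¹ * H₁ z) = H₁ z * H₂ z * (H₂ z * (H₂ z)⁻¹) := by ring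
        _ = _ := by rw [ENNReal.mul_inv_cancel (hH₂0 z) h2, mul_one]
    rw [h2] at h1
    simp only [ENNReal.rpow_two] at h1
    calc I ≤ ∫⁻ z, F z * H₂ z := by
          refine lintegral_mono fun z => ?_
          calc f z ^ p * w z = f z * k z := by
                simp only [hk]
                rw [← mul_assoc]
                congr 1
                conv_rhs => rw [← ENNReal.rpow_one (f z), ← ENNReal.rpow_mul, one_mul,
                  ← ENNReal.rpow_add _ _ (hf0 z) (hft z)]
                congr 1
                ring
            _ ≤ _ := mul_le_mul' (hfF z) (hle₂ z)
      _ ≤ _ := h1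
      _ ≤ (K * P) ^ (1 / 2 : ℝ) * P ^ (1 / 2 : ℝ) := by
          gcongr
          exact (H W hWm hW0 hWt hWA).trans (by gcongr)
      _ = K ^ (1 / 2 : ℝ) * (P ^ (1 / 2 : ℝ) * P ^ (1 / 2 : ℝ)) := by
          rw [ENNReal.mul_rpow_of_nonneg _ _ (by norm_num), mul_assoc]
      _ = _ := by
          rw [← ENNReal.rpow_add_of_nonneg _ _ (by norm_num) (by norm_num)]
          norm_num
  have hPIJ : P ≤ 4 * (J ^ (1 / p) * I ^ (1 / q)) := by
    calc P ≤ (2 ^ p * J) ^ (1 / p) * (2 ^ q * I) ^ (1 / q) := by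
          refine (lintegral_mul_le_weight hpq hw hw0 hwt hm₁ hm₂).trans ?_
          have := hpq.nonneg
          have := hpq.symm.nonneg
          gcongr
      _ = (2 * J ^ (1 / p)) * (2 * I ^ (1 / q)) := by
          rw [ENNReal.mul_rpow_of_nonneg _ _ (by simpa using hpq.nonneg),
            ENNReal.mul_rpow_of_nonneg _ _ (by simpa using hpq.symm.nonneg), ← ENNReal.rpow_mul,
            ← ENNReal.rpow_mul, mul_one_div_cancel hp0, mul_one_div_cancel hq0, ENNReal.rpow_one]
      _ = (2 * 2) * (J ^ (1 / p) * I ^ (1 / q)) := by ring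
      _ = _ := by norm_num
  by_cases hI0 : I = 0
  · rw [hI0]
    exact zero_le
  have hIq0 : I ^ (1 / q) ≠ 0 := by simp [ENNReal.rpow_eq_zero_iff, hI0, hfi]
  have hIqt : I ^ (1 / q) ≠ ∞ :=
    ENNReal.rpow_ne_top_of_nonneg (by simpa using hpq.symm.nonneg) hfi
  -- Dividing by I^{1/q} is the reason why the core argument needs a function f ≤ F of finite norm.
  have hfinal : I ^ (1 / p) ≤ 4 * K ^ (1 / 2 : ℝ) * J ^ (1 / p) := by
    have h1 : I ^ (1 / p) * I ^ (1 / q) ≤ 4 * K ^ (1 / 2 : ℝ) * J ^ (1 / p) * I ^ (1 / q) := by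
      rw [← ENNReal.rpow_add _ _ hI0 hfi, one_div, one_div, hpq.inv_add_inv_eq_one,
        ENNReal.rpow_one, ← one_div, ← one_div]
      calc I ≤ K ^ (1 / 2 : ℝ) * (4 * (J ^ (1 / p) * I ^ (1 / q))) := hIP.trans (by gcongr)
        _ = _ := by ring
    exact (ENNReal.mul_le_mul_iff_left hIq0 hIqt).1 h1
  have h1 := ENNReal.rpow_le_rpow hfinal hpq.nonneg
  rwa [ENNReal.mul_rpow_of_nonneg _ _ hpq.nonneg, ← ENNReal.rpow_mul, ← ENNReal.rpow_mul,
    one_div_mul_cancel hp0, ENNReal.rpow_one, ENNReal.rpow_one] at h1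

/-- A positive function of small norm in a weighted `L^p` space. -/
theorem exists_pos_lintegral_rpow_mul_lt {α : Type*} [MeasurableSpace α] (μ : Measure α)
    [SigmaFinite μ] {p : ℝ} (hp : 0 < p) {w : α → ℝ≥0∞} (hw : Measurable w) (hw0 : ∀ z, w z ≠ 0)
    (hwt : ∀ z, w z ≠ ∞) {ε : ℝ≥0∞} (hε : ε ≠ 0) :
    ∃ g : α → ℝ≥0∞, Measurable g ∧ (∀ z, g z ≠ 0) ∧ (∀ z, g z ≠ ∞) ∧
      ∫⁻ z, g z ^ p * w z ∂μ < ε := by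
  obtain ⟨g, g0, gm, gi⟩ := exists_pos_lintegral_lt_of_sigmaFinite μ hε
  refine ⟨fun z => ((g z : ℝ≥0∞) / w z) ^ (1 / p), ?_, fun z => ?_, fun z => ?_, ?_⟩
  · exact (gm.coe_nnreal_ennreal.div hw).pow_const _
  · have : (g z : ℝ≥0∞) ≠ 0 := by simpa using (g0 z).ne'
    have h1 : (g z : ℝ≥0∞) / w z ≠ 0 := ENNReal.div_ne_zero.2 ⟨this, hwt z⟩
    have h2 : (g z : ℝ≥0∞) / w z ≠ ∞ := ENNReal.div_ne_top ENNReal.coe_ne_top (hw0 z)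
    simp [ENNReal.rpow_eq_zero_iff, h1, h2]
  · exact ENNReal.rpow_ne_top_of_nonneg (by positivity)
      (ENNReal.div_ne_top ENNReal.coe_ne_top (hw0 z))
  · refine lt_of_le_of_lt (le_of_eq (lintegral_congr fun z => ?_)) gi
    rw [← ENNReal.rpow_mul, one_div_mul_cancel hp.ne', ENNReal.rpow_one,
      ENNReal.div_mul_cancel (hw0 z) (hwt z)]

/-- With `g` positive of finite norm, the truncations min(F, N g) have finite norm and increase to
F. This replaces an a priori assumption that F has finite norm. -/
theorem lintegral_rpow_mul_eq_iSup_min {α : Type*} [MeasurableSpace α] {μ : Measure α} {p : ℝ}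
    (hp : 0 < p) {w F g : α → ℝ≥0∞} (hw : Measurable w) (hF : Measurable F) (hg : Measurable g)
    (hg0 : ∀ z, g z ≠ 0) :
    ∫⁻ z, F z ^ p * w z ∂μ = ⨆ N : ℕ, ∫⁻ z, min (F z) (N * g z) ^ p * w z ∂μ := by
  have hmono : ∀ z, Monotone fun N : ℕ => min (F z) (N * g z) := fun z a b hab =>
    min_le_min le_rfl (by gcongr)
  rw [← lintegral_iSup]
  · refine lintegral_congr fun z => ?_
    have h1 : F z = ⨆ N : ℕ, min (F z) (N * g z) := by
      rw [← inf_iSup_eq, ← ENNReal.iSup_mul, ENNReal.iSup_natCast, ENNReal.top_mul (hg0 z)]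
      simp
    have h2 := (ENNReal.monotone_rpow_of_nonneg hp.le).map_iSup_of_continuousAt
      (f := fun x : ℝ≥0∞ => x ^ p) (g := fun N : ℕ => min (F z) (N * g z))
      ENNReal.continuous_rpow_const.continuousAt (by simp [hp])
    rw [← ENNReal.iSup_mul, ← h2, ← h1]
  · intro N
    exact ((hF.min (hg.const_mul _)).pow_const _).mul hw
  · intro a b hab z
    simp only
    gcongr

/-- **Rubio de Francia extrapolation** from `L²` with dyadic `A₂` weights. -/
theorem exists_extrapolation (hn : 0 < n) (hm : 0 < m) {p q : ℝ} (hpq : p.HolderConjugate q)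
    (Q : ℝ≥0) : ∃ B : ℝ, ∀ K : ℝ≥0, ∃ C : ℝ≥0, ∀ (D : Set (Cube n)) (E : Set (Cube m)),
    IsDyadicGrid D → IsDyadicGrid E →
    ∀ w : (Fin n → ℝ) × (Fin m → ℝ) → ℝ≥0∞, Measurable w → (∀ z, w z ≠ 0) → (∀ z, w z ≠ ∞) →
    FiberAp D E p q Q w →
    ∀ F G : (Fin n → ℝ) × (Fin m → ℝ) → ℝ≥0∞, Measurable F → Measurable G →
    (∀ W : (Fin n → ℝ) × (Fin m → ℝ) → ℝ≥0∞, Measurable W → (∀ z, W z ≠ 0) →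
      (∀ z, W z ≠ ∞) → FiberAp D E 2 2 (ENNReal.ofReal B) W →
      ∫⁻ z, F z ^ 2 * W z ≤ K * ∫⁻ z, G z ^ 2 * W z) →
    ∫⁻ z, F z ^ p * w z ≤ C * ∫⁻ z, G z ^ p * w z := by
  have hQ : (Q : ℝ≥0∞) ≠ ∞ := ENNReal.coe_ne_top
  have hQ' : (Q : ℝ≥0∞) ^ (q - 1) ≠ ∞ :=
    ENNReal.rpow_ne_top_of_nonneg hpq.symm.sub_one_pos.le hQ
  set A₁ : ℝ≥0∞ := 2 ^ (p - 1) * (2 * maxConst p q Q) with hA₁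
  set A₂ : ℝ≥0∞ := 2 ^ (q - 1) * (2 * maxConst q p (Q ^ (q - 1))) with hA₂
  have hA₁t : A₁ ≠ ∞ := ENNReal.mul_ne_top
    (ENNReal.rpow_ne_top_of_nonneg hpq.sub_one_pos.le (by norm_num))
    (ENNReal.mul_ne_top (by norm_num) (maxConst_ne_top hpq hQ))
  have hA₂t : A₂ ≠ ∞ := ENNReal.mul_ne_top
    (ENNReal.rpow_ne_top_of_nonneg hpq.symm.sub_one_pos.le (by norm_num))
    (ENNReal.mul_ne_top (by norm_num) (maxConst_ne_top hpq.symm hQ'))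
  -- Since a ≥ 1, a ≤ a^p and a ≤ a^q, so one number serves for the operator on L^p(w) and on its
  -- dual space.
  set a := max 1 (max A₁ A₂) with ha
  have ha1 : 1 ≤ a := le_max_left _ _
  have hat : a ≠ ∞ := by simp [ha, hA₁t, hA₂t]
  have ha0 : a ≠ 0 := (lt_of_lt_of_le one_pos ha1).ne'
  have hap : ∀ r : ℝ, 1 ≤ r → a ≤ a ^ r := fun r hr => by
    simpa using ENNReal.rpow_le_rpow_of_exponent_le ha1 hr
  have h1 : A₁ ≤ a ^ p := ((le_max_left _ _).trans (le_max_right _ _)).trans (hap p hpq.lt.le)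
  have h2 : A₂ ≤ a ^ q := ((le_max_right _ _).trans (le_max_right _ _)).trans (hap q hpq.symm.lt.le)
  have hbt : (2 * a) ^ 2 ≠ ∞ := ENNReal.pow_ne_top (ENNReal.mul_ne_top (by norm_num) hat)
  -- The A₂ bound of the weights that the algorithm builds. It is fixed before `K`, so that `K` may
  -- be the L² constant for exactly this class of weights.
  refine ⟨((2 * a) ^ 2).toReal, fun K => ?_⟩
  rw [ENNReal.ofReal_toReal hbt]
  set c : ℝ≥0∞ := (4 * (2 * K + 2) ^ (1 / 2 : ℝ)) ^ p with hc
  have hct : c * 2 ^ (p - 1) ≠ ∞ := by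
    refine ENNReal.mul_ne_top (ENNReal.rpow_ne_top_of_nonneg hpq.nonneg
      (ENNReal.mul_ne_top (by norm_num) (ENNReal.rpow_ne_top_of_nonneg (by norm_num) ?_)))
      (ENNReal.rpow_ne_top_of_nonneg hpq.sub_one_pos.le (by norm_num))
    exact ENNReal.add_ne_top.2 ⟨ENNReal.mul_ne_top (by norm_num) ENNReal.coe_ne_top, by norm_num⟩
  refine ⟨(c * 2 ^ (p - 1)).toNNReal, ?_⟩
  rw [ENNReal.coe_toNNReal hct]
  intro D E hD hE w hw hw0 hwt hA F G hF hG H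
  by_cases hGt : ∫⁻ z, G z ^ p * w z = ∞
  · rw [hGt, ENNReal.mul_top]
    · exact le_top
    · refine mul_ne_zero ?_ (by simp [ENNReal.rpow_eq_zero_iff])
      simp [hc, ENNReal.rpow_eq_zero_iff, hpq.pos.not_gt]
  have hσ0 : ∀ z, w z ^ (1 - q) ≠ 0 := fun z => by
    simp [ENNReal.rpow_eq_zero_iff, hw0 z, hwt z]
  have hσt : ∀ z, w z ^ (1 - q) ≠ ∞ := fun z => by
    simp [ENNReal.rpow_eq_top_iff, hw0 z, hwt z]
  have hT : ∀ h : (Fin n → ℝ) × (Fin m → ℝ) → ℝ≥0∞, Measurable h →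
      ∫⁻ z, sumMax D E h z ^ p * w z ≤ a ^ p * ∫⁻ z, h z ^ p * w z := fun h hh =>
    (lintegral_sumMax_rpow_mul_le hD hE hn hm hpq hQ hw hw0 hwt hA hh).trans (by gcongr)
  have hT' : ∀ h : (Fin n → ℝ) × (Fin m → ℝ) → ℝ≥0∞, Measurable h →
      ∫⁻ z, sumMax D E h z ^ q * w z ^ (1 - q) ≤ a ^ q * ∫⁻ z, h z ^ q * w z ^ (1 - q) :=
    fun h hh => (lintegral_sumMax_rpow_mul_le hD hE hn hm hpq.symm hQ' (hw.pow_const _) hσ0 hσt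
      (hA.symm hpq) hh).trans (by gcongr)
  have h2t : (2 : ℝ≥0∞) ^ (p - 1) ≠ ∞ :=
    ENNReal.rpow_ne_top_of_nonneg hpq.sub_one_pos.le (by norm_num)
  -- Adding a positive function `g` of norm below ε makes the functions nonvanishing. Adding G + g
  -- to F as well keeps the hypothesis, with K replaced by 2K + 2.
  have main : ∀ ε : ℝ≥0, 0 < ε → ∫⁻ z, F z ^ p * w z ≤
      c * 2 ^ (p - 1) * (∫⁻ z, G z ^ p * w z) + c * 2 ^ (p - 1) * ε := by
    intro ε hε
    obtain ⟨g, gm, g0, gt, gi⟩ := exists_pos_lintegral_rpow_mul_lt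
      (volume : Measure ((Fin n → ℝ) × (Fin m → ℝ))) hpq.pos hw hw0 hwt
      (show (ε : ℝ≥0∞) ≠ 0 by simpa using hε.ne')
    set G₁ := fun z => G z + g z with hG₁
    set F₁ := fun z => F z + G₁ z with hF₁
    have hG₁m : Measurable G₁ := hG.add gm
    have hF₁m : Measurable F₁ := hF.add hG₁m
    have hG₁0 : ∀ z, G₁ z ≠ 0 := fun z h => g0 z (by simpa [hG₁] using (add_eq_zero.1 h).2)
    have hF₁0 : ∀ z, F₁ z ≠ 0 := fun z h => hG₁0 z (add_eq_zero.1 h).2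
    have hGi : ∫⁻ z, G₁ z ^ p * w z ≤ 2 ^ (p - 1) * (∫⁻ z, G z ^ p * w z) + 2 ^ (p - 1) * ε := by
      have hm1 : Measurable fun z => G z ^ p * w z := (hG.pow_const _).mul hw
      calc ∫⁻ z, G₁ z ^ p * w z ≤ ∫⁻ z, 2 ^ (p - 1) * (G z ^ p * w z + g z ^ p * w z) := by
            refine lintegral_mono fun z => ?_
            simp only
            rw [← add_mul, ← mul_assoc]
            gcongr
            exact ENNReal.rpow_add_le_mul_rpow_add_rpow _ _ hpq.lt.le
        _ = 2 ^ (p - 1) * ((∫⁻ z, G z ^ p * w z) + ∫⁻ z, g z ^ p * w z) := by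
            rw [lintegral_const_mul' _ _ h2t, lintegral_add_left hm1]
        _ ≤ _ := by
            rw [mul_add]
            gcongr
    have hG₁t : ∫⁻ z, G₁ z ^ p * w z ≠ ∞ := by
      refine ne_top_of_le_ne_top (ENNReal.add_ne_top.2 ⟨ENNReal.mul_ne_top h2t hGt,
        ENNReal.mul_ne_top h2t ENNReal.coe_ne_top⟩) hGi
    have hH : ∀ W : (Fin n → ℝ) × (Fin m → ℝ) → ℝ≥0∞, Measurable W → (∀ z, W z ≠ 0) →
        (∀ z, W z ≠ ∞) → FiberAp D E 2 2 ((2 * a) ^ 2) W →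
        ∫⁻ z, F₁ z ^ 2 * W z ≤ (2 * K + 2) * ∫⁻ z, G₁ z ^ 2 * W z := by
      intro W hW hW0 hWt hWA
      have hm1 : Measurable fun z => F z ^ 2 * W z := (hF.pow_const _).mul hW
      calc ∫⁻ z, F₁ z ^ 2 * W z ≤ ∫⁻ z, 2 * (F z ^ 2 * W z + G₁ z ^ 2 * W z) := by
            refine lintegral_mono fun z => ?_
            simp only
            rw [← add_mul, ← mul_assoc]
            gcongr
            have := ENNReal.rpow_add_le_mul_rpow_add_rpow (F z) (G₁ z) (p := 2) (by norm_num)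
            norm_num at this
            exact this
        _ = 2 * ((∫⁻ z, F z ^ 2 * W z) + ∫⁻ z, G₁ z ^ 2 * W z) := by
            rw [lintegral_const_mul' _ _ (by norm_num), lintegral_add_left hm1]
        _ ≤ 2 * (K * (∫⁻ z, G₁ z ^ 2 * W z) + ∫⁻ z, G₁ z ^ 2 * W z) := by
            gcongr
            refine (H W hW hW0 hWt hWA).trans ?_
            gcongr
            exact le_self_add
        _ = _ := by ring
    calc ∫⁻ z, F z ^ p * w z ≤ ∫⁻ z, F₁ z ^ p * w z := by
          refine lintegral_mono fun z => ?_
          have : F z ≤ F₁ z := le_self_add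
          have := hpq.nonneg
          gcongr
      _ ≤ c * ∫⁻ z, G₁ z ^ p * w z := by
          rw [lintegral_rpow_mul_eq_iSup_min hpq.pos hw hF₁m gm g0]
          refine iSup_le fun N => ?_
          rcases Nat.eq_zero_or_pos N with hN | hN
          · simp [hN, hpq.pos]
          have hN0 : (N : ℝ≥0∞) ≠ 0 := by simpa using hN.ne'
          refine lintegral_rpow_mul_le_of_two hD.countable hE.countable hpq ha0 hat hw hw0 hwt
            hT hT' hF₁m hG₁m (hF₁m.min (gm.const_mul _)) hG₁0 (fun z => ?_) (fun z => ?_)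
            (fun z => min_le_left _ _) hG₁t ?_ hH
          · rw [← pos_iff_ne_zero, lt_min_iff]
            exact ⟨pos_iff_ne_zero.2 (hF₁0 z), pos_iff_ne_zero.2 (mul_ne_zero hN0 (g0 z))⟩
          · exact ne_top_of_le_ne_top (ENNReal.mul_ne_top (ENNReal.natCast_ne_top N) (gt z))
              (min_le_right _ _)
          · refine ne_top_of_le_ne_top (b := N ^ p * ∫⁻ z, g z ^ p * w z) (ENNReal.mul_ne_top
              (ENNReal.rpow_ne_top_of_nonneg hpq.nonneg (ENNReal.natCast_ne_top N))
              (ne_top_of_lt gi)) ?_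
            rw [← lintegral_const_mul' _ _
              (ENNReal.rpow_ne_top_of_nonneg hpq.nonneg (ENNReal.natCast_ne_top N))]
            refine lintegral_mono fun z => ?_
            simp only
            rw [← mul_assoc, ← ENNReal.mul_rpow_of_nonneg _ _ hpq.nonneg]
            have := hpq.nonneg
            gcongr
            exact min_le_right _ _
      _ ≤ c * (2 ^ (p - 1) * (∫⁻ z, G z ^ p * w z) + 2 ^ (p - 1) * ε) := by gcongr
      _ = _ := by ring
  refine ENNReal.le_of_forall_pos_le_add fun δ hδ _ => ?_
  set c' := c * 2 ^ (p - 1) with hc'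
  have hε : 0 < δ / (c'.toNNReal + 1) := by positivity
  refine (main _ hε).trans ?_
  gcongr
  rw [← ENNReal.coe_toNNReal hct, ← ENNReal.coe_mul, ENNReal.coe_le_coe, ← mul_div_assoc]
  refine div_le_of_le_mul₀ (by positivity) (by positivity) ?_
  rw [mul_comm]
  gcongr
  exact le_self_add

end Extrapolation

end BiParam

namespace BiParam

/-! ### From weights on rectangles to weights on fibres; the Bloom weight. -/

section FiberWeights

variable {n m : ℕ}

theorem locallyIntegrable_of_integrableOn_cube {F : Type*} [NormedAddCommGroup F]
    {a : (Fin n → ℝ) → F} (h : ∀ J : Cube n, IntegrableOn a J.toSet) :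
    LocallyIntegrable a volume := by
  intro x
  let J : Cube n := ⟨fun i => x i - 1, 2, by norm_num⟩
  refine ⟨J.toSet, ?_, h J⟩
  refine set_pi_mem_nhds Set.finite_univ fun i _ => Ico_mem_nhds ?_ ?_
  · simp [J]
  · simp only [J]
    linarith

/-- A cube of side length `2 ^ (-N)` with lower corner `x`. -/
noncomputable def cornerCube (x : Fin n → ℝ) (N : ℕ) : Cube n := ⟨x, (1 / 2) ^ N, by positivity⟩

/-- Divide by |J|^p and let J shrink to y: Lebesgue differentiation turns the two averages into
point values. -/
theorem ae_mul_rpow_le_of_cube {u s : (Fin n → ℝ) → ℝ≥0∞} (hu : Measurable u) (hs : Measurable s)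
    {p : ℝ} (hp : 1 < p) {c : ℝ≥0∞} (hc : c ≠ ∞)
    (hut : ∀ J : Cube n, ∫⁻ y in J.toSet, u y ≠ ∞) (hst : ∀ J : Cube n, ∫⁻ y in J.toSet, s y ≠ ∞)
    (h : ∀ J : Cube n, (∫⁻ y in J.toSet, u y) * (∫⁻ y in J.toSet, s y) ^ (p - 1) ≤
      c * volume J.toSet ^ p) :
    ∀ᵐ y, u y * s y ^ (p - 1) ≤ c := by
  have aux : ∀ v : (Fin n → ℝ) → ℝ≥0∞, Measurable v →
      (∀ J : Cube n, ∫⁻ y in J.toSet, v y ≠ ∞) →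
      (∀ᵐ y, v y ≠ ∞) ∧ LocallyIntegrable (fun y => (v y).toReal) volume ∧
      ∀ J : Cube n, ⨍ y in J.toSet, (v y).toReal =
        (∫⁻ y in J.toSet, v y).toReal / volume.real J.toSet := by
    intro v hv hvt
    have hfin : ∀ J : Cube n, ∀ᵐ y ∂volume.restrict J.toSet, v y < ∞ := fun J =>
      ae_lt_top hv (hvt J)
    refine ⟨?_, locallyIntegrable_of_integrableOn_cube fun J =>
      integrable_toReal_of_lintegral_ne_top hv.aemeasurable (hvt J), fun J => ?_⟩
    · let J : ℕ → Cube n := fun N => ⟨fun _ => -(N + 1 : ℝ), 2 * (N + 1), by positivity⟩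
      have h1 : ∀ᵐ y, ∀ N, y ∈ (J N).toSet → v y < ∞ := ae_all_iff.2 fun N =>
        (ae_restrict_iff' (J N).measurableSet_toSet).1 (hfin (J N))
      filter_upwards [h1] with y hy
      obtain ⟨N, hN⟩ := exists_nat_gt ‖y‖
      refine (hy N (Cube.mem_toSet.2 fun i => ?_)).ne
      have h2 := (norm_le_pi_norm y i).trans_lt hN
      rw [Real.norm_eq_abs, abs_lt] at h2
      simp only [J]
      constructor <;> linarith [h2.1, h2.2]
    · rw [setAverage_eq, integral_toReal hv.aemeasurable (hfin J), smul_eq_mul, inv_mul_eq_div]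
  obtain ⟨ut, uL, uav⟩ := aux u hu hut
  obtain ⟨st, sL, sav⟩ := aux s hs hst
  filter_upwards [ut, st, ae_tendsto_average_cube uL, ae_tendsto_average_cube sL]
    with y y1 y2 y3 y4
  have hmem : ∀ N, y ∈ (cornerCube y N).toSet := fun N => (cornerCube y N).corner_mem
  have hside : Tendsto (fun N => (cornerCube y N).side) atTop (𝓝 0) :=
    tendsto_pow_atTop_nhds_zero_of_lt_one (by norm_num) (by norm_num)
  have t1 := y3 _ hmem hside
  have t2 := (Real.continuous_rpow_const (by linarith : 0 ≤ p - 1)).continuousAt.tendsto.comp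
    (y4 _ hmem hside)
  have hle : (u y).toReal * (s y).toReal ^ (p - 1) ≤ c.toReal := by
    refine le_of_tendsto (t1.mul t2) (Eventually.of_forall fun N => ?_)
    simp only [Function.comp_apply, uav, sav]
    set J := cornerCube y N
    have hJ := J.volume_real_pos
    have h1 := ENNReal.toReal_mono (ENNReal.mul_ne_top hc
      (ENNReal.rpow_ne_top_of_nonneg (by linarith) J.volume_ne_top)) (h J)
    rw [ENNReal.toReal_mul, ENNReal.toReal_mul, ← ENNReal.toReal_rpow, ← ENNReal.toReal_rpow] at h1
    rw [Real.div_rpow ENNReal.toReal_nonneg hJ.le, div_mul_div_comm, div_le_iff₀ (by positivity)]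
    refine h1.trans (le_of_eq ?_)
    congr 1
    change volume.real J.toSet ^ p = _
    conv_rhs => rw [← Real.rpow_one (volume.real J.toSet), ← Real.rpow_mul hJ.le, one_mul,
      ← Real.rpow_add hJ]
    congr 1
    ring
  rw [← ENNReal.ofReal_toReal (ENNReal.mul_ne_top y1
    (ENNReal.rpow_ne_top_of_nonneg (by linarith) y2)), ENNReal.toReal_mul, ← ENNReal.toReal_rpow]
  exact ENNReal.ofReal_le_of_le_toReal hle

theorem measurableSet_rect (I : Cube n) (J : Cube m) : MeasurableSet (rect I J) :=
  I.measurableSet_toSet.prod J.measurableSet_toSet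

theorem volume_rect (I : Cube n) (J : Cube m) :
    volume (rect I J) = volume I.toSet * volume J.toSet := by
  rw [rect, Measure.volume_eq_prod, Measure.prod_prod]

theorem volume_rect_ne_zero (I : Cube n) (J : Cube m) : volume (rect I J) ≠ 0 := by
  rw [volume_rect]
  exact mul_ne_zero I.volume_ne_zero J.volume_ne_zero

theorem volume_rect_ne_top (I : Cube n) (J : Cube m) : volume (rect I J) ≠ ∞ := by
  rw [volume_rect]
  exact ENNReal.mul_ne_top I.volume_ne_top J.volume_ne_top

theorem restrict_rect (I : Cube n) (J : Cube m) :
    (volume : Measure ((Fin n → ℝ) × (Fin m → ℝ))).restrict (rect I J) =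
      (volume.restrict I.toSet).prod (volume.restrict J.toSet) := by
  rw [rect, Measure.volume_eq_prod, Measure.prod_restrict]

theorem lintegral_rect_symm {F : (Fin n → ℝ) × (Fin m → ℝ) → ℝ≥0∞} (hF : Measurable F)
    (I : Cube n) (J : Cube m) :
    ∫⁻ z in rect I J, F z = ∫⁻ y in J.toSet, ∫⁻ x in I.toSet, F (x, y) := by
  rw [restrict_rect, lintegral_prod_symm _ hF.aemeasurable]

theorem lintegral_rect {F : (Fin n → ℝ) × (Fin m → ℝ) → ℝ≥0∞} (hF : Measurable F)
    (I : Cube n) (J : Cube m) :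
    ∫⁻ z in rect I J, F z = ∫⁻ x in I.toSet, ∫⁻ y in J.toSet, F (x, y) := by
  rw [restrict_rect, lintegral_prod _ hF.aemeasurable]

theorem rect_integrableOn {F : Type*} [NormedAddCommGroup F]
    {b : (Fin n → ℝ) × (Fin m → ℝ) → F} (hb : LocallyIntegrable b volume)
    (I : Cube n) (J : Cube m) : IntegrableOn b (rect I J) :=
  (hb.integrableOn_isCompact ((isCompact_closedBall _ _).prod (isCompact_closedBall _ _))).mono_set
    (Set.prod_mono I.subset_closedBall J.subset_closedBall)

theorem lavg_mul_le_apConst (p : ℝ) (hp : 1 < p) (w : (Fin n → ℝ) × (Fin m → ℝ) → ℝ)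
    (I : Cube n) (J : Cube m) :
    (∫⁻ z in rect I J, ENNReal.ofReal (w z)) *
      (∫⁻ z in rect I J, ENNReal.ofReal (w z ^ (1 - p.conjExponent))) ^ (p - 1) ≤
      apConst p w * volume (rect I J) ^ p := by
  have h : lavg (rect I J) (fun x => ENNReal.ofReal (w x)) *
      lavg (rect I J) (fun x => ENNReal.ofReal (w x ^ (1 - p.conjExponent))) ^ (p - 1) ≤
      apConst p w := le_iSup₂_of_le I J le_rfl
  have hV0 := volume_rect_ne_zero I J
  have hVt := volume_rect_ne_top I J
  unfold lavg at h
  set V := volume (rect I J)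
  refine le_trans (le_of_eq ?_) (mul_le_mul_left h (V ^ p))
  have e : V ^ p = V * V ^ (p - 1) := by
    conv_rhs => rw [← ENNReal.rpow_one V, ← ENNReal.rpow_mul, one_mul,
      ← ENNReal.rpow_add _ _ hV0 hVt]
    congr 1
    ring
  have hp0 : V ^ (p - 1) ≠ 0 := by simp [ENNReal.rpow_eq_zero_iff, hV0, hVt]
  have hpt : V ^ (p - 1) ≠ ∞ := ENNReal.rpow_ne_top_of_nonneg (by linarith) hVt
  rw [e, ENNReal.div_rpow_of_nonneg _ _ (by linarith), mul_mul_mul_comm,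
    ENNReal.div_mul_cancel hV0 hVt, ENNReal.div_mul_cancel hp0 hpt]

/-- The facts about an `A_p` weight, viewed as a `[0, ∞]`-valued function, that the estimates
on rectangles use. -/
structure RectAp (p q : ℝ) (Q : ℝ≥0∞) (w : (Fin n → ℝ) × (Fin m → ℝ) → ℝ≥0∞) : Prop where
  measurable : Measurable w
  ne_zero : ∀ z, w z ≠ 0
  ne_top : ∀ z, w z ≠ ∞
  const_ne_top : Q ≠ ∞
  lintegral_ne_top : ∀ I J, ∫⁻ z in rect I J, w z ≠ ∞
  dual_ne_top : ∀ I J, ∫⁻ z in rect I J, w z ^ (1 - q) ≠ ∞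
  mul_le : ∀ I J, (∫⁻ z in rect I J, w z) * (∫⁻ z in rect I J, w z ^ (1 - q)) ^ (p - 1) ≤
    Q * volume (rect I J) ^ p

theorem setLIntegral_rect_ne_zero {w : (Fin n → ℝ) × (Fin m → ℝ) → ℝ≥0∞} (hw : Measurable w)
    (hw0 : ∀ x, w x ≠ 0) (I : Cube n) (J : Cube m) : ∫⁻ z in rect I J, w z ≠ 0 := by
  rw [← pos_iff_ne_zero, setLIntegral_pos_iff hw]
  have : Function.support w = Set.univ := Set.eq_univ_of_forall hw0
  rw [this, Set.univ_inter]
  exact pos_iff_ne_zero.2 (volume_rect_ne_zero I J)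

theorem IsApWeight.rectAp {p : ℝ} (hp : 1 < p) {w : (Fin n → ℝ) × (Fin m → ℝ) → ℝ}
    (hw : IsApWeight p w) (hm : Measurable w) (hpos : ∀ z, 0 < w z) :
    RectAp p p.conjExponent (apConst p w) (fun z => ENNReal.ofReal (w z)) := by
  have e : ∀ z, ENNReal.ofReal (w z ^ (1 - p.conjExponent)) =
      ENNReal.ofReal (w z) ^ (1 - p.conjExponent) := fun z =>
    (ENNReal.ofReal_rpow_of_pos (hpos z)).symm
  have hmul : ∀ I J, (∫⁻ z in rect I J, ENNReal.ofReal (w z)) *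
      (∫⁻ z in rect I J, ENNReal.ofReal (w z) ^ (1 - p.conjExponent)) ^ (p - 1) ≤
      apConst p w * volume (rect I J) ^ p := by
    intro I J
    have := lavg_mul_le_apConst p hp w I J
    simpa only [e] using this
  refine ⟨hm.ennreal_ofReal, fun z => by simpa using hpos z, fun z => ENNReal.ofReal_ne_top,
    hw.apConst_lt_top.ne, fun I J => ?_, fun I J h => ?_, hmul⟩
  · exact (rect_integrableOn hw.locallyIntegrable I J).lintegral_lt_top.ne
  · have h1 := hmul I J
    rw [h, ENNReal.top_rpow_of_pos (by linarith), ENNReal.mul_top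
      (setLIntegral_rect_ne_zero hm.ennreal_ofReal (fun z => by simpa using hpos z) I J),
      top_le_iff] at h1
    exact ENNReal.mul_ne_top hw.apConst_lt_top.ne (ENNReal.rpow_ne_top_of_nonneg (by linarith)
      (volume_rect_ne_top I J)) h1

/-- For a fixed cube I the functions ∫_I w(x, y) dx and ∫_I w(x, y)^{1-q} dx of y inherit the
condition on all cubes J, hence pointwise almost everywhere. The grids are countable, so the
exceptional null sets can be united. -/
theorem RectAp.fiberAp {p q : ℝ} (hp : 1 < p) {Q : ℝ≥0∞}
    {w : (Fin n → ℝ) × (Fin m → ℝ) → ℝ≥0∞} (h : RectAp p q Q w) {D : Set (Cube n)}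
    {E : Set (Cube m)} (hD : D.Countable) (hE : E.Countable) : FiberAp D E p q Q w := by
  have hw := h.measurable
  have hσ : Measurable fun z => w z ^ (1 - q) := hw.pow_const _
  have hsplit : ∀ (I : Cube n) (J : Cube m), volume (rect I J) ^ p =
      volume I.toSet ^ p * volume J.toSet ^ p := fun I J => by
    rw [volume_rect, ENNReal.mul_rpow_of_nonneg _ _ (by linarith)]
  constructor
  · refine (ae_ball_iff hD).2 fun I _ => ?_
    refine ae_mul_rpow_le_of_cube (Measurable.lintegral_prod_left' hw)
      (Measurable.lintegral_prod_left' hσ) hp (ENNReal.mul_ne_top h.const_ne_top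
        (ENNReal.rpow_ne_top_of_nonneg (by linarith) I.volume_ne_top)) (fun J => ?_) (fun J => ?_)
      fun J => ?_
    · rw [← lintegral_rect_symm hw]
      exact h.lintegral_ne_top I J
    · rw [← lintegral_rect_symm hσ]
      exact h.dual_ne_top I J
    · rw [← lintegral_rect_symm hw, ← lintegral_rect_symm hσ, mul_assoc, ← hsplit]
      exact h.mul_le I J
  · refine (ae_ball_iff hE).2 fun J _ => ?_
    refine ae_mul_rpow_le_of_cube (Measurable.lintegral_prod_right' hw)
      (Measurable.lintegral_prod_right' hσ) hp (ENNReal.mul_ne_top h.const_ne_top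
        (ENNReal.rpow_ne_top_of_nonneg (by linarith) J.volume_ne_top)) (fun I => ?_) (fun I => ?_)
      fun I => ?_
    · rw [← lintegral_rect hw]
      exact h.lintegral_ne_top I J
    · rw [← lintegral_rect hσ]
      exact h.dual_ne_top I J
    · rw [← lintegral_rect hw, ← lintegral_rect hσ, mul_assoc, mul_comm (volume J.toSet ^ p),
        ← hsplit]
      exact h.mul_le I J

/-- The Bloom weight of two `A_p` weights is an `A₂` weight. -/
theorem RectAp.bloom {p q : ℝ} (hpq : p.HolderConjugate q) {Q Q' : ℝ≥0∞}
    {M L : (Fin n → ℝ) × (Fin m → ℝ) → ℝ≥0∞} (hM : RectAp p q Q M) (hL : RectAp p q Q' L) :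
    RectAp 2 2 ((Q * Q') ^ (1 / p)) (fun z => M z ^ (1 / p) * L z ^ (-(1 / p))) := by
  have hp0 := hpq.ne_zero
  have hq0 := hpq.symm.ne_zero
  have hmul := hpq.mul_eq_add
  -- The inverse of the Bloom weight of (M, L) is the Bloom weight of (L, M), so this one Hölder
  -- estimate serves both factors of the A₂ product.
  have aux : ∀ {M L : (Fin n → ℝ) × (Fin m → ℝ) → ℝ≥0∞}, Measurable M → Measurable L →
      ∀ I J, ∫⁻ z in rect I J, M z ^ (1 / p) * L z ^ (-(1 / p)) ≤
        (∫⁻ z in rect I J, M z) ^ (1 / p) * (∫⁻ z in rect I J, L z ^ (1 - q)) ^ (1 / q) := by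
    intro M L hM hL I J
    have h := ENNReal.lintegral_mul_le_Lp_mul_Lq (volume.restrict (rect I J)) hpq
      (f := fun z => M z ^ (1 / p)) (g := fun z => L z ^ (-(1 / p)))
      (hM.pow_const _).aemeasurable (hL.pow_const _).aemeasurable
    simp only [Pi.mul_apply, ← ENNReal.rpow_mul, one_div_mul_cancel hp0, ENNReal.rpow_one] at h
    rwa [show -(1 / p) * q = 1 - q by field_simp; linarith] at h
  have hinv : ∀ z, (M z ^ (1 / p) * L z ^ (-(1 / p))) ^ (1 - (2 : ℝ)) =
      L z ^ (1 / p) * M z ^ (-(1 / p)) := by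
    intro z
    rw [show (1 : ℝ) - 2 = -1 by norm_num, ENNReal.mul_rpow_of_ne_top, ← ENNReal.rpow_mul,
      ← ENNReal.rpow_mul, mul_comm]
    · congr 2 <;> ring
    · exact ENNReal.rpow_ne_top_of_nonneg (by simpa using hpq.nonneg) (hM.ne_top z)
    · simp [ENNReal.rpow_eq_top_iff, hL.ne_zero z, hL.ne_top z]
  have hp1 : 0 ≤ 1 / p := by simpa using hpq.nonneg
  have hq1 : 0 ≤ 1 / q := by simpa using hpq.symm.nonneg
  have fin : ∀ {M L : (Fin n → ℝ) × (Fin m → ℝ) → ℝ≥0∞} {Q Q'}, RectAp p q Q M →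
      RectAp p q Q' L → ∀ I J, ∫⁻ z in rect I J, M z ^ (1 / p) * L z ^ (-(1 / p)) ≠ ∞ := by
    intro M L Q Q' hM hL I J
    exact ne_top_of_le_ne_top (ENNReal.mul_ne_top
      (ENNReal.rpow_ne_top_of_nonneg hp1 (hM.lintegral_ne_top I J))
      (ENNReal.rpow_ne_top_of_nonneg hq1 (hL.dual_ne_top I J))) (aux hM.measurable hL.measurable I J)
  refine ⟨(hM.measurable.pow_const _).mul (hL.measurable.pow_const _), fun z => ?_, fun z => ?_,
    ENNReal.rpow_ne_top_of_nonneg hp1 (ENNReal.mul_ne_top hM.const_ne_top hL.const_ne_top),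
    fin hM hL, ?_, fun I J => ?_⟩
  · refine mul_ne_zero ?_ ?_ <;> simp [ENNReal.rpow_eq_zero_iff, hM.ne_zero z, hM.ne_top z,
      hL.ne_zero z, hL.ne_top z]
  · refine ENNReal.mul_ne_top ?_ ?_ <;> simp [ENNReal.rpow_eq_top_iff, hM.ne_zero z, hM.ne_top z,
      hL.ne_zero z, hL.ne_top z]
  · simp only [hinv]
    exact fin hL hM
  · simp only [hinv]
    set V := volume (rect I J)
    have h1 := ENNReal.rpow_le_rpow (hM.mul_le I J) hp1
    have h2 := ENNReal.rpow_le_rpow (hL.mul_le I J) hp1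
    have e : (p - 1) * (1 / p) = 1 / q := by field_simp; linarith
    rw [ENNReal.mul_rpow_of_nonneg _ _ hp1, ENNReal.mul_rpow_of_nonneg _ _ hp1, ← ENNReal.rpow_mul,
      ← ENNReal.rpow_mul, mul_one_div_cancel hp0, ENNReal.rpow_one, e] at h1 h2
    rw [show (2 : ℝ) - 1 = 1 by norm_num, ENNReal.rpow_one]
    calc _ ≤ ((∫⁻ z in rect I J, M z) ^ (1 / p) * (∫⁻ z in rect I J, L z ^ (1 - q)) ^ (1 / q)) *
          ((∫⁻ z in rect I J, L z) ^ (1 / p) * (∫⁻ z in rect I J, M z ^ (1 - q)) ^ (1 / q)) :=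
          mul_le_mul' (aux hM.measurable hL.measurable I J) (aux hL.measurable hM.measurable I J)
      _ = ((∫⁻ z in rect I J, M z) ^ (1 / p) * (∫⁻ z in rect I J, M z ^ (1 - q)) ^ (1 / q)) *
          ((∫⁻ z in rect I J, L z) ^ (1 / p) * (∫⁻ z in rect I J, L z ^ (1 - q)) ^ (1 / q)) := by
          ring
      _ ≤ (Q ^ (1 / p) * V) * (Q' ^ (1 / p) * V) := mul_le_mul' h1 h2
      _ = _ := by
          rw [ENNReal.mul_rpow_of_nonneg _ _ hp1, ENNReal.rpow_two]
          ring

end FiberWeights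

end BiParam

namespace BiParam

/-! ### Weighted bounds for the square functions in the first variable. -/

section SquareFunctions

variable {n m : ℕ}

/-- The square of the square function `∑_I ∑_η 1_I / |I| ⊗ c_{I, η}²`. -/
noncomputable def sqFn (D : Set (Cube n)) (S : Cube n → Finset (Fin n → Fin 2))
    (c : Cube n → (Fin n → Fin 2) → (Fin m → ℝ) → ℝ≥0∞)
    (z : (Fin n → ℝ) × (Fin m → ℝ)) : ℝ≥0∞ :=
  ∑' I : D, ∑ η ∈ S I, I.1.toSet.indicator (fun _ => (volume I.1.toSet)⁻¹) z.1 * c I η z.2 ^ 2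

/-- The coefficients `|⟨f, h_I^η⟩₁|`. -/
noncomputable def coef (f : (Fin n → ℝ) × (Fin m → ℝ) → ℂ) (I : Cube n) (η : Fin n → Fin 2)
    (y : Fin m → ℝ) : ℝ≥0∞ :=
  ‖pair₁ f (haar I η) y‖ₑ

/-- The maximal coefficients `M_E ⟨f, h_I^η⟩₁`. -/
noncomputable def maxCoef (E : Set (Cube m)) (f : (Fin n → ℝ) × (Fin m → ℝ) → ℂ) (I : Cube n)
    (η : Fin n → Fin 2) (y : Fin m → ℝ) : ℝ≥0∞ :=
  dyadicMax E (pair₁ f (haar I η)) y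

theorem measurable_pair₁ {f : (Fin n → ℝ) × (Fin m → ℝ) → ℂ} (hf : Measurable f) (I : Cube n)
    (η : Fin n → Fin 2) : Measurable (pair₁ f (haar I η)) := by
  have h : Measurable fun z : (Fin n → ℝ) × (Fin m → ℝ) => f z * (haar I η z.1 : ℂ) :=
    hf.mul (Complex.measurable_ofReal.comp ((measurable_haar I η).comp measurable_fst))
  exact (h.stronglyMeasurable.integral_prod_left' (μ := volume)).measurable

theorem measurable_coef {f : (Fin n → ℝ) × (Fin m → ℝ) → ℂ} (hf : Measurable f) (I : Cube n)
    (η : Fin n → Fin 2) : Measurable (coef f I η) :=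
  (measurable_pair₁ hf I η).enorm

theorem measurable_maxCoef {E : Set (Cube m)} (hE : E.Countable)
    (f : (Fin n → ℝ) × (Fin m → ℝ) → ℂ) (I : Cube n)
    (η : Fin n → Fin 2) : Measurable (maxCoef E f I η) :=
  measurable_maxM hE _

theorem measurable_cubeDensity (I : Cube n) : Measurable fun z : (Fin n → ℝ) × (Fin m → ℝ) =>
    I.toSet.indicator (fun _ => (volume I.toSet)⁻¹) z.1 :=
  (measurable_const.indicator I.measurableSet_toSet).comp measurable_fst

theorem measurable_sqFn {D : Set (Cube n)} (hD : D.Countable)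
    {S : Cube n → Finset (Fin n → Fin 2)}
    {c : Cube n → (Fin n → Fin 2) → (Fin m → ℝ) → ℝ≥0∞} (hc : ∀ I η, Measurable (c I η)) :
    Measurable (sqFn D S c) := by
  have : Countable D := hD.to_subtype
  exact Measurable.tsum fun I => Finset.measurable_sum _ fun η _ =>
    (measurable_cubeDensity I.1).mul (((hc I η).comp measurable_snd).pow_const 2)

theorem lintegral_sqFn_mul {D : Set (Cube n)} (hD : D.Countable)
    {S : Cube n → Finset (Fin n → Fin 2)}
    {c : Cube n → (Fin n → Fin 2) → (Fin m → ℝ) → ℝ≥0∞} (hc : ∀ I η, Measurable (c I η))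
    {W : (Fin n → ℝ) × (Fin m → ℝ) → ℝ≥0∞} (hW : Measurable W) :
    ∫⁻ z, sqFn D S c z * W z = ∑' I : D, ∑ η ∈ S I,
      ∫⁻ z, I.1.toSet.indicator (fun _ => (volume I.1.toSet)⁻¹) z.1 * c I η z.2 ^ 2 * W z := by
  have : Countable D := hD.to_subtype
  have hm : ∀ (I : Cube n) η, Measurable fun z : (Fin n → ℝ) × (Fin m → ℝ) =>
      I.toSet.indicator (fun _ => (volume I.toSet)⁻¹) z.1 * c I η z.2 ^ 2 * W z := fun I η =>
    ((measurable_cubeDensity I).mul (((hc I η).comp measurable_snd).pow_const 2)).mul hW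
  simp only [sqFn, ← ENNReal.tsum_mul_right, Finset.sum_mul]
  rw [lintegral_tsum fun I => (Finset.measurable_sum _ fun η _ => hm I.1 η).aemeasurable]
  refine tsum_congr fun I => ?_
  rw [lintegral_finsetSum _ fun η _ => hm I.1 η]

theorem lintegral_indicator_mul (I : Cube n) (v : (Fin n → ℝ) → ℝ≥0∞) (a : ℝ≥0∞) :
    ∫⁻ x, I.toSet.indicator (fun _ => a) x * v x = ∫⁻ x in I.toSet, a * v x := by
  rw [← lintegral_indicator I.measurableSet_toSet]
  refine lintegral_congr fun x => ?_
  by_cases hx : x ∈ I.toSet <;> simp [hx]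

/-- The weighted `L²` bounds for the square functions in the first variable. -/
theorem exists_lintegral_sqFn_mul_le (hn : 0 < n) (B : ℝ) : ∃ K : ℝ≥0,
    ∀ (D : Set (Cube n)) (E : Set (Cube m)), IsDyadicGrid D →
    ∀ W : (Fin n → ℝ) × (Fin m → ℝ) → ℝ≥0∞, Measurable W → (∀ z, W z ≠ 0) → (∀ z, W z ≠ ∞) →
    FiberAp D E 2 2 (ENNReal.ofReal B) W →
    ∀ f : (Fin n → ℝ) × (Fin m → ℝ) → ℂ, Measurable f →
    ∀ S : Cube n → Finset (Fin n → Fin 2), (∀ I, 0 ∉ S I) →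
      ∫⁻ z, sqFn D S (coef f) z * W z ≤ K * ∫⁻ z, ‖f z‖ₑ ^ 2 * W z := by
  obtain ⟨C, -, H⟩ := exists_tsum_haar_le n hn B
  refine ⟨C, fun D E hD W hW hW0 hWt hA f hf S hS => ?_⟩
  have hcD : Countable D := hD.countable.to_subtype
  have hfW : Measurable fun z => ‖f z‖ₑ ^ 2 * W z := (hf.enorm.pow_const 2).mul hW
  -- Integrating in the first variable turns W into its average over I on the fibre, which is the
  -- form of the one-variable Haar estimate.
  have hterm : ∀ (I : Cube n) η, ∫⁻ z : (Fin n → ℝ) × (Fin m → ℝ),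
      I.toSet.indicator (fun _ => (volume I.toSet)⁻¹) z.1 * coef f I η z.2 ^ 2 * W z =
      ∫⁻ y, coef f I η y ^ 2 * ((∫⁻ x in I.toSet, W (x, y)) / volume I.toSet) := by
    intro I η
    have hm : Measurable fun z : (Fin n → ℝ) × (Fin m → ℝ) =>
        I.toSet.indicator (fun _ => (volume I.toSet)⁻¹) z.1 * coef f I η z.2 ^ 2 * W z :=
      ((measurable_cubeDensity I).mul (((measurable_coef hf I η).comp
        measurable_snd).pow_const 2)).mul hW
    rw [lintegral_eq_lintegral_snd_fst hm]
    refine lintegral_congr fun y => ?_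
    have hWy : Measurable fun x => W (x, y) := hW.comp measurable_prodMk_right
    simp only [mul_assoc]
    rw [lintegral_indicator_mul, lintegral_const_mul _ (hWy.const_mul _),
      lintegral_const_mul _ hWy, ENNReal.div_eq_inv_mul]
    ring
  have hmy : ∀ (I : Cube n) η, Measurable fun y : Fin m → ℝ =>
      coef f I η y ^ 2 * ((∫⁻ x in I.toSet, W (x, y)) / volume I.toSet) := fun I η =>
    ((measurable_coef hf I η).pow_const 2).mul ((Measurable.lintegral_prod_left' hW).div_const _)
  rw [lintegral_sqFn_mul hD.countable (measurable_coef hf) hW, lintegral_eq_lintegral_snd_fst hfW,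
    ← lintegral_const_mul' _ _ ENNReal.coe_ne_top]
  simp only [hterm]
  have e : ∀ I : D, ∑ η ∈ S I, ∫⁻ y, coef f I.1 η y ^ 2 *
      ((∫⁻ x in I.1.toSet, W (x, y)) / volume I.1.toSet) = ∫⁻ y, ∑ η ∈ S I, coef f I.1 η y ^ 2 *
      ((∫⁻ x in I.1.toSet, W (x, y)) / volume I.1.toSet) := fun I =>
    (lintegral_finsetSum _ fun η _ => hmy I.1 η).symm
  simp only [e]
  rw [← lintegral_tsum fun I => (Finset.measurable_sum _ fun η _ => hmy I.1 η).aemeasurable]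
  refine lintegral_mono_ae (hA.1.mono fun y hy => ?_)
  exact H (fun x => W (x, y)) (hW.comp measurable_prodMk_right) (fun x => hW0 _) (fun x => hWt _)
    D hD hy (fun x => f (x, y)) (hf.comp measurable_prodMk_right) S hS

/-- At exponent 2 the square function decouples into a sum over I and η. For fixed x each summand is
a weighted L² norm in y of one maximal function, so the scalar Muckenhoupt theorem for W(x, ·)
applies term by term. -/
theorem lintegral_sqFn_maxCoef_mul_le (hm : 0 < m) {D : Set (Cube n)} {E : Set (Cube m)}
    (hD : IsDyadicGrid D) (hE : IsDyadicGrid E) {Q : ℝ≥0∞} (hQ : Q ≠ ∞)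
    {W : (Fin n → ℝ) × (Fin m → ℝ) → ℝ≥0∞} (hW : Measurable W) (hW0 : ∀ z, W z ≠ 0)
    (hWt : ∀ z, W z ≠ ∞) (hA : FiberAp D E 2 2 Q W) {f : (Fin n → ℝ) × (Fin m → ℝ) → ℂ}
    (hf : Measurable f) (S : Cube n → Finset (Fin n → Fin 2)) :
    ∫⁻ z, sqFn D S (maxCoef E f) z * W z ≤
      maxConst 2 2 Q * ∫⁻ z, sqFn D S (coef f) z * W z := by
  have hK := maxConst_ne_top Real.HolderConjugate.two_two hQ
  rw [lintegral_sqFn_mul hD.countable (measurable_coef hf) hW,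
    lintegral_sqFn_mul hD.countable (measurable_maxCoef hE.countable f) hW, ← ENNReal.tsum_mul_left]
  refine ENNReal.tsum_le_tsum fun I => ?_
  rw [Finset.mul_sum]
  refine Finset.sum_le_sum fun η _ => ?_
  have hm1 : ∀ c : (Fin m → ℝ) → ℝ≥0∞, Measurable c →
      Measurable fun z : (Fin n → ℝ) × (Fin m → ℝ) =>
        I.1.toSet.indicator (fun _ => (volume I.1.toSet)⁻¹) z.1 * c z.2 ^ 2 * W z := fun c hc =>
    ((measurable_cubeDensity I.1).mul ((hc.comp measurable_snd).pow_const 2)).mul hW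
  rw [lintegral_eq_lintegral_fst_snd (hm1 _ (measurable_maxCoef hE.countable f I.1 η)),
    lintegral_eq_lintegral_fst_snd (hm1 _ (measurable_coef hf I.1 η)),
    ← lintegral_const_mul' _ _ hK]
  refine lintegral_mono_ae (hA.2.mono fun x hx => ?_)
  have h := lintegral_maxM_rpow_mul_le (w := fun y => W (x, y)) (g := coef f I.1 η) hE hm
    Real.HolderConjugate.two_two hQ (hW.comp measurable_prodMk_left) (fun y => hW0 _)
    (fun y => hWt _) hx (measurable_coef hf I.1 η)
  simp only [ENNReal.rpow_two] at h
  have ht : I.1.toSet.indicator (fun _ => (volume I.1.toSet)⁻¹) x ≠ ∞ := by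
    by_cases hxI : x ∈ I.1.toSet <;> simp [hxI, I.1.volume_ne_zero]
  simp only [mul_assoc]
  rw [lintegral_const_mul' _ _ ht, lintegral_const_mul' _ _ ht, mul_left_comm]
  gcongr
  exact h

/-- The weighted `L^p` bounds for the square functions with coefficients `⟨f, h_I^η⟩₁` and
`M_E ⟨f, h_I^η⟩₁`. -/
theorem exists_lintegral_sqFn_rpow_le (hn : 0 < n) (hm : 0 < m) {p q : ℝ}
    (hpq : p.HolderConjugate q) (Q : ℝ≥0) : ∃ C : ℝ≥0,
    ∀ (D : Set (Cube n)) (E : Set (Cube m)), IsDyadicGrid D → IsDyadicGrid E →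
    ∀ w : (Fin n → ℝ) × (Fin m → ℝ) → ℝ≥0∞, Measurable w → (∀ z, w z ≠ 0) → (∀ z, w z ≠ ∞) →
    FiberAp D E p q Q w →
    ∀ f : (Fin n → ℝ) × (Fin m → ℝ) → ℂ, Measurable f →
    ∀ S : Cube n → Finset (Fin n → Fin 2), (∀ I, 0 ∉ S I) →
      ∫⁻ z, (sqFn D S (coef f) z ^ (1 / 2 : ℝ)) ^ p * w z ≤ C * ∫⁻ z, ‖f z‖ₑ ^ p * w z ∧
      ∫⁻ z, (sqFn D S (maxCoef E f) z ^ (1 / 2 : ℝ)) ^ p * w z ≤ C * ∫⁻ z, ‖f z‖ₑ ^ p * w z := by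
  obtain ⟨B, HB⟩ := exists_extrapolation hn hm hpq Q
  obtain ⟨K, HK⟩ := exists_lintegral_sqFn_mul_le (m := m) hn B
  have hQ : ENNReal.ofReal B ≠ ∞ := ENNReal.ofReal_ne_top
  have hmt := maxConst_ne_top Real.HolderConjugate.two_two hQ
  -- One constant for both square functions: the second costs the additional factor from
  -- Muckenhoupt's theorem.
  obtain ⟨C, HC⟩ := HB (max K ((maxConst 2 2 (ENNReal.ofReal B)).toNNReal * K))
  refine ⟨C, fun D E hD hE w hw hw0 hwt hA f hf S hS => ?_⟩
  have hsq : ∀ a : ℝ≥0∞, (a ^ (1 / 2 : ℝ)) ^ 2 = a := fun a => by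
    rw [← ENNReal.rpow_two, ← ENNReal.rpow_mul]
    norm_num
  constructor
  · refine HC D E hD hE w hw hw0 hwt hA _ _
      ((measurable_sqFn hD.countable (measurable_coef hf)).pow_const _) hf.enorm ?_
    intro W hW hW0 hWt hWA
    simp only [hsq]
    refine (HK D E hD W hW hW0 hWt hWA f hf S hS).trans ?_
    gcongr
    exact le_max_left _ _
  · refine HC D E hD hE w hw hw0 hwt hA _ _
      ((measurable_sqFn hD.countable (measurable_maxCoef hE.countable f)).pow_const _) hf.enorm ?_
    intro W hW hW0 hWt hWA
    simp only [hsq]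
    refine (lintegral_sqFn_maxCoef_mul_le hm hD hE hQ hW hW0 hWt hWA hf S).trans ?_
    refine (mul_le_mul_right (HK D E hD W hW hW0 hWt hWA f hf S hS) _).trans ?_
    rw [← mul_assoc]
    gcongr
    rw [ENNReal.coe_max, ENNReal.coe_mul, ENNReal.coe_toNNReal hmt]
    exact le_max_right _ _

end SquareFunctions

end BiParam

namespace BiParam

/-! ### The duality bound for finite partial sums. -/

section Duality

variable {n m : ℕ}

/-- The square of the square function over finitely many cubes. -/
noncomputable def sqFin {D : Set (Cube n)} (s : Finset D) (S : Cube n → Finset (Fin n → Fin 2))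
    (c : Cube n → (Fin n → Fin 2) → (Fin m → ℝ) → ℝ≥0∞)
    (z : (Fin n → ℝ) × (Fin m → ℝ)) : ℝ≥0∞ :=
  ∑ I ∈ s, ∑ η ∈ S I, I.1.toSet.indicator (fun _ => (volume I.1.toSet)⁻¹) z.1 * c I η z.2 ^ 2

theorem sqFin_le_sqFn {D : Set (Cube n)} (s : Finset D) (S : Cube n → Finset (Fin n → Fin 2))
    (c : Cube n → (Fin n → Fin 2) → (Fin m → ℝ) → ℝ≥0∞) (z : (Fin n → ℝ) × (Fin m → ℝ)) :
    sqFin s S c z ≤ sqFn D S c z :=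
  ENNReal.sum_le_tsum s

theorem measurable_sqFin {D : Set (Cube n)} (s : Finset D)
    {S : Cube n → Finset (Fin n → Fin 2)}
    {c : Cube n → (Fin n → Fin 2) → (Fin m → ℝ) → ℝ≥0∞} (hc : ∀ I η, Measurable (c I η)) :
    Measurable (sqFin s S c) :=
  Finset.measurable_sum _ fun I _ => Finset.measurable_sum _ fun η _ =>
    (measurable_cubeDensity I.1).mul (((hc I η).comp measurable_snd).pow_const 2)

/-- Cauchy–Schwarz over the pairs (I, η), with the density 1_I/|I| split evenly between the two
factors. -/
theorem sum_mul_le_sqFin {D : Set (Cube n)} (s : Finset D) (S : Cube n → Finset (Fin n → Fin 2))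
    (c d : Cube n → (Fin n → Fin 2) → (Fin m → ℝ) → ℝ≥0∞) (z : (Fin n → ℝ) × (Fin m → ℝ)) :
    ∑ I ∈ s, ∑ η ∈ S I, I.1.toSet.indicator (fun _ => (volume I.1.toSet)⁻¹) z.1 *
      (c I η z.2 * d I η z.2) ≤ sqFin s S c z ^ (1 / 2 : ℝ) * sqFin s S d z ^ (1 / 2 : ℝ) := by
  unfold sqFin
  rw [Finset.sum_sigma', Finset.sum_sigma', Finset.sum_sigma']
  set κ : (Σ _ : D, Fin n → Fin 2) → ℝ≥0∞ := fun i =>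
    i.1.1.toSet.indicator (fun _ => (volume i.1.1.toSet)⁻¹) z.1
  have h := ENNReal.inner_le_Lp_mul_Lq (s.sigma fun I : D => S I)
    (fun i => κ i ^ (1 / 2 : ℝ) * c i.1 i.2 z.2) (fun i => κ i ^ (1 / 2 : ℝ) * d i.1 i.2 z.2)
    Real.HolderConjugate.two_two
  have e1 : ∀ a b c : ℝ≥0∞, a ^ (1 / 2 : ℝ) * b * (a ^ (1 / 2 : ℝ) * c) = a * (b * c) :=
    fun a b c => by
      rw [mul_mul_mul_comm, ← ENNReal.rpow_add_of_nonneg _ _ (by norm_num) (by norm_num)]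
      norm_num
  have e2 : ∀ a b : ℝ≥0∞, (a ^ (1 / 2 : ℝ) * b) ^ (2 : ℝ) = a * b ^ 2 := fun a b => by
    rw [ENNReal.mul_rpow_of_nonneg _ _ (by norm_num), ← ENNReal.rpow_mul]
    norm_num
  simp only [e1, e2] at h
  exact h

theorem measurable_avg₁ {ν : (Fin n → ℝ) × (Fin m → ℝ) → ℝ} (hν : Measurable ν) (I : Cube n) :
    Measurable (avg₁ ν I) := by
  have h : Measurable fun y : Fin m → ℝ => ∫ x in I.toSet, ν (x, y) :=
    (hν.stronglyMeasurable.integral_prod_left' (μ := volume.restrict I.toSet)).measurable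
  have e : avg₁ ν I = fun y => (volume.real I.toSet)⁻¹ * ∫ x in I.toSet, ν (x, y) := by
    ext y
    rw [avg₁, setAverage_eq, smul_eq_mul]
  rw [e]
  exact h.const_mul _

theorem enorm_avg₁_le (ν : (Fin n → ℝ) × (Fin m → ℝ) → ℝ) (I : Cube n) (y : Fin m → ℝ) :
    ‖avg₁ ν I y‖ₑ ≤ (∫⁻ x in I.toSet, ‖ν (x, y)‖ₑ) / volume I.toSet := by
  rw [avg₁, setAverage_eq, enorm_smul, ENNReal.div_eq_inv_mul]
  gcongr
  · rw [enorm_inv I.volume_real_pos.ne', Real.enorm_eq_ofReal I.volume_real_pos.le, Measure.real,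
      ENNReal.ofReal_toReal I.volume_ne_top]
  · exact enorm_integral_le_lintegral_enorm _

theorem measurable_phiTerm {E : Set (Cube m)} (hE : E.Countable)
    {ν : (Fin n → ℝ) × (Fin m → ℝ) → ℝ} (hν : Measurable ν)
    (f : (Fin n → ℝ) × (Fin m → ℝ) → ℂ) (I : Cube n) (η : Fin n → Fin 2) :
    Measurable (phiTerm E ν f I η) :=
  ((measurable_haar I η).comp measurable_fst).mul
    ((((measurable_maxM hE _).ennreal_toReal).mul (measurable_avg₁ hν I)).comp measurable_snd)

/-- A finite partial sum of `φ^{ν,1} f`. -/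
noncomputable def phiSum {D : Set (Cube n)} (E : Set (Cube m))
    (S : Cube n → Finset (Fin n → Fin 2)) (ν : (Fin n → ℝ) × (Fin m → ℝ) → ℝ)
    (f : (Fin n → ℝ) × (Fin m → ℝ) → ℂ) (s : Finset D) (z : (Fin n → ℝ) × (Fin m → ℝ)) : ℝ :=
  ∑ I ∈ s, ∑ η ∈ S I, phiTerm E ν f I η z

theorem measurable_phiSum {D : Set (Cube n)} {E : Set (Cube m)} (hE : E.Countable)
    {ν : (Fin n → ℝ) × (Fin m → ℝ) → ℝ} (hν : Measurable ν)
    (f : (Fin n → ℝ) × (Fin m → ℝ) → ℂ) (S : Cube n → Finset (Fin n → Fin 2)) (s : Finset D) :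
    Measurable (phiSum E S ν f s) :=
  Finset.measurable_sum _ fun I _ => Finset.measurable_sum _ fun η _ =>
    measurable_phiTerm hE hν f I η

/-- The pairing of a finite partial sum of `φ^{ν,1} f` with a function on a fibre. -/
theorem lintegral_phiSum_mul_fiber_le {D : Set (Cube n)} {E : Set (Cube m)}
    {S : Cube n → Finset (Fin n → Fin 2)} {ν : (Fin n → ℝ) × (Fin m → ℝ) → ℝ}
    {f : (Fin n → ℝ) × (Fin m → ℝ) → ℂ} {s : Finset D} {g : (Fin n → ℝ) × (Fin m → ℝ) → ℝ}
    {y : Fin m → ℝ} (hgint : ∀ I ∈ D, IntegrableOn (fun x => g (x, y)) I.toSet)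
    (hnn : ∀ x, 0 ≤ phiSum E S ν f s (x, y) * g (x, y)) :
    ∫⁻ x, ENNReal.ofReal (phiSum E S ν f s (x, y) * g (x, y)) ≤
      ∑ I ∈ s, ∑ η ∈ S I, maxCoef E f I η y * coef (fun z => (g z : ℂ)) I η y *
        ((∫⁻ x in I.1.toSet, ‖ν (x, y)‖ₑ) / volume I.1.toSet) := by
  have hpair : ∀ I ∈ D, ∀ η, Integrable (fun x => g (x, y) * haar I η x) ∧
      ‖∫ x, g (x, y) * haar I η x‖ₑ = coef (fun z => (g z : ℂ)) I η y := by
    intro I hI η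
    have h1 := integrable_mul_haar (hgint I hI).ofReal η
    have h2 : ∀ x, (g (x, y) : ℂ) * (haar I η x : ℂ) = ((g (x, y) * haar I η x : ℝ) : ℂ) :=
      fun x => (Complex.ofReal_mul _ _).symm
    constructor
    · exact h1.re.congr (Eventually.of_forall fun x => by simp)
    · rw [coef, pair₁]
      simp only [h2]
      rw [integral_complex_ofReal, ← ofReal_norm, ← ofReal_norm, Complex.norm_real]
  have hterm : ∀ x, phiSum E S ν f s (x, y) * g (x, y) = ∑ I ∈ s, ∑ η ∈ S I,
      ((dyadicMax E (pair₁ f (haar I.1 η)) y).toReal * avg₁ ν I y) * (g (x, y) * haar I.1 η x) := by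
    intro x
    simp only [phiSum, Finset.sum_mul, phiTerm]
    refine Finset.sum_congr rfl fun I _ => Finset.sum_congr rfl fun η _ => ?_
    ring
  have hi : ∀ I ∈ s, ∀ η ∈ S I, Integrable fun x =>
      ((dyadicMax E (pair₁ f (haar I.1 η)) y).toReal * avg₁ ν I y) * (g (x, y) * haar I.1 η x) :=
    fun I _ η _ => (hpair I.1 I.2 η).1.const_mul _
  have hint : Integrable fun x => phiSum E S ν f s (x, y) * g (x, y) := by
    rw [funext hterm]
    exact integrable_finsetSum _ fun I hI => integrable_finsetSum _ fun η hη => hi I hI η hη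
  -- By nonnegativity this is an ordinary integral, which is linear in the Haar functions; absolute
  -- values are taken only after integrating, so cancellation is kept in the coefficients of g.
  rw [← ofReal_integral_eq_lintegral_ofReal hint (Eventually.of_forall hnn)]
  refine (Real.ofReal_le_enorm _).trans ?_
  rw [funext hterm, integral_finsetSum _ fun I hI => integrable_finsetSum _ fun η hη => hi I hI η hη]
  refine (enorm_sum_le _ _).trans (Finset.sum_le_sum fun I hI => ?_)
  rw [integral_finsetSum _ fun η hη => hi I hI η hη]
  refine (enorm_sum_le _ _).trans (Finset.sum_le_sum fun η hη => ?_)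
  rw [integral_const_mul, enorm_mul, enorm_mul, (hpair I.1 I.2 η).2, mul_right_comm]
  have h1 : ‖(dyadicMax E (pair₁ f (haar I.1 η)) y).toReal‖ₑ ≤ maxCoef E f I.1 η y := by
    rw [Real.enorm_eq_ofReal ENNReal.toReal_nonneg]
    exact ENNReal.ofReal_toReal_le
  gcongr
  exact enorm_avg₁_le ν I.1 y

/-- The pairing of a finite partial sum of `φ^{ν,1} f` with a function is bounded by square
functions. -/
theorem lintegral_phiSum_mul_le {D : Set (Cube n)} {E : Set (Cube m)} (hE : E.Countable)
    {S : Cube n → Finset (Fin n → Fin 2)} {ν : (Fin n → ℝ) × (Fin m → ℝ) → ℝ} (hν : Measurable ν)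
    (f : (Fin n → ℝ) × (Fin m → ℝ) → ℂ) (s : Finset D) {g : (Fin n → ℝ) × (Fin m → ℝ) → ℝ}
    (hg : Measurable g) (hgint : ∀ᵐ y, ∀ I ∈ D, IntegrableOn (fun x => g (x, y)) I.toSet)
    (hnn : ∀ z, 0 ≤ phiSum E S ν f s z * g z) :
    ∫⁻ z, ENNReal.ofReal (phiSum E S ν f s z * g z) ≤
      ∫⁻ z, sqFin s S (maxCoef E f) z ^ (1 / 2 : ℝ) *
        sqFin s S (coef fun z => (g z : ℂ)) z ^ (1 / 2 : ℝ) * ‖ν z‖ₑ := by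
  have hgc : Measurable fun z => (g z : ℂ) := Complex.measurable_ofReal.comp hg
  have hm1 : Measurable fun z => ENNReal.ofReal (phiSum E S ν f s z * g z) :=
    ((measurable_phiSum hE hν f S s).mul hg).ennreal_ofReal
  set T : Cube n → (Fin n → Fin 2) → (Fin n → ℝ) × (Fin m → ℝ) → ℝ≥0∞ := fun I η z =>
    I.toSet.indicator (fun _ => (volume I.toSet)⁻¹) z.1 *
      (maxCoef E f I η z.2 * coef (fun z => (g z : ℂ)) I η z.2) * ‖ν z‖ₑ with hT
  have hTm : ∀ I η, Measurable (T I η) := fun I η =>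
    ((measurable_cubeDensity I).mul (((measurable_maxCoef hE f I η).mul
      (measurable_coef hgc I η)).comp measurable_snd)).mul hν.enorm
  have hTint : ∀ I η y, ∫⁻ x, T I η (x, y) =
      maxCoef E f I η y * coef (fun z => (g z : ℂ)) I η y *
        ((∫⁻ x in I.toSet, ‖ν (x, y)‖ₑ) / volume I.toSet) := by
    intro I η y
    have hνy : Measurable fun x => ‖ν (x, y)‖ₑ := (hν.comp measurable_prodMk_right).enorm
    simp only [hT, mul_assoc]
    rw [lintegral_indicator_mul, lintegral_const_mul _ ((hνy.const_mul _).const_mul _),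
      lintegral_const_mul _ (hνy.const_mul _), lintegral_const_mul _ hνy, ENNReal.div_eq_inv_mul]
    ring
  calc ∫⁻ z, ENNReal.ofReal (phiSum E S ν f s z * g z)
      ≤ ∫⁻ z, ∑ I ∈ s, ∑ η ∈ S I, T I η z := by
        rw [lintegral_eq_lintegral_snd_fst hm1, lintegral_eq_lintegral_snd_fst
          (Finset.measurable_sum _ fun I _ => Finset.measurable_sum _ fun η _ => hTm I.1 η)]
        refine lintegral_mono_ae (hgint.mono fun y hy => ?_)
        refine (lintegral_phiSum_mul_fiber_le hy fun x => hnn (x, y)).trans (le_of_eq ?_)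
        have hTy : ∀ I η, Measurable fun x => T I η (x, y) := fun I η =>
          (hTm I η).comp measurable_prodMk_right
        rw [lintegral_finsetSum _ fun I _ => Finset.measurable_sum _ fun η _ => hTy I.1 η]
        refine Finset.sum_congr rfl fun I _ => ?_
        rw [lintegral_finsetSum _ fun η _ => hTy I.1 η]
        exact Finset.sum_congr rfl fun η _ => (hTint I.1 η y).symm
    _ ≤ _ := by
        refine lintegral_mono fun z => ?_
        simp only [hT, ← Finset.sum_mul]
        gcongr
        exact sum_mul_le_sqFin s S _ _ z

/-- The finite partial sums of `φ^{ν,1} f` are bounded by the square function with the maximal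
coefficients. -/
theorem lintegral_phiSum_rpow_le {D : Set (Cube n)} {E : Set (Cube m)} (hD : IsDyadicGrid D)
    (hE : IsDyadicGrid E) {p q : ℝ} (hpq : p.HolderConjugate q) {Q : ℝ≥0∞} {C : ℝ≥0}
    {M L : (Fin n → ℝ) × (Fin m → ℝ) → ℝ≥0∞} (hM : Measurable M) (hL : RectAp p q Q L)
    {S : Cube n → Finset (Fin n → Fin 2)}
    (hC : ∀ g : (Fin n → ℝ) × (Fin m → ℝ) → ℂ, Measurable g →
      ∫⁻ z, (sqFn D S (coef g) z ^ (1 / 2 : ℝ)) ^ q * L z ^ (1 - q) ≤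
        C * ∫⁻ z, ‖g z‖ₑ ^ q * L z ^ (1 - q))
    {ν : (Fin n → ℝ) × (Fin m → ℝ) → ℝ} (hν : Measurable ν)
    (hνML : ∀ z, ‖ν z‖ₑ = M z ^ (1 / p) * L z ^ (-(1 / p)))
    (f : (Fin n → ℝ) × (Fin m → ℝ) → ℂ) (s : Finset D) :
    ∫⁻ z, ‖phiSum E S ν f s z‖ₑ ^ p * L z ≤
      C ^ (p / q) * ∫⁻ z, (sqFin s S (maxCoef E f) z ^ (1 / 2 : ℝ)) ^ p * M z := by
  have hLm := hL.measurable
  have hp0 := hpq.ne_zero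
  have hq0 := hpq.symm.ne_zero
  have hmul := hpq.mul_eq_add
  obtain ⟨g₀, gm, g0, gt, gi⟩ := exists_pos_lintegral_rpow_mul_lt
    (volume : Measure ((Fin n → ℝ) × (Fin m → ℝ))) hpq.pos hLm hL.ne_zero hL.ne_top one_ne_zero
  set φ := phiSum E S ν f s with hφ
  have hφm : Measurable φ := measurable_phiSum hE.countable hν f S s
  rw [lintegral_rpow_mul_eq_iSup_min hpq.pos hLm hφm.enorm gm g0]
  refine iSup_le fun N => ?_
  -- The truncation makes J finite, so that J^{1/q} can be cancelled at the end without knowing that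
  -- the partial sum lies in L^p.
  set F : (Fin n → ℝ) × (Fin m → ℝ) → ℝ≥0∞ := fun z => min ‖φ z‖ₑ (N * g₀ z) with hF
  have hFm : Measurable F := hφm.enorm.min (gm.const_mul _)
  have hFt : ∀ z, F z ≠ ∞ := fun z => ne_top_of_le_ne_top enorm_ne_top (min_le_left _ _)
  set k : (Fin n → ℝ) × (Fin m → ℝ) → ℝ≥0∞ := fun z => F z ^ (p - 1) * L z with hk
  have hkm : Measurable k := (hFm.pow_const _).mul hLm
  have hkt : ∀ z, k z ≠ ∞ := fun z => ENNReal.mul_ne_top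
    (ENNReal.rpow_ne_top_of_nonneg hpq.sub_one_pos.le (hFt z)) (hL.ne_top z)
  set J := ∫⁻ z, F z ^ p * L z with hJ
  have hJt : J ≠ ∞ := by
    refine ne_top_of_le_ne_top (b := N ^ p * ∫⁻ z, g₀ z ^ p * L z) (ENNReal.mul_ne_top
      (ENNReal.rpow_ne_top_of_nonneg hpq.nonneg (ENNReal.natCast_ne_top N)) (ne_top_of_lt gi)) ?_
    rw [← lintegral_const_mul' _ _
      (ENNReal.rpow_ne_top_of_nonneg hpq.nonneg (ENNReal.natCast_ne_top N))]
    refine lintegral_mono fun z => ?_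
    simp only
    rw [← mul_assoc, ← ENNReal.mul_rpow_of_nonneg _ _ hpq.nonneg]
    have := hpq.nonneg
    gcongr
    exact min_le_right _ _
  have hkJ : ∫⁻ z, k z ^ q * L z ^ (1 - q) = J := by
    refine lintegral_congr fun z => ?_
    simp only [hk]
    rw [ENNReal.mul_rpow_of_nonneg _ _ hpq.symm.nonneg, mul_assoc,
      ← ENNReal.rpow_add _ _ (hL.ne_zero z) (hL.ne_top z), ← ENNReal.rpow_mul,
      show (p - 1) * q = p by linarith, show q + (1 - q) = 1 by ring, ENNReal.rpow_one]
  -- The extremal function for the duality, with the sign of φ, so that φ g dominates F^p times the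
  -- weight.
  set g : (Fin n → ℝ) × (Fin m → ℝ) → ℝ := fun z =>
    if 0 ≤ φ z then (k z).toReal else -(k z).toReal with hg
  have hgm : Measurable g := Measurable.ite (measurableSet_le measurable_const hφm)
    hkm.ennreal_toReal hkm.ennreal_toReal.neg
  have hgk : ∀ z, ‖g z‖ₑ = k z := by
    intro z
    simp only [hg]
    split_ifs
    · rw [Real.enorm_eq_ofReal ENNReal.toReal_nonneg, ENNReal.ofReal_toReal (hkt z)]
    · rw [enorm_neg, Real.enorm_eq_ofReal ENNReal.toReal_nonneg, ENNReal.ofReal_toReal (hkt z)]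
  have hφg : ∀ z, φ z * g z = |φ z| * (k z).toReal := by
    intro z
    simp only [hg]
    split_ifs with h
    · rw [abs_of_nonneg h]
    · rw [abs_of_neg (not_le.1 h)]
      ring
  have hnn : ∀ z, 0 ≤ φ z * g z := fun z => by
    rw [hφg]
    positivity
  have hσm : Measurable fun z => k z ^ q * L z ^ (1 - q) := (hkm.pow_const _).mul (hLm.pow_const _)
  -- The Haar coefficients of g on a fibre need local integrability: almost every fibre has finite
  -- L^q norm for the dual weight, and the weight itself is integrable over the cubes of the fibre.
  have hgint : ∀ᵐ y, ∀ I ∈ D, IntegrableOn (fun x => g (x, y)) I.toSet := by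
    have h1 : ∀ᵐ y, ∫⁻ x, k (x, y) ^ q * L (x, y) ^ (1 - q) < ∞ := by
      refine ae_lt_top (Measurable.lintegral_prod_left' hσm) ?_
      rw [← lintegral_eq_lintegral_snd_fst hσm, hkJ]
      exact hJt
    filter_upwards [h1, (hL.fiberAp hpq.lt hD.countable hE.countable).1] with y hy hAy I hI
    refine ⟨(hgm.comp measurable_prodMk_right).aestronglyMeasurable, ?_⟩
    have hLy : Measurable fun x => L (x, y) := hLm.comp measurable_prodMk_right
    have h2 := lintegral_mul_le_weight (μ := volume.restrict I.toSet) hpq hLy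
      (fun x => hL.ne_zero _) (fun x => hL.ne_top _) (u := fun _ => 1)
      (v := fun x => k (x, y)) measurable_const (hkm.comp measurable_prodMk_right)
    simp only [one_mul, ENNReal.one_rpow] at h2
    change ∫⁻ x in I.toSet, ‖g (x, y)‖ₑ < ∞
    simp only [hgk]
    refine lt_of_le_of_lt h2 (ENNReal.mul_lt_top ?_ ?_)
    · refine ENNReal.rpow_lt_top_of_nonneg (by simpa using hpq.nonneg) ?_
      refine hAy.left_ne_top hpq.lt hL.const_ne_top (hLy.pow_const _) (fun x => ?_) hI
      simp [ENNReal.rpow_eq_zero_iff, hL.ne_zero, hL.ne_top]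
    · refine ENNReal.rpow_lt_top_of_nonneg (by simpa using hpq.symm.nonneg) ?_
      exact ne_top_of_le_ne_top hy.ne (setLIntegral_le_lintegral _ _)
  -- Only the maximal factor keeps the restriction to `s`, which later gives the Cauchy property;
  -- the other factor is enlarged to the full square function.
  set X := ∫⁻ z, (sqFin s S (maxCoef E f) z ^ (1 / 2 : ℝ)) ^ p * M z with hX
  have hmain : J ≤ X ^ (1 / p) * (C * J) ^ (1 / q) := by
    have hgc : Measurable fun z => (g z : ℂ) := Complex.measurable_ofReal.comp hgm
    set A : (Fin n → ℝ) × (Fin m → ℝ) → ℝ≥0∞ := fun z =>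
      sqFin s S (maxCoef E f) z ^ (1 / 2 : ℝ) with hA
    set B : (Fin n → ℝ) × (Fin m → ℝ) → ℝ≥0∞ := fun z =>
      sqFin s S (coef fun z => (g z : ℂ)) z ^ (1 / 2 : ℝ) with hB
    have hAm : Measurable A := (measurable_sqFin s (measurable_maxCoef hE.countable f)).pow_const _
    have hBm : Measurable B := (measurable_sqFin s (measurable_coef hgc)).pow_const _
    have hhol := ENNReal.lintegral_mul_le_Lp_mul_Lq volume hpq
      (f := fun z => A z * M z ^ (1 / p)) (g := fun z => B z * L z ^ (-(1 / p)))
      (hAm.mul (hM.pow_const _)).aemeasurable (hBm.mul (hLm.pow_const _)).aemeasurable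
    have e2 : ∀ a b : ℝ≥0∞, (a * b ^ (1 / p)) ^ p = a ^ p * b := fun a b => by
      rw [ENNReal.mul_rpow_of_nonneg _ _ hpq.nonneg, ← ENNReal.rpow_mul, one_div_mul_cancel hp0,
        ENNReal.rpow_one]
    have e3 : ∀ a b : ℝ≥0∞, (a * b ^ (-(1 / p))) ^ q = a ^ q * b ^ (1 - q) := fun a b => by
      rw [ENNReal.mul_rpow_of_nonneg _ _ hpq.symm.nonneg, ← ENNReal.rpow_mul,
        show -(1 / p) * q = 1 - q by field_simp; linarith]
    simp only [Pi.mul_apply, e2, e3] at hhol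
    calc J ≤ ∫⁻ z, ENNReal.ofReal (φ z * g z) := by
          refine lintegral_mono fun z => ?_
          simp only
          rw [hφg, ENNReal.ofReal_mul (abs_nonneg _), ← Real.enorm_eq_ofReal_abs,
            ENNReal.ofReal_toReal (hkt z)]
          calc F z ^ p * L z = F z * k z := by
                simp only [hk]
                rw [← mul_assoc]
                congr 1
                conv_lhs => rw [show p = 1 + (p - 1) by ring]
                rw [ENNReal.rpow_add_of_nonneg _ _ zero_le_one hpq.sub_one_pos.le,
                  ENNReal.rpow_one]
            _ ≤ _ := mul_le_mul_left (min_le_left _ _) _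
      _ ≤ ∫⁻ z, A z * B z * ‖ν z‖ₑ :=
          lintegral_phiSum_mul_le hE.countable hν f s hgm hgint hnn
      _ = ∫⁻ z, A z * M z ^ (1 / p) * (B z * L z ^ (-(1 / p))) := by
          refine lintegral_congr fun z => ?_
          rw [hνML]
          ring
      _ ≤ X ^ (1 / p) * (∫⁻ z, B z ^ q * L z ^ (1 - q)) ^ (1 / q) := hhol
      _ ≤ X ^ (1 / p) * (C * J) ^ (1 / q) := by
          have hq1 : 0 ≤ 1 / q := by simpa using hpq.symm.nonneg
          gcongr
          rw [← hkJ]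
          calc ∫⁻ z, B z ^ q * L z ^ (1 - q)
              ≤ ∫⁻ z, (sqFn D S (coef fun z => (g z : ℂ)) z ^ (1 / 2 : ℝ)) ^ q * L z ^ (1 - q) := by
                refine lintegral_mono fun z => ?_
                have := hpq.symm.nonneg
                simp only [hB]
                gcongr
                exact sqFin_le_sqFn _ _ _ _
            _ ≤ C * ∫⁻ z, ‖(g z : ℂ)‖ₑ ^ q * L z ^ (1 - q) := hC _ hgc
            _ = _ := by
                congr 1
                refine lintegral_congr fun z => ?_
                rw [← hgk, ← ofReal_norm, ← ofReal_norm, Complex.norm_real]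
  by_cases hJ0 : J = 0
  · rw [hJ0]
    exact zero_le
  have hJq0 : J ^ (1 / q) ≠ 0 := by simp [ENNReal.rpow_eq_zero_iff, hJ0, hJt]
  have hJqt : J ^ (1 / q) ≠ ∞ :=
    ENNReal.rpow_ne_top_of_nonneg (by simpa using hpq.symm.nonneg) hJt
  have hfinal : J ^ (1 / p) ≤ C ^ (1 / q) * X ^ (1 / p) := by
    have h1 : J ^ (1 / p) * J ^ (1 / q) ≤ C ^ (1 / q) * X ^ (1 / p) * J ^ (1 / q) := by
      rw [← ENNReal.rpow_add _ _ hJ0 hJt, one_div, one_div, hpq.inv_add_inv_eq_one,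
        ENNReal.rpow_one, ← one_div, ← one_div]
      rw [ENNReal.mul_rpow_of_nonneg _ _ (by simpa using hpq.symm.nonneg)] at hmain
      refine hmain.trans (le_of_eq ?_)
      ring
    exact (ENNReal.mul_le_mul_iff_left hJq0 hJqt).1 h1
  have h1 := ENNReal.rpow_le_rpow hfinal hpq.nonneg
  rwa [ENNReal.mul_rpow_of_nonneg _ _ hpq.nonneg, ← ENNReal.rpow_mul, ← ENNReal.rpow_mul,
    ← ENNReal.rpow_mul, one_div_mul_cancel hp0, ENNReal.rpow_one, ENNReal.rpow_one,
    show 1 / q * p = p / q by ring] at h1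

end Duality

end BiParam

namespace BiParam

/-! ### Unconditional convergence from a dominating series. -/

section Unconditional

variable {α ι : Type*} [MeasurableSpace α] [Countable ι]

/-- Dominated convergence, with the full sum as majorant: tails vanish wherever the sum is finite.
Countability of the index set makes the filter of finite subsets countably generated. -/
theorem tendsto_lintegral_tsum_compl_rpow {ρ : Measure α} {a : ι → α → ℝ≥0∞}
    (ha : ∀ i, Measurable (a i)) {r : ℝ} (hr : 0 < r)
    (hfin : ∫⁻ z, (∑' i, a i z) ^ r ∂ρ ≠ ∞) :
    Tendsto (fun s : Finset ι => ∫⁻ z, (∑' i : { i // i ∉ s }, a i z) ^ r ∂ρ) atTop (𝓝 0) := by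
  have h0 : (0 : ℝ≥0∞) = ∫⁻ _ : α, 0 ∂ρ := by simp
  rw [h0]
  have hm : Measurable fun z => (∑' i, a i z) ^ r := (Measurable.tsum ha).pow_const r
  refine tendsto_lintegral_filter_of_dominated_convergence (fun z => (∑' i, a i z) ^ r)
    (Eventually.of_forall fun s => (Measurable.tsum fun i => ha _).pow_const r)
    (Eventually.of_forall fun s => Eventually.of_forall fun z => ?_) hfin ?_
  · exact ENNReal.rpow_le_rpow
      (ENNReal.tsum_comp_le_tsum_of_injective Subtype.val_injective fun i => a i z) hr.le
  · filter_upwards [ae_lt_top hm hfin] with z hz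
    have hz' : ∑' i, a i z ≠ ∞ := by
      rintro h
      rw [h, ENNReal.top_rpow_of_pos hr] at hz
      exact lt_irrefl _ hz
    have := (ENNReal.continuous_rpow_const (y := r)).tendsto 0 |>.comp
      (ENNReal.tendsto_tsum_compl_atTop_zero hz')
    rwa [ENNReal.zero_rpow_of_pos hr] at this

/-- A series whose finite partial sums are controlled by those of a convergent series of
nonnegative functions converges unconditionally in `L^P`. -/
theorem exists_unconditional_sum {κ ρ : Measure α} {P : ℝ≥0∞} [Fact (1 ≤ P)] {G : ι → α → ℝ}
    (hG : ∀ i, Measurable (G i)) {a : ι → α → ℝ≥0∞} (ha : ∀ i, Measurable (a i)) {r t : ℝ}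
    (hr : 0 < r) (ht : 0 < t) {K : ℝ≥0∞} (hK : K ≠ ∞)
    (h : ∀ s : Finset ι, eLpNorm (fun z => ∑ i ∈ s, G i z) P κ ≤
      (K * ∫⁻ z, (∑ i ∈ s, a i z) ^ r ∂ρ) ^ t)
    (hfin : ∫⁻ z, (∑' i, a i z) ^ r ∂ρ ≠ ∞) :
    ∃ φ : α → ℝ, Measurable φ ∧ MemLp φ P κ ∧
      Tendsto (fun s : Finset ι => eLpNorm (fun z => φ z - ∑ i ∈ s, G i z) P κ) atTop (𝓝 0) ∧
      eLpNorm φ P κ ≤ (K * ∫⁻ z, (∑' i, a i z) ^ r ∂ρ) ^ t := by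
  set B := (K * ∫⁻ z, (∑' i, a i z) ^ r ∂ρ) ^ t with hB
  have hBt : B ≠ ∞ := ENNReal.rpow_ne_top_of_nonneg ht.le (ENNReal.mul_ne_top hK hfin)
  have hsB : ∀ s : Finset ι, eLpNorm (fun z => ∑ i ∈ s, G i z) P κ ≤ B := fun s => by
    refine (h s).trans ?_
    rw [hB]
    gcongr
    exact ENNReal.sum_le_tsum s
  have hsm : ∀ s : Finset ι, MemLp (fun z => ∑ i ∈ s, G i z) P κ := fun s =>
    ⟨(Finset.measurable_sum _ fun i _ => hG i).aestronglyMeasurable,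
      (hsB s).trans_lt hBt.lt_top⟩
  have hGm : ∀ i, MemLp (G i) P κ := fun i => by simpa using hsm {i}
  have hcoe : ∀ s : Finset ι, (∑ i ∈ s, (hGm i).toLp (G i) : Lp ℝ P κ) =ᵐ[κ]
      fun z => ∑ i ∈ s, G i z := by
    intro s
    have h2 : ∀ᵐ z ∂κ, ∀ i : ι, ((hGm i).toLp (G i)) z = G i z :=
      ae_all_iff.2 fun i => (hGm i).coeFn_toLp
    filter_upwards [Lp.coeFn_finsetSum s fun i => (hGm i).toLp (G i), h2] with z hz hz2
    rw [hz, Finset.sum_apply]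
    exact Finset.sum_congr rfl fun i _ => hz2 i
  have hnorm : ∀ s : Finset ι, ‖∑ i ∈ s, (hGm i).toLp (G i)‖ =
      (eLpNorm (fun z => ∑ i ∈ s, G i z) P κ).toReal := fun s => by
    rw [Lp.norm_def, eLpNorm_congr_ae (hcoe s)]
  have hsum : Summable fun i => (hGm i).toLp (G i) := by
    rw [summable_iff_vanishing_norm]
    intro ε hε
    have h1 : Tendsto (fun s : Finset ι =>
        (K * ∫⁻ z, (∑' i : { i // i ∉ s }, a i z) ^ r ∂ρ) ^ t) atTop (𝓝 0) := by
      have h2 := ENNReal.Tendsto.const_mul (tendsto_lintegral_tsum_compl_rpow ha hr hfin)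
        (Or.inr hK)
      have h3 := (ENNReal.continuous_rpow_const (y := t)).tendsto _ |>.comp h2
      rwa [mul_zero, ENNReal.zero_rpow_of_pos ht] at h3
    -- Cauchy criterion: a finite sum over indices outside `s` is controlled by the tail of the
    -- dominating series beyond `s`.
    obtain ⟨s, hs⟩ := (h1.eventually (gt_mem_nhds (ENNReal.ofReal_pos.2 hε))).exists
    refine ⟨s, fun u hu => ?_⟩
    rw [hnorm]
    refine ENNReal.toReal_lt_of_lt_ofReal (lt_of_le_of_lt ((h u).trans ?_) hs)
    gcongr with z
    have hus : ∀ i ∈ u, i ∉ s := fun i hi his => Finset.disjoint_left.1 hu hi his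
    classical
    calc ∑ i ∈ u, a i z = ∑ i ∈ u.subtype (· ∉ s), a i z :=
          (Finset.sum_subtype_of_mem (fun i => a i z) hus).symm
      _ ≤ _ := ENNReal.sum_le_tsum _
  obtain ⟨φ, hφ⟩ := hsum
  have htend : Tendsto (fun s : Finset ι => eLpNorm (fun z => φ z - ∑ i ∈ s, G i z) P κ) atTop
      (𝓝 0) := by
    have h1 := (Lp.tendsto_Lp_iff_tendsto_eLpNorm' _ _).1 hφ
    rw [SummationFilter.unconditional_filter] at h1
    refine h1.congr fun s => ?_
    rw [eLpNorm_sub_comm]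
    refine eLpNorm_congr_ae ?_
    filter_upwards [hcoe s] with z hz
    rw [Pi.sub_apply, hz]
  refine ⟨φ, (Lp.stronglyMeasurable φ).measurable, Lp.memLp φ, htend, ?_⟩
  have h1 : Tendsto (fun s : Finset ι => eLpNorm (fun z => φ z - ∑ i ∈ s, G i z) P κ + B) atTop
      (𝓝 (0 + B)) := htend.add tendsto_const_nhds
  rw [zero_add] at h1
  refine ge_of_tendsto' h1 fun s => ?_
  calc eLpNorm φ P κ
      = eLpNorm ((fun z => φ z - ∑ i ∈ s, G i z) + fun z => ∑ i ∈ s, G i z) P κ := by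
        congr 1
        ext z
        simp
    _ ≤ _ := (eLpNorm_add_le ((Lp.aestronglyMeasurable φ).sub (hsm s).1) (hsm s).1
        (Fact.out : 1 ≤ P)).trans (add_le_add_right (hsB s) _)

end Unconditional

/-! ### Existence and norm of φ for Borel data. -/

section Construction

variable {n m : ℕ}

theorem eLpNorm_wMeasure {F : Type*} [NormedAddCommGroup F] {p : ℝ} (hp : 0 < p)
    {w : (Fin n → ℝ) × (Fin m → ℝ) → ℝ} (hw : Measurable w)
    {g : (Fin n → ℝ) × (Fin m → ℝ) → F} (hg : Measurable fun z => ‖g z‖ₑ) :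
    eLpNorm g (ENNReal.ofReal p) (wMeasure w) =
      (∫⁻ z, ‖g z‖ₑ ^ p * ENNReal.ofReal (w z)) ^ (1 / p) := by
  rw [eLpNorm_eq_lintegral_rpow_enorm_toReal (by simpa using hp) ENNReal.ofReal_ne_top,
    ENNReal.toReal_ofReal hp.le, wMeasure,
    lintegral_withDensity_eq_lintegral_mul _ hw.ennreal_ofReal (hg.pow_const _)]
  simp only [Pi.mul_apply, mul_comm]

theorem enorm_bloomWeight {p : ℝ} {μ lam : (Fin n → ℝ) × (Fin m → ℝ) → ℝ} (hμ : ∀ z, 0 < μ z)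
    (hlam : ∀ z, 0 < lam z) (z : (Fin n → ℝ) × (Fin m → ℝ)) :
    ‖bloomWeight p μ lam z‖ₑ =
      ENNReal.ofReal (μ z) ^ (1 / p) * ENNReal.ofReal (lam z) ^ (-(1 / p)) := by
  have h1 := Real.rpow_pos_of_pos (hμ z) (1 / p)
  have h2 := Real.rpow_pos_of_pos (hlam z) (-(1 / p))
  rw [bloomWeight, Real.enorm_eq_ofReal (mul_pos h1 h2).le, ENNReal.ofReal_mul h1.le,
    ENNReal.ofReal_rpow_of_pos (hμ z), ENNReal.ofReal_rpow_of_pos (hlam z)]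

theorem measurable_bloomWeight {p : ℝ} {μ lam : (Fin n → ℝ) × (Fin m → ℝ) → ℝ}
    (hμ : Measurable μ) (hlam : Measurable lam) : Measurable (bloomWeight p μ lam) :=
  (hμ.pow_const _).mul (hlam.pow_const _)

/-- Existence of `φ^{ν,1} f` and its `L^p(lam)` bound, for Borel measurable data. -/
theorem exists_isPhi (hn : 0 < n) (hm : 0 < m) {p : ℝ} (hp : 1 < p) (Q Q' : ℝ≥0) : ∃ C : ℝ≥0,
    ∀ D : Set (Cube n), ∀ E : Set (Cube m), IsDyadicGrid D → IsDyadicGrid E →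
    ∀ S : Cube n → Finset (Fin n → Fin 2), (∀ I, 0 ∉ S I) →
    ∀ μ lam : (Fin n → ℝ) × (Fin m → ℝ) → ℝ, Measurable μ → Measurable lam →
    (∀ z, 0 < μ z) → (∀ z, 0 < lam z) →
    RectAp p p.conjExponent Q (fun z => ENNReal.ofReal (μ z)) →
    RectAp p p.conjExponent Q' (fun z => ENNReal.ofReal (lam z)) →
    ∀ f : (Fin n → ℝ) × (Fin m → ℝ) → ℂ, Measurable f →
    eLpNorm f (ENNReal.ofReal p) (wMeasure μ) ≠ ∞ →
      (∃ φ : (Fin n → ℝ) × (Fin m → ℝ) → ℝ, Measurable φ ∧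
        IsPhi D E S p lam (bloomWeight p μ lam) f φ ∧
        eLpNorm φ (ENNReal.ofReal p) (wMeasure lam) ≤
          C * eLpNorm f (ENNReal.ofReal p) (wMeasure μ)) ∧
      ∫⁻ z, (sqFn D S (maxCoef E f) z ^ (1 / 2 : ℝ)) ^ p * ENNReal.ofReal (μ z) ≠ ∞ := by
  have hpq : p.HolderConjugate p.conjExponent := Real.HolderConjugate.conjExponent hp
  set q := p.conjExponent
  obtain ⟨C₁, hC₁⟩ := exists_lintegral_sqFn_rpow_le hn hm hpq Q
  -- The dual weight has A_q constant Q'^{q-1}.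
  obtain ⟨C₂, hC₂⟩ := exists_lintegral_sqFn_rpow_le hn hm hpq.symm (Q' ^ (q - 1))
  have hp0 := hpq.pos
  refine ⟨(C₂ ^ (p / q) * C₁) ^ (1 / p), fun D E hD hE S hS μ lam hμm hlm hμ0 hl0 hμ hl f hf hft =>
    ?_⟩
  set M := fun z => ENNReal.ofReal (μ z)
  set L := fun z => ENNReal.ofReal (lam z)
  have hDc : Countable D := hD.countable.to_subtype
  have hfnorm := eLpNorm_wMeasure hp0 hμm hf.enorm
  have hft' : ∫⁻ z, ‖f z‖ₑ ^ p * M z ≠ ∞ := by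
    rw [hfnorm] at hft
    intro h
    rw [show ∫⁻ z, ‖f z‖ₑ ^ p * ENNReal.ofReal (μ z) = ∞ from h,
      ENNReal.top_rpow_of_pos (by positivity)] at hft
    exact hft rfl
  have hmax := (hC₁ D E hD hE M hμ.measurable hμ.ne_zero hμ.ne_top
    (hμ.fiberAp hp hD.countable hE.countable) f hf S hS).2
  have hmaxt := ne_top_of_le_ne_top (ENNReal.mul_ne_top ENNReal.coe_ne_top hft') hmax
  refine ⟨?_, hmaxt⟩
  have hdual : FiberAp D E q p (Q' ^ (q - 1) : ℝ≥0) (fun z => L z ^ (1 - q)) := by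
    rw [ENNReal.coe_rpow_of_nonneg _ hpq.symm.sub_one_pos.le]
    exact (hl.fiberAp hp hD.countable hE.countable).symm hpq
  have hνm := measurable_bloomWeight (p := p) hμm hlm
  set ν := bloomWeight p μ lam
  have hfac : Fact (1 ≤ ENNReal.ofReal p) := ⟨by simpa using hp.le⟩
  have hsum : ∀ s : Finset D, ∫⁻ z, ‖phiSum E S ν f s z‖ₑ ^ p * L z ≤
      C₂ ^ (p / q) * ∫⁻ z, (sqFin s S (maxCoef E f) z ^ (1 / 2 : ℝ)) ^ p * M z := fun s =>
    lintegral_phiSum_rpow_le hD hE hpq hμ.measurable hl (S := S) (fun g hg =>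
      (hC₂ D E hD hE (fun z => L z ^ (1 - q)) (hl.measurable.pow_const _)
        (fun z => by simp [ENNReal.rpow_eq_zero_iff, hl.ne_zero z, hl.ne_top z])
        (fun z => by simp [ENNReal.rpow_eq_top_iff, hl.ne_zero z, hl.ne_top z])
        hdual g hg S hS).1) hνm (enorm_bloomWeight hμ0 hl0) f s
  have hrw : ∀ u : (Fin n → ℝ) × (Fin m → ℝ) → ℝ≥0∞, Measurable u →
      ∫⁻ z, (u z ^ (1 / 2 : ℝ)) ^ p * M z = ∫⁻ z, u z ^ (1 / 2 * p) ∂(wMeasure μ) := by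
    intro u hu
    rw [wMeasure, lintegral_withDensity_eq_lintegral_mul _ hμ.measurable (hu.pow_const _)]
    refine lintegral_congr fun z => ?_
    rw [Pi.mul_apply, mul_comm, ENNReal.rpow_mul]
  have hsq := measurable_sqFn hD.countable (S := S) (measurable_maxCoef hE.countable f)
  have ha : ∀ I : D, Measurable fun z : (Fin n → ℝ) × (Fin m → ℝ) => ∑ η ∈ S I,
      I.1.toSet.indicator (fun _ => (volume I.1.toSet)⁻¹) z.1 * maxCoef E f I η z.2 ^ 2 := fun I =>
    Finset.measurable_sum _ fun η _ => (measurable_cubeDensity I.1).mul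
      (((measurable_maxCoef hE.countable f I η).comp measurable_snd).pow_const 2)
  have hCt : (C₂ : ℝ≥0∞) ^ (p / q) ≠ ∞ := ENNReal.rpow_ne_top_of_nonneg
    (div_nonneg hp0.le hpq.symm.nonneg) ENNReal.coe_ne_top
  -- The dominating series is the squared maximal square function; r = p/2 because its square root
  -- enters to the power p.
  obtain ⟨φ, h0, h1, h2, h3⟩ := exists_unconditional_sum (κ := wMeasure lam) (ρ := wMeasure μ)
    (P := ENNReal.ofReal p) (ι := D) (G := fun I z => ∑ η ∈ S I, phiTerm E ν f I η z)
    (fun I => Finset.measurable_sum _ fun η _ => measurable_phiTerm hE.countable hνm f I η)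
    ha (r := 1 / 2 * p) (t := 1 / p) (by positivity) (by positivity) hCt
    (fun s => by
      refine (eLpNorm_wMeasure hp0 hlm (measurable_phiSum hE.countable hνm f S s).enorm).le.trans ?_
      refine ENNReal.rpow_le_rpow ((hsum s).trans (le_of_eq ?_)) (by positivity)
      rw [hrw _ (measurable_sqFin s (measurable_maxCoef hE.countable f))]
      rfl)
    (by
      have := hrw _ hsq
      rw [this] at hmaxt
      exact hmaxt)
  refine ⟨φ, h0, ⟨h1, h2⟩, h3.trans ?_⟩
  have h4 : ∫⁻ z, (∑' I : D, ∑ η ∈ S I, I.1.toSet.indicator (fun _ => (volume I.1.toSet)⁻¹) z.1 *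
      maxCoef E f I η z.2 ^ 2) ^ (1 / 2 * p) ∂(wMeasure μ) ≤ C₁ * ∫⁻ z, ‖f z‖ₑ ^ p * M z := by
    rw [hrw _ hsq] at hmax
    exact hmax
  rw [hfnorm, ENNReal.coe_rpow_of_nonneg _ (by positivity), ENNReal.coe_mul,
    ENNReal.coe_rpow_of_nonneg _ (div_nonneg hp0.le hpq.symm.nonneg),
    ← ENNReal.mul_rpow_of_nonneg _ _ (by positivity), mul_assoc]
  gcongr

end Construction

end BiParam

namespace BiParam

/-! ### Orthonormality of the Haar system. -/

section Orthonormality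

variable {n m : ℕ}

/-- The signs are the characters of (ℤ/2)^n, and addition in `Fin 2` is modulo 2. Orthogonality on
one cube thereby reduces to mean zero. -/
theorem haarSign_add (η η' ε : Fin n → Fin 2) :
    haarSign η ε * haarSign η' ε = haarSign (η + η') ε := by
  rw [haarSign, haarSign, haarSign, ← Finset.prod_mul_distrib]
  refine Finset.prod_congr rfl fun i _ => ?_
  rw [Pi.add_apply]
  generalize η i = a
  generalize η' i = b
  generalize ε i = c
  fin_cases a <;> fin_cases b <;> fin_cases c <;> simp

theorem haar_mul_haar (I : Cube n) (η η' : Fin n → Fin 2) (x : Fin n → ℝ) :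
    haar I η x * haar I η' x = (√I.side)⁻¹ ^ n * haar I (η + η') x := by
  by_cases hx : x ∈ I.toSet
  · obtain ⟨ε, hε⟩ := Cube.exists_mem_child hx
    rw [haar_eq_of_mem_child η ε hε, haar_eq_of_mem_child η' ε hε,
      haar_eq_of_mem_child (η + η') ε hε, ← haarSign_add]
    ring
  · rw [haar_eq_zero η hx, haar_eq_zero (η + η') hx]
    ring

theorem integrable_haar (I : Cube n) (η : Fin n → Fin 2) : Integrable (haar I η) := by
  have h := integrable_mul_haar (I := I) (f := fun _ => 1)
    (integrableOn_const I.volume_ne_top) η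
  exact h.re.congr (Eventually.of_forall fun x => by simp)

theorem integrable_haar_mul_haar (I I' : Cube n) (η η' : Fin n → Fin 2) :
    Integrable fun x => haar I η x * haar I' η' x :=
  (integrable_haar I' η').bdd_mul (measurable_haar I η).aestronglyMeasurable
    (Eventually.of_forall fun x => abs_haar_le I η x)

theorem integral_haar_eq_zero (I : Cube n) {η : Fin n → Fin 2} (hη : η ≠ 0) :
    ∫ x, haar I η x = 0 := by
  have h0 : ∫ x, haar I η x = ∫ x in I.toSet, haar I η x :=
    (setIntegral_eq_integral_of_forall_compl_eq_zero fun x hx => haar_eq_zero η hx).symm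
  rw [h0, I.integral_eq_sum_child (integrable_haar I η).integrableOn]
  have h1 : ∀ ε, ∫ x in (I.child ε).toSet, haar I η x =
      (volume.real I.toSet / 2 ^ n * (√I.side)⁻¹ ^ n) * haarSign η ε := by
    intro ε
    rw [setIntegral_congr_fun (I.child ε).measurableSet_toSet
      (fun x hx => haar_eq_of_mem_child η ε hx), setIntegral_const, I.volume_real_child ε,
      smul_eq_mul]
    field_simp
  simp only [h1]
  rw [← Finset.mul_sum, sum_haarSign hη, mul_zero]

theorem integral_haar_mul_haar_self (I : Cube n) (η : Fin n → Fin 2) :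
    ∫ x, haar I η x * haar I η x = 1 := by
  have h0 : ∫ x, haar I η x * haar I η x = ∫ x in I.toSet, (I.side ^ n)⁻¹ := by
    rw [← setIntegral_eq_integral_of_forall_compl_eq_zero (s := I.toSet)
      (fun x hx => by rw [haar_eq_zero η hx, mul_zero])]
    refine setIntegral_congr_fun I.measurableSet_toSet fun x hx => ?_
    rw [← sq_haar_of_mem η hx, sq]
  rw [h0, setIntegral_const, I.volume_real, smul_eq_mul,
    mul_inv_cancel₀ (pow_pos I.side_pos n).ne']

theorem integral_haar_mul_haar_of_ne (I : Cube n) {η η' : Fin n → Fin 2} (h : η ≠ η') :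
    ∫ x, haar I η x * haar I η' x = 0 := by
  simp only [haar_mul_haar]
  rw [integral_const_mul, integral_haar_eq_zero I, mul_zero]
  intro h0
  refine h (funext fun i => ?_)
  have hi : η i + η' i = 0 := congrFun h0 i
  omega

/-- A different cube of no larger side that meets I has at most half its side, so it lies in one
child of I. There the Haar function of I is constant, and the other one has mean zero. -/
theorem integral_haar_mul_haar_of_side_le {D : Set (Cube n)} (hD : IsDyadicGrid D) (hn : 0 < n)
    {I I' : Cube n} (hI : I ∈ D) (hI' : I' ∈ D) (hne : I' ≠ I) (hs : I'.side ≤ I.side)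
    (η : Fin n → Fin 2) {η' : Fin n → Fin 2} (hη' : η' ≠ 0) :
    ∫ x, haar I η x * haar I' η' x = 0 := by
  rcases hD.subset_or_disjoint hn hI' hI hs with hsub | hdisj
  · have hc := hsub I'.corner_mem
    obtain ⟨ε, hε⟩ := Cube.exists_mem_child hc
    have hs2 : I'.side ≤ (I.child ε).side := by
      obtain ⟨k, hk⟩ := hD.side_eq I hI
      obtain ⟨k', hk'⟩ := hD.side_eq I' hI'
      have hk1 : k' ≤ k := by
        rw [hk, hk'] at hs
        exact (zpow_le_zpow_iff_right₀ (by norm_num)).1 hs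
      have hk2 : k' ≠ k := fun h => hne (hD.eq_of_mem hI' hI (by rw [hk, hk', h]) I'.corner_mem hc)
      change I'.side ≤ I.side / 2
      rw [hk, hk', div_eq_mul_inv, ← zpow_sub_one₀ (by norm_num)]
      exact zpow_le_zpow_right₀ (by norm_num) (by omega)
    have hsub2 := hD.subset_of_mem hn hI' (hD.child_mem hn hI ε) hs2 I'.corner_mem hε
    have h1 : ∀ x, haar I η x * haar I' η' x =
        ((√I.side)⁻¹ ^ n * haarSign η ε) * haar I' η' x := by
      intro x
      by_cases hx : x ∈ I'.toSet
      · rw [haar_eq_of_mem_child η ε (hsub2 hx)]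
      · rw [haar_eq_zero η' hx, mul_zero, mul_zero]
    simp only [h1]
    rw [integral_const_mul, integral_haar_eq_zero I' hη', mul_zero]
  · have h1 : ∀ x, haar I η x * haar I' η' x = 0 := by
      intro x
      by_cases hx : x ∈ I'.toSet
      · rw [haar_eq_zero η (Set.disjoint_left.1 hdisj hx), zero_mul]
      · rw [haar_eq_zero η' hx, mul_zero]
    simp [h1]

/-- Orthogonality of the cancellative Haar functions on different cubes. -/
theorem integral_haar_mul_haar_of_cube_ne {D : Set (Cube n)} (hD : IsDyadicGrid D) (hn : 0 < n)
    {I I' : Cube n} (hI : I ∈ D) (hI' : I' ∈ D) (hne : I' ≠ I)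
    {η η' : Fin n → Fin 2} (hη : η ≠ 0) (hη' : η' ≠ 0) :
    ∫ x, haar I η x * haar I' η' x = 0 := by
  rcases le_total I'.side I.side with hs | hs
  · exact integral_haar_mul_haar_of_side_le hD hn hI hI' hne hs η hη'
  · have := integral_haar_mul_haar_of_side_le hD hn hI' hI hne.symm hs η' hη
    simpa only [mul_comm] using this

end Orthonormality

/-! ### Pairing φ with a Haar function times an averaged indicator. -/

section Pairing

variable {n m : ℕ} {D : Set (Cube n)} {E : Set (Cube m)} {S : Cube n → Finset (Fin n → Fin 2)}
  {ν : (Fin n → ℝ) × (Fin m → ℝ) → ℝ} {f : (Fin n → ℝ) × (Fin m → ℝ) → ℂ}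

/-- The function `h_I^η ⊗ 1_J / |J|`. -/
noncomputable def testFn (I : Cube n) (η : Fin n → Fin 2) (J : Cube m)
    (z : (Fin n → ℝ) × (Fin m → ℝ)) : ℝ :=
  haar I η z.1 * J.toSet.indicator (fun _ => (volume.real J.toSet)⁻¹) z.2

theorem measurable_testFn (I : Cube n) (η : Fin n → Fin 2) (J : Cube m) :
    Measurable (testFn I η J) :=
  ((measurable_haar I η).comp measurable_fst).mul
    ((measurable_const.indicator J.measurableSet_toSet).comp measurable_snd)

theorem enorm_testFn_le (I : Cube n) (η : Fin n → Fin 2) (J : Cube m)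
    (z : (Fin n → ℝ) × (Fin m → ℝ)) : ‖testFn I η J z‖ₑ ≤
      (rect I J).indicator
        (fun _ => ENNReal.ofReal ((√I.side)⁻¹ ^ n * (volume.real J.toSet)⁻¹)) z := by
  have hJ := J.volume_real_pos
  by_cases h1 : z.1 ∈ I.toSet
  · by_cases h2 : z.2 ∈ J.toSet
    · have hz : z ∈ rect I J := ⟨h1, h2⟩
      rw [Set.indicator_of_mem hz, testFn, Set.indicator_of_mem h2, Real.enorm_eq_ofReal_abs,
        abs_mul, abs_haar_of_mem η h1, abs_of_pos (inv_pos.2 hJ)]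
    · simp [testFn, h2]
  · simp [testFn, haar_eq_zero η h1]

/-- Haar coefficients of a finite partial sum of `φ^{ν,1} f`, averaged over a cube. -/
theorem integral_phiSum_mul_testFn (hD : IsDyadicGrid D) (hn : 0 < n) (hS : ∀ I, 0 ∉ S I)
    {s : Finset D} {I : D} (hI : I ∈ s) {η : Fin n → Fin 2} (hη : η ∈ S I) {J : Cube m}
    (hint : Integrable fun z => phiSum E S ν f s z * testFn I η J z) :
    IntegrableOn (fun y => (dyadicMax E (pair₁ f (haar I η)) y).toReal * avg₁ ν I y) J.toSet ∧
    ∫ z, phiSum E S ν f s z * testFn I η J z = (volume.real J.toSet)⁻¹ *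
      ∫ y in J.toSet, (dyadicMax E (pair₁ f (haar I η)) y).toReal * avg₁ ν I y := by
  classical
  set B : Cube n → (Fin n → Fin 2) → (Fin m → ℝ) → ℝ := fun I η y =>
    (dyadicMax E (pair₁ f (haar I η)) y).toReal * avg₁ ν I y with hB
  set c := (volume.real J.toSet)⁻¹ with hc
  have hc0 : c ≠ 0 := inv_ne_zero J.volume_real_pos.ne'
  have h0 : ∀ I' : D, ∀ η' ∈ S I', η' ≠ 0 := fun I' η' h e => hS I' (e ▸ h)
  have hinner : ∀ y, ∫ x, phiSum E S ν f s (x, y) * testFn I η J (x, y) =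
      J.toSet.indicator (fun y => c * B I η y) y := by
    intro y
    have e : ∀ x, phiSum E S ν f s (x, y) * testFn I η J (x, y) =
        J.toSet.indicator (fun _ => c) y *
          ∑ I' ∈ s, ∑ η' ∈ S I', B I' η' y * (haar I η x * haar I' η' x) := by
      intro x
      simp only [phiSum, testFn, phiTerm, Finset.sum_mul, Finset.mul_sum, hB]
      refine Finset.sum_congr rfl fun I' _ => Finset.sum_congr rfl fun η' _ => ?_
      ring
    have hi : ∀ (I' : Cube n) η', Integrable fun x => B I' η' y * (haar I η x * haar I' η' x) :=
      fun I' η' => (integrable_haar_mul_haar _ _ _ _).const_mul _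
    simp only [e]
    rw [integral_const_mul,
      integral_finsetSum _ fun I' _ => integrable_finsetSum (S I'.1) fun η' _ => hi I'.1 η']
    rw [Finset.sum_eq_single_of_mem I hI, integral_finsetSum _ fun η' _ => hi I η',
      Finset.sum_eq_single_of_mem η hη, integral_const_mul, integral_haar_mul_haar_self, mul_one]
    · by_cases hy : y ∈ J.toSet <;> simp [hy]
    · intro η' _ hne
      rw [integral_const_mul, integral_haar_mul_haar_of_ne _ hne.symm, mul_zero]
    · intro I' _ hne
      rw [integral_finsetSum _ fun η' _ => hi I' η']
      refine Finset.sum_eq_zero fun η' hη' => ?_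
      rw [integral_const_mul, integral_haar_mul_haar_of_cube_ne hD hn I.2 I'.2
        (fun h => hne (Subtype.ext h)) (h0 I η hη) (h0 I' η' hη'), mul_zero]
  -- Integrability of the single coefficient on J is read off from Fubini, since the inner integral
  -- has already isolated it.
  have h1 := hint.integral_prod_right
  simp only [hinner] at h1
  rw [integrable_indicator_iff J.measurableSet_toSet] at h1
  have h2 : IntegrableOn (B I η) J.toSet := by
    have := h1.const_mul c⁻¹
    simp only [inv_mul_cancel_left₀ hc0] at this
    exact this
  refine ⟨h2, ?_⟩
  rw [Measure.volume_eq_prod, integral_prod_symm _ hint]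
  simp only [hinner]
  rw [integral_indicator J.measurableSet_toSet, integral_const_mul]

/-- The test function lies in the dual space L^q(λ^{1-q}), so the pairing is continuous along the
partial sums, and it is constant as soon as they contain I. -/
theorem IsPhi.integral_mul_testFn {p q : ℝ} (hpq : p.HolderConjugate q) {Q : ℝ≥0∞}
    {lam φ : (Fin n → ℝ) × (Fin m → ℝ) → ℝ} (hφ : IsPhi D E S p lam ν f φ) (hφm : Measurable φ)
    (hlm : Measurable lam) (hl : RectAp p q Q (fun z => ENNReal.ofReal (lam z)))
    (hν : Measurable ν) (hD : IsDyadicGrid D) (hE : IsDyadicGrid E) (hn : 0 < n)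
    (hS : ∀ I, 0 ∉ S I) {I : Cube n} (hI : I ∈ D) {η : Fin n → Fin 2} (hη : η ∈ S I)
    (J : Cube m) :
    IntegrableOn (fun y => (dyadicMax E (pair₁ f (haar I η)) y).toReal * avg₁ ν I y) J.toSet ∧
    ∫ z, φ z * testFn I η J z = (volume.real J.toSet)⁻¹ *
      ∫ y in J.toSet, (dyadicMax E (pair₁ f (haar I η)) y).toReal * avg₁ ν I y := by
  have hp0 := hpq.pos
  set L := fun z => ENNReal.ofReal (lam z)
  have hkm := measurable_testFn I η J
  set k := testFn I η J
  set K := (∫⁻ z, ‖k z‖ₑ ^ q * L z ^ (1 - q)) ^ (1 / q) with hK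
  have hKt : K ≠ ∞ := by
    refine ENNReal.rpow_ne_top_of_nonneg (by simpa using hpq.symm.nonneg) ?_
    set c := ENNReal.ofReal ((√I.side)⁻¹ ^ n * (volume.real J.toSet)⁻¹)
    refine ne_top_of_le_ne_top (b := c ^ q * ∫⁻ z in rect I J, L z ^ (1 - q)) (ENNReal.mul_ne_top
      (ENNReal.rpow_ne_top_of_nonneg hpq.symm.nonneg ENNReal.ofReal_ne_top)
      (hl.dual_ne_top I J)) ?_
    rw [← lintegral_const_mul _ (hl.measurable.pow_const _),
      ← lintegral_indicator (measurableSet_rect I J)]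
    refine lintegral_mono fun z => ?_
    have h1 := enorm_testFn_le I η J z
    by_cases hz : z ∈ rect I J
    · rw [Set.indicator_of_mem hz] at h1 ⊢
      gcongr
      exact hpq.symm.nonneg
    · rw [Set.indicator_of_notMem hz] at h1
      have h3 : ‖k z‖ₑ = 0 := le_antisymm h1 zero_le
      rw [h3, ENNReal.zero_rpow_of_pos hpq.symm.pos, zero_mul]
      exact zero_le
  have hhol : ∀ g : (Fin n → ℝ) × (Fin m → ℝ) → ℝ, Measurable g →
      ∫⁻ z, ‖g z * k z‖ₑ ≤ eLpNorm g (ENNReal.ofReal p) (wMeasure lam) * K := by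
    intro g hg
    rw [eLpNorm_wMeasure hp0 hlm hg.enorm]
    simp only [enorm_mul]
    exact lintegral_mul_le_weight hpq hl.measurable hl.ne_zero hl.ne_top hg.enorm hkm.enorm
  have hint : ∀ g : (Fin n → ℝ) × (Fin m → ℝ) → ℝ, Measurable g →
      eLpNorm g (ENNReal.ofReal p) (wMeasure lam) ≠ ∞ → Integrable fun z => g z * k z :=
    fun g hg hgt => ⟨(hg.mul hkm).aestronglyMeasurable,
      (hhol g hg).trans_lt (ENNReal.mul_lt_top hgt.lt_top hKt.lt_top)⟩
  have hsm : ∀ s : Finset D, Measurable (phiSum E S ν f s) := measurable_phiSum hE.countable hν f S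
  have hfφ := hint φ hφm hφ.memLp.2.ne
  -- Finiteness of the error norm is recorded as well: it shows that the product of the partial sum
  -- with the test function is integrable.
  have hev : ∀ᶠ s : Finset D in atTop, ⟨I, hI⟩ ∈ s ∧
      eLpNorm (fun z => φ z - phiSum E S ν f s z) (ENNReal.ofReal p) (wMeasure lam) ≠ ∞ := by
    refine (eventually_ge_atTop {⟨I, hI⟩}).and ?_ |>.mono fun s hs =>
      ⟨Finset.singleton_subset_iff.1 hs.1, hs.2⟩
    exact (hφ.tendsto.eventually (gt_mem_nhds ENNReal.zero_lt_top)).mono fun s hs => hs.ne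
  have hsub : ∀ s : Finset D,
      eLpNorm (fun z => φ z - phiSum E S ν f s z) (ENNReal.ofReal p) (wMeasure lam) ≠ ∞ →
      Integrable fun z => phiSum E S ν f s z * k z := by
    intro s hs
    have h1 := hfφ.sub (hint _ (hφm.sub (hsm s)) hs)
    refine h1.congr (Eventually.of_forall fun z => ?_)
    simp only [Pi.sub_apply]
    ring
  obtain ⟨s₀, hs₀, hs₀'⟩ := hev.exists
  refine ⟨(integral_phiSum_mul_testFn hD hn hS hs₀ hη (hsub s₀ hs₀')).1, ?_⟩
  have hlim : Tendsto (fun s : Finset D => ∫ z, phiSum E S ν f s z * k z) atTop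
      (𝓝 (∫ z, φ z * k z)) := by
    rw [tendsto_iff_edist_tendsto_0]
    have h1 := ENNReal.Tendsto.mul_const (b := K) hφ.tendsto (Or.inr hKt)
    rw [zero_mul] at h1
    refine tendsto_of_tendsto_of_tendsto_of_le_of_le' tendsto_const_nhds h1
      (Eventually.of_forall fun _ => zero_le) (hev.mono fun s hs => ?_)
    rw [edist_comm, edist_eq_enorm_sub, ← integral_sub hfφ (hsub s hs.2)]
    refine (enorm_integral_le_lintegral_enorm _).trans ?_
    simp only [← sub_mul]
    exact hhol _ (hφm.sub (hsm s))
  refine tendsto_nhds_unique hlim (tendsto_const_nhds.congr' (hev.mono fun s hs => ?_))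
  exact (integral_phiSum_mul_testFn hD hn hS hs.1 hη (hsub s hs.2)).2.symm

end Pairing

end BiParam

namespace BiParam

/-! ### The stopping argument for weighted oscillation in one variable. -/

section Oscillation

variable {m : ℕ}

theorem enorm_average_sub_mul_le {a : (Fin m → ℝ) → ℂ} (J : Cube m)
    (ha : IntegrableOn a J.toSet) (c : ℂ) :
    ‖(⨍ y in J.toSet, a y) - c‖ₑ * volume J.toSet ≤ ∫⁻ y in J.toSet, ‖a y - c‖ₑ := by
  have hc : IntegrableOn (fun _ => c) J.toSet := integrableOn_const J.volume_ne_top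
  have h1 : (volume.real J.toSet : ℂ) * ((⨍ y in J.toSet, a y) - c) =
      ∫ y in J.toSet, (a y - c) := by
    rw [integral_sub ha hc, setIntegral_const, setAverage_eq, mul_sub, Complex.real_smul,
      Complex.real_smul, Complex.ofReal_inv, mul_inv_cancel_left₀]
    exact_mod_cast J.volume_real_pos.ne'
  calc ‖(⨍ y in J.toSet, a y) - c‖ₑ * volume J.toSet
      = ‖(volume.real J.toSet : ℂ) * ((⨍ y in J.toSet, a y) - c)‖ₑ := by
        rw [enorm_mul, mul_comm]
        congr 1
        rw [← ofReal_norm, Complex.norm_real, Real.norm_of_nonneg J.volume_real_pos.le,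
          Measure.real, ENNReal.ofReal_toReal J.volume_ne_top]
    _ ≤ _ := by
        rw [h1]
        exact enorm_integral_le_lintegral_enorm _

/-- The cubes on which `a` has a large mean oscillation relative to the cube `J`. -/
def stopSet (E : Set (Cube m)) (J : Cube m) (g : (Fin m → ℝ) → ℝ≥0∞) (t : ℝ≥0∞) :
    Set (Fin m → ℝ) :=
  ⋃ J' ∈ {J' ∈ E | J'.toSet ⊆ J.toSet ∧ t * volume J'.toSet < ∫⁻ y in J'.toSet, g y}, J'.toSet

theorem measurableSet_stopSet {E : Set (Cube m)} (hE : E.Countable) (J : Cube m)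
    (g : (Fin m → ℝ) → ℝ≥0∞) (t : ℝ≥0∞) : MeasurableSet (stopSet E J g t) :=
  MeasurableSet.biUnion (hE.mono fun _ h => h.1) fun J' _ => J'.measurableSet_toSet

theorem stopSet_subset {E : Set (Cube m)} (J : Cube m) (g : (Fin m → ℝ) → ℝ≥0∞) (t : ℝ≥0∞) :
    stopSet E J g t ⊆ J.toSet :=
  Set.iUnion₂_subset fun _ h => h.2.1

/-- The threshold is twice the mean of g over J, so the weak type inequality bounds the measure of
the stopped set by half of |J|. -/
theorem volume_le_two_mul_diff_stopSet {E : Set (Cube m)} (hE : IsDyadicGrid E) (hm : 0 < m)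
    (J : Cube m) {g : (Fin m → ℝ) → ℝ≥0∞} (hg : ∫⁻ y in J.toSet, g y ≠ ∞) :
    volume J.toSet ≤ 2 * volume (J.toSet \
      stopSet E J g (2 * ((∫⁻ y in J.toSet, g y) / volume J.toSet))) := by
  set G := ∫⁻ y in J.toSet, g y with hG
  set t := 2 * (G / volume J.toSet) with ht
  set Ω := stopSet E J g t with hΩ
  have hJ0 := J.volume_ne_zero
  have hJt := J.volume_ne_top
  have h2 : 2 * volume Ω ≤ volume J.toSet := by
    -- For threshold 0 the weak type bound says nothing, but then no cube is stopped.
    by_cases h0 : G = 0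
    · have : Ω = ∅ := by
        refine Set.eq_empty_of_forall_notMem fun x hx => ?_
        obtain ⟨J', hJ', -⟩ := Set.mem_iUnion₂.1 hx
        have h1 : ∫⁻ y in J'.toSet, g y ≤ G := lintegral_mono_set hJ'.2.1
        exact absurd hJ'.2.2 (by rw [h0] at h1; exact not_lt.2 (h1.trans zero_le))
      simp [this]
    · have h1 := mul_measure_lt_maxM_le (ω := volume) hE hm (fun I _ => I.volume_ne_zero)
        (fun I _ => I.volume_ne_top) (J.toSet.indicator g) t
      rw [lintegral_indicator J.measurableSet_toSet] at h1
      have hsub : Ω ⊆ {x | t < maxM volume E (J.toSet.indicator g) x} := by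
        intro x hx
        obtain ⟨J', hJ', hxJ'⟩ := Set.mem_iUnion₂.1 hx
        refine lt_maxM_iff.2 ⟨J', hJ'.1, hxJ', ?_⟩
        rw [ENNReal.lt_div_iff_mul_lt (Or.inl J'.volume_ne_zero) (Or.inl J'.volume_ne_top),
          setLIntegral_congr_fun J'.measurableSet_toSet
            (fun y hy => Set.indicator_of_mem (hJ'.2.1 hy) g)]
        exact hJ'.2.2
      have h3 : t * volume Ω ≤ G := (mul_le_mul_right (measure_mono hsub) t).trans h1
      rw [ht] at h3
      have h4 : G * (2 * volume Ω) ≤ G * volume J.toSet := by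
        calc G * (2 * volume Ω) = 2 * (G / volume J.toSet * volume J.toSet) * volume Ω := by
              rw [ENNReal.div_mul_cancel hJ0 hJt]
              ring
          _ = 2 * (G / volume J.toSet) * volume Ω * volume J.toSet := by ring
          _ ≤ _ := mul_le_mul_left h3 _
      exact (ENNReal.mul_le_mul_iff_right h0 hg).1 h4
  have h5 : volume J.toSet = volume Ω + volume (J.toSet \ Ω) := by
    rw [← measure_inter_add_sdiff J.toSet (measurableSet_stopSet hE.countable J g t),
      Set.inter_eq_self_of_subset_right (stopSet_subset J g t)]
  have h6 : volume J.toSet + volume J.toSet ≤ volume J.toSet + 2 * volume (J.toSet \ Ω) := by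
    calc volume J.toSet + volume J.toSet = 2 * volume Ω + 2 * volume (J.toSet \ Ω) := by
          conv_lhs => rw [h5]
          ring
      _ ≤ _ := add_le_add_left h2 _
  exact (ENNReal.add_le_add_iff_left hJt).1 h6

variable {E : Set (Cube m)} {a α : (Fin m → ℝ) → ℂ} {F V : (Fin m → ℝ) → ℝ≥0∞}

/-- One stopping step for the oscillation of `a` on `J₀`. -/
theorem lintegral_sub_mul_le_of_stopSet (hE : IsDyadicGrid E) (hm : 0 < m)
    (ha : LocallyIntegrable a volume) (hF : Measurable F) {C : ℝ≥0∞} {δ : ℝ}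
    (hα : ∀ J ∈ E, J.side = δ → ∀ y ∈ J.toSet, α y = ⨍ z in J.toSet, a z) {j : ℕ}
    (IH : ∀ i < j, ∀ J ∈ E, J.side = 2 ^ i * δ →
      ∫⁻ y in J.toSet, ‖α y - ⨍ z in J.toSet, a z‖ₑ * F y ≤
        C * ∫⁻ y in J.toSet, maxM volume E F y * V y)
    (J₀ : Cube m) (c : ℂ) (t : ℝ≥0∞) : ∀ i ≤ j, ∀ J ∈ E, J.side = 2 ^ i * δ →
      J.toSet ⊆ J₀.toSet →
      ∫⁻ y in J.toSet, ‖a y - c‖ₑ ≤ t * volume J.toSet →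
      ∫⁻ y in J.toSet, ‖α y - c‖ₑ * F y ≤ 2 ^ m * t * (∫⁻ y in J.toSet, F y) +
        C * ∫⁻ y in J.toSet, (stopSet E J₀ (fun y => ‖a y - c‖ₑ) t).indicator
          (fun y => maxM volume E F y * V y) y := by
  set Ω := stopSet E J₀ (fun y => ‖a y - c‖ₑ) t with hΩ
  have hcube : ∀ J : Cube m, IntegrableOn a J.toSet := Cube.locallyIntegrable_integrableOn ha
  -- Induction on the generation of an unstopped cube above the scale δ. At the bottom α is the
  -- average of a, which the absence of stopping bounds directly; this is why α replaces a.
  intro i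
  induction i with
  | zero =>
    intro _ J hJ hs _ hJg
    have h1 : ‖(⨍ z in J.toSet, a z) - c‖ₑ ≤ t :=
      (ENNReal.mul_le_mul_iff_left J.volume_ne_zero J.volume_ne_top).1
        ((enorm_average_sub_mul_le J (hcube J) c).trans hJg)
    refine le_add_right ?_
    calc ∫⁻ y in J.toSet, ‖α y - c‖ₑ * F y
        = ∫⁻ y in J.toSet, ‖(⨍ z in J.toSet, a z) - c‖ₑ * F y :=
          setLIntegral_congr_fun J.measurableSet_toSet fun y hy => by
            rw [hα J hJ (by simpa using hs) y hy]
      _ = ‖(⨍ z in J.toSet, a z) - c‖ₑ * ∫⁻ y in J.toSet, F y := lintegral_const_mul _ hF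
      _ ≤ t * ∫⁻ y in J.toSet, F y := mul_le_mul_left h1 _
      _ ≤ _ := by
          gcongr
          exact le_mul_of_one_le_left' (one_le_pow₀ (by norm_num))
  | succ i ih =>
    intro hij J hJ hs hJ₀ hJg
    rw [J.lintegral_eq_sum_child, J.lintegral_eq_sum_child F,
      J.lintegral_eq_sum_child (Ω.indicator fun y => maxM volume E F y * V y), Finset.mul_sum,
      Finset.mul_sum, ← Finset.sum_add_distrib]
    refine Finset.sum_le_sum fun ε _ => ?_
    have hcE := hE.child_mem hm hJ ε
    have hcs : (J.child ε).side = 2 ^ i * δ := by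
      change J.side / 2 = _
      rw [hs]
      ring
    have hcJ := (J.child_subset ε).trans hJ₀
    by_cases hB : ∫⁻ y in (J.child ε).toSet, ‖a y - c‖ₑ ≤ t * volume (J.child ε).toSet
    · exact ih (by omega) _ hcE hcs hcJ hB
    -- A stopped child. Its average differs from c by at most 2^m t because its parent was not
    -- stopped, and the oscillation about its own average is the outer induction hypothesis, charged
    -- to the stopped set.
    · set J' := J.child ε with hJ'
      have hsub : J'.toSet ⊆ Ω := Set.subset_biUnion_of_mem
        (u := fun J' : Cube m => J'.toSet) ⟨hcE, hcJ, not_le.1 hB⟩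
      have h1 : ‖(⨍ z in J'.toSet, a z) - c‖ₑ ≤ 2 ^ m * t := by
        refine (ENNReal.mul_le_mul_iff_left J'.volume_ne_zero J'.volume_ne_top).1
          ((enorm_average_sub_mul_le J' (hcube J') c).trans
            ((lintegral_mono_set (J.child_subset ε)).trans (hJg.trans (le_of_eq ?_))))
        rw [J.volume_child ε]
        ring
      have h2 : ∫⁻ y in J'.toSet, Ω.indicator (fun y => maxM volume E F y * V y) y =
          ∫⁻ y in J'.toSet, maxM volume E F y * V y :=
        setLIntegral_congr_fun J'.measurableSet_toSet fun y hy =>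
          Set.indicator_of_mem (hsub hy) _
      rw [h2]
      calc ∫⁻ y in J'.toSet, ‖α y - c‖ₑ * F y
          ≤ ∫⁻ y in J'.toSet, (‖(⨍ z in J'.toSet, a z) - c‖ₑ * F y +
              ‖α y - ⨍ z in J'.toSet, a z‖ₑ * F y) := by
            refine lintegral_mono fun y => ?_
            simp only
            rw [← add_mul]
            gcongr
            calc ‖α y - c‖ₑ
                = ‖((⨍ z in J'.toSet, a z) - c) + (α y - ⨍ z in J'.toSet, a z)‖ₑ := by
                  congr 1
                  ring
              _ ≤ _ := enorm_add_le _ _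
        _ = ‖(⨍ z in J'.toSet, a z) - c‖ₑ * (∫⁻ y in J'.toSet, F y) +
            ∫⁻ y in J'.toSet, ‖α y - ⨍ z in J'.toSet, a z‖ₑ * F y := by
            rw [lintegral_add_left (hF.const_mul _), lintegral_const_mul _ hF]
        _ ≤ _ := by
            gcongr
            exact IH i (by omega) J' hcE hcs

/-- The unstopped part costs 2^{m+1} ⟨F⟩_J times the oscillation over J, which is at most β times
the V-mass of J, hence at most Kβ times that of J outside the stopped set, where ⟨F⟩_J ≤ MF. The
stopped part costs C ∫ MF · V over the stopped set, with the same C. The two sets are disjoint, so C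
reproduces itself at every scale. -/
theorem lintegral_level_sub_mul_le (hE : IsDyadicGrid E) (hm : 0 < m)
    (ha : LocallyIntegrable a volume) (hF : Measurable F) (hV : Measurable V) {β K : ℝ≥0∞}
    (hβ : ∀ J ∈ E, ∫⁻ y in J.toSet, ‖a y - ⨍ z in J.toSet, a z‖ₑ ≤ β * ∫⁻ y in J.toSet, V y)
    (hK : ∀ J ∈ E, ∀ A ⊆ J.toSet, MeasurableSet A → volume J.toSet ≤ 2 * volume A →
      ∫⁻ y in J.toSet, V y ≤ K * ∫⁻ y in A, V y) {δ : ℝ}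
    (hα : ∀ J ∈ E, J.side = δ → ∀ y ∈ J.toSet, α y = ⨍ z in J.toSet, a z) (j : ℕ) :
    ∀ J ∈ E, J.side = 2 ^ j * δ →
      ∫⁻ y in J.toSet, ‖α y - ⨍ z in J.toSet, a z‖ₑ * F y ≤
        2 ^ (m + 1) * K * β * ∫⁻ y in J.toSet, maxM volume E F y * V y := by
  induction j using Nat.strong_induction_on with
  | _ j IH =>
  intro J hJ hs
  set c := ⨍ z in J.toSet, a z with hc
  set g : (Fin m → ℝ) → ℝ≥0∞ := fun y => ‖a y - c‖ₑ with hg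
  set G := ∫⁻ y in J.toSet, g y with hG
  have hGt : G ≠ ∞ := by
    have h1 : IntegrableOn (fun y => a y - c) J.toSet :=
      (Cube.locallyIntegrable_integrableOn ha J).sub (integrableOn_const J.volume_ne_top)
    exact h1.2.ne
  have hJ0 := J.volume_ne_zero
  have hJt := J.volume_ne_top
  set t := 2 * (G / volume J.toSet) with ht
  have hGt2 : G ≤ t * volume J.toSet := by
    rw [ht, mul_assoc, ENNReal.div_mul_cancel hJ0 hJt]
    exact le_mul_of_one_le_left' (by norm_num)
  set Ω := stopSet E J g t with hΩ
  have hΩm : MeasurableSet Ω := measurableSet_stopSet hE.countable J g t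
  set C := 2 ^ (m + 1) * K * β with hC
  have h1 := lintegral_sub_mul_le_of_stopSet (V := V) hE hm ha hF hα IH J c t j le_rfl J hJ hs
    subset_rfl hGt2
  have hMV : Measurable fun y => maxM volume E F y * V y :=
    (measurable_maxM hE.countable F).mul hV
  have h2 : ∫⁻ y in J.toSet, Ω.indicator (fun y => maxM volume E F y * V y) y =
      ∫⁻ y in J.toSet ∩ Ω, maxM volume E F y * V y := by
    rw [lintegral_indicator hΩm, Measure.restrict_restrict hΩm, Set.inter_comm]
  have h3 : 2 ^ m * t * (∫⁻ y in J.toSet, F y) ≤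
      C * ∫⁻ y in J.toSet \ Ω, maxM volume E F y * V y := by
    set A := (∫⁻ y in J.toSet, F y) / volume J.toSet with hA
    calc 2 ^ m * t * (∫⁻ y in J.toSet, F y)
        = 2 ^ (m + 1) * G * A := by
          rw [ht, hA, pow_succ, ENNReal.div_eq_inv_mul, ENNReal.div_eq_inv_mul]
          ring
      _ ≤ 2 ^ (m + 1) * (β * (K * ∫⁻ y in J.toSet \ Ω, V y)) * A := by
          gcongr
          exact (hβ J hJ).trans (mul_le_mul_right (hK J hJ _ Set.sdiff_subset
            (J.measurableSet_toSet.diff hΩm) (volume_le_two_mul_diff_stopSet hE hm J hGt)) _)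
      _ = C * ∫⁻ y in J.toSet \ Ω, A * V y := by
          rw [lintegral_const_mul _ hV, hC]
          ring
      _ ≤ _ := by
          refine mul_le_mul_right (setLIntegral_mono' (J.measurableSet_toSet.diff hΩm)
            fun y hy => ?_) _
          exact mul_le_mul_left (le_maxM hJ hy.1 F) _
  calc ∫⁻ y in J.toSet, ‖α y - c‖ₑ * F y ≤ _ := h1
    _ ≤ C * (∫⁻ y in J.toSet \ Ω, maxM volume E F y * V y) +
        C * ∫⁻ y in J.toSet ∩ Ω, maxM volume E F y * V y := by
        rw [← h2]
        gcongr
    _ = _ := by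
        rw [← mul_add, add_comm, lintegral_inter_add_sdiff _ _ hΩm]

/-- The weighted bound for the oscillation of `a` against `F`. -/
theorem lintegral_sub_average_mul_le (hE : IsDyadicGrid E) (hm : 0 < m)
    (ha : LocallyIntegrable a volume) (hF : Measurable F) (hFt : ∀ y, F y ≠ ∞) (hV : Measurable V)
    {β K : ℝ≥0∞}
    (hβ : ∀ J ∈ E, ∫⁻ y in J.toSet, ‖a y - ⨍ z in J.toSet, a z‖ₑ ≤ β * ∫⁻ y in J.toSet, V y)
    (hK : ∀ J ∈ E, ∀ A ⊆ J.toSet, MeasurableSet A → volume J.toSet ≤ 2 * volume A →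
      ∫⁻ y in J.toSet, V y ≤ K * ∫⁻ y in A, V y) {J : Cube m} (hJ : J ∈ E) :
    ∫⁻ y in J.toSet, ‖a y - ⨍ z in J.toSet, a z‖ₑ * F y ≤
      2 ^ (m + 1) * K * β * ∫⁻ y in J.toSet, maxM volume E F y * V y := by
  obtain ⟨k, hk⟩ := hE.side_eq J hJ
  -- The average of a over the grid cube N generations below the scale of J serves as α, so that J
  -- lies exactly N generations above the bottom.
  choose Q hQ hQs hxQ using fun (N : ℕ) (x : Fin m → ℝ) => hE.exists_cube (k - N) x
  set c := ⨍ z in J.toSet, a z with hc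
  set α : ℕ → (Fin m → ℝ) → ℂ := fun N x => ⨍ z in (Q N x).toSet, a z with hα
  have hα' : ∀ N : ℕ, ∀ J' ∈ E, J'.side = (2 : ℝ) ^ (k - N) → ∀ y ∈ J'.toSet,
      α N y = ⨍ z in J'.toSet, a z := by
    intro N J' hJ' hs y hy
    simp only [hα]
    rw [hE.eq_of_mem (hQ N y) hJ' ((hQs N y).trans hs.symm) (hxQ N y) hy]
  -- The approximation takes one value per cube, so preimages are countable unions of cubes.
  have hαm : ∀ N, Measurable (α N) := by
    intro N s hs
    have : α N ⁻¹' s = ⋃ J' ∈ {J' ∈ E | J'.side = (2 : ℝ) ^ (k - N) ∧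
        (⨍ z in J'.toSet, a z) ∈ s}, J'.toSet := by
      ext y
      rw [Set.mem_iUnion₂, Set.mem_preimage]
      constructor
      · intro hy
        exact ⟨Q N y, ⟨hQ N y, hQs N y, hy⟩, hxQ N y⟩
      · rintro ⟨J', ⟨h1, h2, h3⟩, hy⟩
        rwa [hα' N J' h1 h2 y hy]
    rw [this]
    exact MeasurableSet.biUnion (hE.countable.mono fun _ h => h.1)
      fun J' _ => J'.measurableSet_toSet
  have hlim : ∀ᵐ y, Tendsto (fun N => ‖α N y - c‖ₑ * F y) atTop (𝓝 (‖a y - c‖ₑ * F y)) := by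
    filter_upwards [ae_tendsto_average_cube ha] with y hy
    have h1 : Tendsto (fun N => (Q N y).side) atTop (𝓝 0) := by
      simp only [hQs]
      have h2 := (tendsto_pow_atTop_nhds_zero_of_lt_one (r := (1 / 2 : ℝ)) (by norm_num)
        (by norm_num)).const_mul ((2 : ℝ) ^ k)
      rw [mul_zero] at h2
      refine h2.congr fun N => ?_
      rw [zpow_sub₀ (by norm_num), zpow_natCast, one_div, inv_pow, div_eq_mul_inv]
    have h3 := hy (fun N => Q N y) (fun N => hxQ N y) h1
    exact ENNReal.Tendsto.mul_const ((continuous_enorm.tendsto _).comp (h3.sub_const c))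
      (Or.inr (hFt y))
  have hbound : ∀ N, ∫⁻ y in J.toSet, ‖α N y - c‖ₑ * F y ≤
      2 ^ (m + 1) * K * β * ∫⁻ y in J.toSet, maxM volume E F y * V y := fun N =>
    lintegral_level_sub_mul_le hE hm ha hF hV hβ hK (hα' N) N J hJ (by
      rw [hk, ← zpow_natCast, ← zpow_add₀ (by norm_num)]
      congr 1
      ring)
  -- The bound is uniform in N; Lebesgue differentiation and Fatou's lemma pass to the limit.
  calc ∫⁻ y in J.toSet, ‖a y - c‖ₑ * F y
      = ∫⁻ y in J.toSet, liminf (fun N => ‖α N y - c‖ₑ * F y) atTop :=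
        lintegral_congr_ae (ae_restrict_of_ae (hlim.mono fun y hy => hy.liminf_eq.symm))
    _ ≤ liminf (fun N => ∫⁻ y in J.toSet, ‖α N y - c‖ₑ * F y) atTop :=
        lintegral_liminf_le fun N => ((hαm N).sub_const c).enorm.mul hF
    _ ≤ _ := liminf_le_of_frequently_le' (Frequently.of_forall hbound)

end Oscillation

end BiParam

namespace BiParam

/-! ### Little bmo in one variable and the pairing estimate. -/

section LittleBmo

variable {n m : ℕ}

theorem RectAp.lavg_mul_le {p q : ℝ} (hp : 1 < p) {Q : ℝ≥0∞}
    {w : (Fin n → ℝ) × (Fin m → ℝ) → ℝ≥0∞} (h : RectAp p q Q w) (I : Cube n) (J : Cube m) :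
    lavg (rect I J) w * lavg (rect I J) (fun z => w z ^ (1 - q)) ^ (p - 1) ≤ Q := by
  have hV0 := volume_rect_ne_zero I J
  have hVt := volume_rect_ne_top I J
  have hm := h.mul_le I J
  unfold lavg
  set V := volume (rect I J)
  have e : V ^ p = V * V ^ (p - 1) := by
    conv_rhs => rw [← ENNReal.rpow_one V, ← ENNReal.rpow_mul, one_mul,
      ← ENNReal.rpow_add _ _ hV0 hVt]
    congr 1
    ring
  have hp0 : V ^ p ≠ 0 := by simp [ENNReal.rpow_eq_zero_iff, hV0, hVt]
  have hpt : V ^ p ≠ ∞ := ENNReal.rpow_ne_top_of_nonneg (by linarith) hVt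
  rw [ENNReal.div_rpow_of_nonneg _ _ (by linarith), ENNReal.div_eq_inv_mul,
    ENNReal.div_eq_inv_mul, mul_mul_mul_comm, ← ENNReal.mul_inv (Or.inl hV0) (Or.inl hVt), ← e,
    ← ENNReal.div_eq_inv_mul]
  exact (ENNReal.div_le_iff hp0 hpt).2 hm

theorem conjExponent_two : (2 : ℝ).conjExponent = 2 := by
  rw [Real.conjExponent]
  norm_num

theorem RectAp.apConst_two_le {Q : ℝ≥0∞} {ν : (Fin n → ℝ) × (Fin m → ℝ) → ℝ}
    (hpos : ∀ z, 0 < ν z) (h : RectAp 2 2 Q (fun z => ENNReal.ofReal (ν z))) :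
    apConst 2 ν ≤ Q := by
  refine iSup₂_le fun I J => ?_
  rw [conjExponent_two]
  simp only [← ENNReal.ofReal_rpow_of_pos (hpos _)]
  exact h.lavg_mul_le one_lt_two I J

/-- The bound known for the Bloom weight involves the characteristics of μ and λ. It is used only
for finiteness; the constant is then the weight's own characteristic, as the dependence of C₁
requires. -/
theorem RectAp.self_apConst_two {Q : ℝ≥0∞} {ν : (Fin n → ℝ) × (Fin m → ℝ) → ℝ}
    (hpos : ∀ z, 0 < ν z) (h : RectAp 2 2 Q (fun z => ENNReal.ofReal (ν z))) :
    RectAp 2 2 (apConst 2 ν) (fun z => ENNReal.ofReal (ν z)) := by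
  refine ⟨h.measurable, h.ne_zero, h.ne_top,
    ne_top_of_le_ne_top h.const_ne_top (h.apConst_two_le hpos), h.lintegral_ne_top, h.dual_ne_top,
    fun I J => ?_⟩
  have := lavg_mul_le_apConst 2 one_lt_two ν I J
  rw [conjExponent_two] at this
  simpa only [← ENNReal.ofReal_rpow_of_pos (hpos _)] using this

/-- The partial average `⟨w⟩_{I,1}` of a `[0, ∞]`-valued function. -/
noncomputable def lavgFst (w : (Fin n → ℝ) × (Fin m → ℝ) → ℝ≥0∞) (I : Cube n)
    (y : Fin m → ℝ) : ℝ≥0∞ :=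
  (∫⁻ x in I.toSet, w (x, y)) / volume I.toSet

theorem measurable_lavgFst {w : (Fin n → ℝ) × (Fin m → ℝ) → ℝ≥0∞} (hw : Measurable w)
    (I : Cube n) : Measurable (lavgFst w I) :=
  (Measurable.lintegral_prod_left' hw).div_const _

theorem setLIntegral_prod_eq {w : (Fin n → ℝ) × (Fin m → ℝ) → ℝ≥0∞} (hw : Measurable w)
    (I : Cube n) (A : Set (Fin m → ℝ)) :
    ∫⁻ z in I.toSet ×ˢ A, w z = volume I.toSet * ∫⁻ y in A, lavgFst w I y := by
  rw [Measure.volume_eq_prod, ← Measure.prod_restrict, lintegral_prod_symm _ hw.aemeasurable,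
    ← lintegral_const_mul _ (measurable_lavgFst hw I)]
  refine lintegral_congr fun y => ?_
  rw [lavgFst, ENNReal.mul_div_cancel I.volume_ne_zero I.volume_ne_top]

/-- Averages of an `A₂` weight over a large subset of a cube. -/
theorem RectAp.lintegral_lavgFst_le {Q : ℝ≥0∞} {w : (Fin n → ℝ) × (Fin m → ℝ) → ℝ≥0∞}
    (h : RectAp 2 2 Q w) (I : Cube n) (J : Cube m) {A : Set (Fin m → ℝ)} (hA : A ⊆ J.toSet)
    (hvol : volume J.toSet ≤ 2 * volume A) :
    ∫⁻ y in J.toSet, lavgFst w I y ≤ 4 * Q * ∫⁻ y in A, lavgFst w I y := by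
  have hw := h.measurable
  have hd : Measurable fun z => w z ^ (1 - (2 : ℝ)) := hw.pow_const _
  have hI0 := I.volume_ne_zero
  have hIt := I.volume_ne_top
  set X := ∫⁻ z in rect I J, w z with hX
  set Y := ∫⁻ z in rect I J, w z ^ (1 - (2 : ℝ)) with hY
  set Z := ∫⁻ z in I.toSet ×ˢ A, w z with hZ
  have hY0 : Y ≠ 0 := by
    refine setLIntegral_rect_ne_zero hd (fun z => ?_) I J
    simp [ENNReal.rpow_eq_zero_iff, h.ne_zero z, h.ne_top z]
  have hYt : Y ≠ ∞ := h.dual_ne_top I J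
  have hsq : ∀ c : ℝ≥0∞, (c ^ (1 / 2 : ℝ)) ^ 2 = c := fun c => by
    rw [← ENNReal.rpow_two, ← ENNReal.rpow_mul]
    norm_num
  -- Cauchy–Schwarz on I × A, with the inverse weight enlarged to the whole rectangle. Against A₂ on
  -- the rectangle, |I × J|² ≤ 4|I × A|² gives the factor 4Q.
  have hcs : volume (I.toSet ×ˢ A) ^ 2 ≤ Z * Y := by
    have h1 := lintegral_mul_le_weight (μ := volume.restrict (I.toSet ×ˢ A))
      Real.HolderConjugate.two_two hw h.ne_zero h.ne_top (u := fun _ => 1) (v := fun _ => 1)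
      measurable_const measurable_const
    simp only [ENNReal.one_rpow, one_mul, lintegral_const, Measure.restrict_apply_univ] at h1
    have h2 := pow_le_pow_left' h1 2
    rw [mul_pow, hsq, hsq] at h2
    refine h2.trans (mul_le_mul_right (lintegral_mono_set (Set.prod_mono_right hA)) _)
  have hvol2 : volume (rect I J) ≤ 2 * volume (I.toSet ×ˢ A) := by
    rw [volume_rect, Measure.volume_eq_prod, Measure.prod_prod, mul_left_comm]
    gcongr
  have hXY : X * Y ≤ Q * volume (rect I J) ^ 2 := by
    have := h.mul_le I J
    rwa [show (2 : ℝ) - 1 = 1 by norm_num, ENNReal.rpow_one, ENNReal.rpow_two] at this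
  have hXZ : X ≤ 4 * Q * Z := by
    refine (ENNReal.mul_le_mul_iff_left hY0 hYt).1 (hXY.trans ?_)
    calc Q * volume (rect I J) ^ 2 ≤ Q * (2 * volume (I.toSet ×ˢ A)) ^ 2 := by gcongr
      _ = 4 * Q * volume (I.toSet ×ˢ A) ^ 2 := by ring
      _ ≤ 4 * Q * (Z * Y) := by gcongr
      _ = _ := by ring
  refine (ENNReal.mul_le_mul_iff_right hI0 hIt).1 ?_
  rw [mul_left_comm, ← setLIntegral_prod_eq hw, ← setLIntegral_prod_eq hw]
  exact hXZ

theorem ae_ofReal_avg₁ {ν : (Fin n → ℝ) × (Fin m → ℝ) → ℝ} (hν : Measurable ν)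
    (hpos : ∀ z, 0 < ν z) (I : Cube n) (J : Cube m)
    (hfin : ∫⁻ z in rect I J, ENNReal.ofReal (ν z) ≠ ∞) :
    ∀ᵐ y ∂volume.restrict J.toSet, ENNReal.ofReal (avg₁ ν I y) =
      lavgFst (fun z => ENNReal.ofReal (ν z)) I y := by
  rw [lintegral_rect_symm hν.ennreal_ofReal] at hfin
  filter_upwards [ae_lt_top (Measurable.lintegral_prod_left' hν.ennreal_ofReal) hfin] with y hy
  have hνy : Measurable fun x => ν (x, y) := hν.comp measurable_prodMk_right
  have hint : IntegrableOn (fun x => ν (x, y)) I.toSet := by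
    refine ⟨hνy.aestronglyMeasurable, ?_⟩
    change ∫⁻ x in I.toSet, ‖ν (x, y)‖ₑ < ∞
    simpa only [Real.enorm_eq_ofReal (hpos _).le] using hy
  rw [avg₁, setAverage_eq, smul_eq_mul, ENNReal.ofReal_mul (inv_nonneg.2 measureReal_nonneg),
    ofReal_integral_eq_lintegral_ofReal hint (Eventually.of_forall fun x => (hpos _).le),
    ENNReal.ofReal_inv_of_pos I.volume_real_pos, Measure.real, ENNReal.ofReal_toReal I.volume_ne_top,
    lavgFst, ENNReal.div_eq_inv_mul]

variable {b : (Fin n → ℝ) × (Fin m → ℝ) → ℂ}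

theorem locallyIntegrable_avg₁ (hb : LocallyIntegrable b volume) (I : Cube n) :
    LocallyIntegrable (avg₁ b I) volume := by
  refine locallyIntegrable_of_integrableOn_cube fun J => ?_
  have h1 := rect_integrableOn hb I J
  rw [IntegrableOn, restrict_rect] at h1
  refine (h1.integral_prod_right.smul (volume.real I.toSet)⁻¹).congr
    (Eventually.of_forall fun y => ?_)
  rw [avg₁, setAverage_eq]
  rfl

theorem average_avg₁ (hb : LocallyIntegrable b volume) (I : Cube n) (J : Cube m) :
    ⨍ y in J.toSet, avg₁ b I y = ⨍ z in rect I J, b z := by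
  have h1 := rect_integrableOn hb I J
  have h2 : volume.real (rect I J) = volume.real I.toSet * volume.real J.toSet := by
    simp only [Measure.real, volume_rect, ENNReal.toReal_mul]
  rw [IntegrableOn, restrict_rect] at h1
  simp only [setAverage_eq, avg₁]
  rw [integral_smul, restrict_rect, integral_prod_symm _ h1, smul_smul, h2, mul_inv, mul_comm]

/-- Averaging over I does not increase the mean oscillation, so little bmo for ν makes ⟨b⟩_{I,1} a
one-parameter bmo function for the weight ⟨ν⟩_{I,1}, on every J of the grid; the factors |I| cancel.
-/
theorem lintegral_avg₁_sub_average_le {ν : (Fin n → ℝ) × (Fin m → ℝ) → ℝ} {Q : ℝ≥0∞} (h : RectAp 2 2 Q (fun z => ENNReal.ofReal (ν z)))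
    (hb : LocallyIntegrable b volume) {D : Set (Cube n)} {E : Set (Cube m)}
    (hD : IsDyadicGrid D) (hE : IsDyadicGrid E) {I : Cube n} (hI : I ∈ D) {J : Cube m}
    (hJ : J ∈ E) :
    ∫⁻ y in J.toSet, ‖avg₁ b I y - ⨍ z in J.toSet, avg₁ b I z‖ₑ ≤
      bmoNorm ν b * ∫⁻ y in J.toSet, lavgFst (fun z => ENNReal.ofReal (ν z)) I y := by
  rw [average_avg₁ hb]
  set c := ⨍ z in rect I J, b z with hc
  have hI0 := I.volume_ne_zero
  have hIt := I.volume_ne_top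
  have hw : wMeasure ν (rect I J) = ∫⁻ z in rect I J, ENNReal.ofReal (ν z) :=
    withDensity_apply _ (measurableSet_rect I J)
  have h1 : ∫⁻ z in rect I J, ‖b z - c‖ₑ ≤ bmoNorm ν b * wMeasure ν (rect I J) := by
    refine (ENNReal.div_le_iff ?_ ?_).1 ?_
    · rw [hw]
      exact setLIntegral_rect_ne_zero h.measurable h.ne_zero I J
    · rw [hw]
      exact h.lintegral_ne_top I J
    · have h2 : bmoDyadicNorm D E ν b ≤ bmoNorm ν b :=
        le_iSup₂_of_le D hD (le_iSup₂_of_le E hE le_rfl)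
      refine le_trans ?_ h2
      exact le_trans (le_iSup₂ (f := fun (J : Cube m) (_ : J ∈ E) =>
        (∫⁻ z in rect I J, ‖b z - ⨍ y in rect I J, b y‖ₑ) / wMeasure ν (rect I J)) J hJ)
        (le_iSup₂ (f := fun (I : Cube n) (_ : I ∈ D) => ⨆ J ∈ E,
          (∫⁻ z in rect I J, ‖b z - ⨍ y in rect I J, b y‖ₑ) / wMeasure ν (rect I J)) I hI)
  have hbi := rect_integrableOn hb I J
  have hci : IntegrableOn (fun _ => c) (rect I J) := integrableOn_const (volume_rect_ne_top I J)
  have hbc := hbi.sub hci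
  have h3 : ∫⁻ z in rect I J, ‖b z - c‖ₑ = ∫⁻ y in J.toSet, ∫⁻ x in I.toSet, ‖b (x, y) - c‖ₑ := by
    have h4 := hbc.1.enorm
    rw [restrict_rect] at h4 ⊢
    exact lintegral_prod_symm _ h4
  have h5 : ∀ᵐ y ∂volume.restrict J.toSet, IntegrableOn (fun x => b (x, y)) I.toSet := by
    rw [IntegrableOn, restrict_rect] at hbi
    exact hbi.prod_left_ae
  have h6 : ∫⁻ y in J.toSet, ‖avg₁ b I y - c‖ₑ * volume I.toSet ≤
      ∫⁻ z in rect I J, ‖b z - c‖ₑ := by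
    rw [h3]
    exact lintegral_mono_ae (h5.mono fun y hy => enorm_average_sub_mul_le I hy c)
  rw [lintegral_mul_const' _ _ hIt] at h6
  refine (ENNReal.mul_le_mul_iff_left hI0 hIt).1 (h6.trans (h1.trans (le_of_eq ?_)))
  rw [hw, rect, setLIntegral_prod_eq h.measurable]
  ring

/-- The square function is finite almost everywhere, so some x in I has it finite for almost all y,
and it dominates the single (I, η) term. This is needed because φ contains the real value of the
maximal function, which is 0 where that is infinite. -/
theorem ae_maxCoef_lt_top {D : Set (Cube n)} (hD : IsDyadicGrid D) {E : Set (Cube m)}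
    (hE : E.Countable) {S : Cube n → Finset (Fin n → Fin 2)} {p : ℝ} (hp : 0 < p)
    {M : (Fin n → ℝ) × (Fin m → ℝ) → ℝ≥0∞} (hM : Measurable M) (hM0 : ∀ z, M z ≠ 0)
    {f : (Fin n → ℝ) × (Fin m → ℝ) → ℂ}
    (hfin : ∫⁻ z, (sqFn D S (maxCoef E f) z ^ (1 / 2 : ℝ)) ^ p * M z ≠ ∞)
    {I : Cube n} (hI : I ∈ D) {η : Fin n → Fin 2} (hη : η ∈ S I) :
    ∀ᵐ y, maxCoef E f I η y < ∞ := by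
  have hsq := measurable_sqFn hD.countable (S := S) (measurable_maxCoef hE f)
  have h1 : ∀ᵐ z : (Fin n → ℝ) × (Fin m → ℝ), sqFn D S (maxCoef E f) z < ∞ := by
    filter_upwards [ae_lt_top (((hsq.pow_const _).pow_const _).mul hM) hfin] with z hz
    refine lt_top_iff_ne_top.2 fun h => ?_
    rw [Pi.mul_apply, h, ENNReal.top_rpow_of_pos (by norm_num), ENNReal.top_rpow_of_pos hp,
      ENNReal.top_mul (hM0 z)] at hz
    exact lt_irrefl _ hz
  rw [Measure.volume_eq_prod] at h1
  have h2 := Measure.ae_ae_of_ae_prod h1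
  have h3 : ∃ x ∈ I.toSet, ∀ᵐ y, sqFn D S (maxCoef E f) (x, y) < ∞ := by
    by_contra hcon
    exact I.volume_ne_zero (measure_mono_null (fun x hx hx' => hcon ⟨x, hx, hx'⟩) h2)
  obtain ⟨x, hx, hy⟩ := h3
  refine hy.mono fun y hy => ?_
  have h4 : (volume I.toSet)⁻¹ * maxCoef E f I η y ^ 2 ≤ sqFn D S (maxCoef E f) (x, y) := by
    refine le_trans ?_ (ENNReal.le_tsum ⟨I, hI⟩)
    refine le_trans (le_of_eq ?_) (Finset.single_le_sum (fun _ _ => zero_le) hη)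
    simp [hx]
  refine lt_top_iff_ne_top.2 fun h => ?_
  rw [h, ENNReal.top_pow two_ne_zero, ENNReal.mul_top (ENNReal.inv_ne_zero.2 I.volume_ne_top)] at h4
  exact absurd hy (not_lt.2 h4)

/-- The pairing of a little BMO function is controlled by that of `φ^{ν,1} f`. -/
theorem norm_average_mul_pair₁_le (hm : 0 < m) {D : Set (Cube n)}
    {E : Set (Cube m)} (hD : IsDyadicGrid D) (hE : IsDyadicGrid E)
    {ν : (Fin n → ℝ) × (Fin m → ℝ) → ℝ} (hν : Measurable ν) (hpos : ∀ z, 0 < ν z)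
    {Q : ℝ≥0∞} (h : RectAp 2 2 Q (fun z => ENNReal.ofReal (ν z)))
    {f : (Fin n → ℝ) × (Fin m → ℝ) → ℂ} (hf : Measurable f) (hb : MemBmo ν b)
    {I : Cube n} (hI : I ∈ D) {J : Cube m} (hJ : J ∈ E) {η : Fin n → Fin 2}
    (hfin : ∀ᵐ y, maxCoef E f I η y < ∞)
    (hint : IntegrableOn (fun y => (dyadicMax E (pair₁ f (haar I η)) y).toReal * avg₁ ν I y)
      J.toSet) :
    IntegrableOn (fun y => (avg₁ b I y - ⨍ z in rect I J, b z) * pair₁ f (haar I η) y) J.toSet ∧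
    ‖⨍ y in J.toSet, (avg₁ b I y - ⨍ z in rect I J, b z) * pair₁ f (haar I η) y‖ ≤
      (2 ^ (m + 1) * (4 * Q.toReal)) * (bmoNorm ν b).toReal * ((volume.real J.toSet)⁻¹ *
        ∫ y in J.toSet, (dyadicMax E (pair₁ f (haar I η)) y).toReal * avg₁ ν I y) := by
  have hloc := locallyIntegrable_avg₁ hb.locallyIntegrable I
  set w : (Fin n → ℝ) × (Fin m → ℝ) → ℝ≥0∞ := fun z => ENNReal.ofReal (ν z) with hw
  have hV := measurable_lavgFst h.measurable I
  have hFm := measurable_pair₁ hf I η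
  -- The stopping argument with β the bmo norm and K = 4Q, which gives the constant 2^{m+1} · 4Q.
  have hmain := lintegral_sub_average_mul_le hE hm hloc (F := coef f I η) hFm.enorm
    (fun y => enorm_ne_top) hV
    (fun J hJ => lintegral_avg₁_sub_average_le h hb.locallyIntegrable hD hE hI hJ)
    (fun J _ A hA _ hvol => h.lintegral_lavgFst_le I J hA hvol) hJ
  rw [average_avg₁ hb.locallyIntegrable] at hmain
  set c := ⨍ z in rect I J, b z
  set B : (Fin m → ℝ) → ℝ := fun y =>
    (dyadicMax E (pair₁ f (haar I η)) y).toReal * avg₁ ν I y with hB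
  have hB0 : ∀ y, 0 ≤ B y := fun y => by
    refine mul_nonneg ENNReal.toReal_nonneg ?_
    rw [avg₁, setAverage_eq]
    exact smul_nonneg (inv_nonneg.2 measureReal_nonneg) (integral_nonneg fun x => (hpos _).le)
  have hBint : ∫⁻ y in J.toSet, maxM volume E (coef f I η) y * lavgFst w I y =
      ENNReal.ofReal (∫ y in J.toSet, B y) := by
    rw [ofReal_integral_eq_lintegral_ofReal hint (Eventually.of_forall hB0)]
    refine lintegral_congr_ae ?_
    filter_upwards [ae_restrict_of_ae hfin, ae_ofReal_avg₁ hν hpos I J (h.lintegral_ne_top I J)]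
      with y h1 h2
    simp only [hB]
    rw [ENNReal.ofReal_mul ENNReal.toReal_nonneg, h2]
    exact congrArg (· * lavgFst w I y) (ENNReal.ofReal_toReal h1.ne).symm
  rw [hBint] at hmain
  set K := 2 ^ (m + 1) * (4 * Q) * bmoNorm ν b * ENNReal.ofReal (∫ y in J.toSet, B y) with hK
  have hKt : K ≠ ∞ := ENNReal.mul_ne_top (ENNReal.mul_ne_top (ENNReal.mul_ne_top
    (ENNReal.pow_ne_top ENNReal.ofNat_ne_top) (ENNReal.mul_ne_top ENNReal.ofNat_ne_top
      h.const_ne_top)) hb.norm_lt_top.ne) ENNReal.ofReal_ne_top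
  have hle : ∫⁻ y in J.toSet, ‖(avg₁ b I y - c) * pair₁ f (haar I η) y‖ₑ ≤ K := by
    simp only [enorm_mul]
    exact hmain
  have hmeas : AEStronglyMeasurable (fun y => (avg₁ b I y - c) * pair₁ f (haar I η) y)
      (volume.restrict J.toSet) :=
    ((Cube.locallyIntegrable_integrableOn hloc J).1.sub aestronglyMeasurable_const).mul
      hFm.aestronglyMeasurable
  refine ⟨⟨hmeas, hle.trans_lt hKt.lt_top⟩, ?_⟩
  have h1 : ‖∫ y in J.toSet, (avg₁ b I y - c) * pair₁ f (haar I η) y‖ ≤ K.toReal := by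
    rw [← toReal_enorm]
    exact ENNReal.toReal_mono hKt ((enorm_integral_le_lintegral_enorm _).trans hle)
  have h2 : K.toReal = (2 ^ (m + 1) * (4 * Q.toReal)) * (bmoNorm ν b).toReal *
      ∫ y in J.toSet, B y := by
    rw [hK, ENNReal.toReal_mul, ENNReal.toReal_ofReal (integral_nonneg hB0)]
    simp
  have hJ0 := inv_nonneg.2 J.volume_real_pos.le
  rw [setAverage_eq, norm_smul, Real.norm_of_nonneg hJ0, mul_left_comm]
  exact mul_le_mul_of_nonneg_left (h1.trans h2.le) hJ0

end LittleBmo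

end BiParam

namespace BiParam

/-! ### Invariance under changes on null sets, which reduces the theorem to Borel data and
everywhere positive weights. -/

section Modifications

variable {n m : ℕ}

theorem exists_measurable_pos_ae_eq {w : (Fin n → ℝ) × (Fin m → ℝ) → ℝ}
    (hw : AEStronglyMeasurable w volume) (hpos : ∀ᵐ z, 0 < w z) :
    ∃ w' : (Fin n → ℝ) × (Fin m → ℝ) → ℝ, Measurable w' ∧ (∀ z, 0 < w' z) ∧ w =ᵐ[volume] w' := by
  have hm := hw.stronglyMeasurable_mk.measurable
  refine ⟨fun z => if 0 < hw.mk w z then hw.mk w z else 1,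
    Measurable.ite (measurableSet_lt measurable_const hm) hm measurable_const, fun z => ?_, ?_⟩
  · simp only
    split_ifs with h
    exacts [h, one_pos]
  · filter_upwards [hw.ae_eq_mk, hpos] with z h1 h2
    rw [← h1, if_pos h2]

theorem wMeasure_congr {w w' : (Fin n → ℝ) × (Fin m → ℝ) → ℝ} (h : w =ᵐ[volume] w') :
    wMeasure w = wMeasure w' :=
  withDensity_congr_ae (h.mono fun z hz => by simp only [hz])

theorem ae_of_ae_wMeasure {w : (Fin n → ℝ) × (Fin m → ℝ) → ℝ} (hw : Measurable w)
    (hpos : ∀ z, 0 < w z) {P : (Fin n → ℝ) × (Fin m → ℝ) → Prop}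
    (h : ∀ᵐ z ∂wMeasure w, P z) : ∀ᵐ z, P z := by
  rw [wMeasure, ae_withDensity_iff hw.ennreal_ofReal] at h
  exact h.mono fun z hz => hz (by simpa using hpos z)

theorem apConst_congr (p : ℝ) {w w' : (Fin n → ℝ) × (Fin m → ℝ) → ℝ} (h : w =ᵐ[volume] w') :
    apConst p w = apConst p w' := by
  have e : ∀ (I : Cube n) (J : Cube m) (g : ℝ → ℝ≥0∞),
      lavg (rect I J) (fun z => g (w z)) = lavg (rect I J) (fun z => g (w' z)) := fun I J g => by
    have h1 : (fun z => g (w z)) =ᵐ[volume] fun z => g (w' z) := h.fun_comp g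
    rw [lavg, lavg, lintegral_congr_ae (ae_restrict_of_ae h1)]
  unfold apConst
  refine iSup_congr fun I => iSup_congr fun J => ?_
  rw [e I J fun t => ENNReal.ofReal t, e I J fun t => ENNReal.ofReal (t ^ (1 - p.conjExponent))]

theorem IsApWeight.congr {p : ℝ} {w w' : (Fin n → ℝ) × (Fin m → ℝ) → ℝ} (hw : IsApWeight p w)
    (h : w =ᵐ[volume] w') : IsApWeight p w' where
  locallyIntegrable := hw.locallyIntegrable.congr h
  pos := by
    filter_upwards [hw.pos, h] with z h1 h2
    rwa [← h2]
  apConst_lt_top := apConst_congr p h ▸ hw.apConst_lt_top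

theorem bloomWeight_congr (p : ℝ) {μ μ' lam lam' : (Fin n → ℝ) × (Fin m → ℝ) → ℝ}
    (hμ : μ =ᵐ[volume] μ') (hlam : lam =ᵐ[volume] lam') :
    bloomWeight p μ lam =ᵐ[volume] bloomWeight p μ' lam' := by
  filter_upwards [hμ, hlam] with z h1 h2
  rw [bloomWeight, bloomWeight, h1, h2]

theorem bmoNorm_congr {w w' : (Fin n → ℝ) × (Fin m → ℝ) → ℝ} (h : w =ᵐ[volume] w')
    (b : (Fin n → ℝ) × (Fin m → ℝ) → ℂ) : bmoNorm w b = bmoNorm w' b := by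
  simp only [bmoNorm, bmoDyadicNorm, wMeasure_congr h]

theorem ae_ae_snd {P : (Fin n → ℝ) × (Fin m → ℝ) → Prop} (h : ∀ᵐ z, P z) :
    ∀ᵐ y, ∀ᵐ x, P (x, y) := by
  have h1 := (Measure.measurePreserving_swap (μ := (volume : Measure (Fin m → ℝ)))
    (ν := (volume : Measure (Fin n → ℝ)))).quasiMeasurePreserving.ae h
  exact Measure.ae_ae_of_ae_prod h1

theorem pair₁_congr {f f' : (Fin n → ℝ) × (Fin m → ℝ) → ℂ} (h : f =ᵐ[volume] f')
    (k : (Fin n → ℝ) → ℝ) : pair₁ f k =ᵐ[volume] pair₁ f' k :=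
  (ae_ae_snd h).mono fun _ hy => integral_congr_ae (hy.mono fun _ hx => by simp only [hx])

theorem dyadicMax_congr (E : Set (Cube m)) {g g' : (Fin m → ℝ) → ℂ} (h : g =ᵐ[volume] g') :
    dyadicMax E g = dyadicMax E g' := by
  rw [dyadicMax_eq, dyadicMax_eq]
  exact maxM_congr (h.mono fun y hy => by simp only [hy])

theorem avg₁_congr {ν ν' : (Fin n → ℝ) × (Fin m → ℝ) → ℝ} (h : ν =ᵐ[volume] ν') (I : Cube n) :
    avg₁ ν I =ᵐ[volume] avg₁ ν' I :=
  (ae_ae_snd h).mono fun _ hy => average_congr (ae_restrict_of_ae hy)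

theorem phiTerm_congr (E : Set (Cube m)) {ν ν' : (Fin n → ℝ) × (Fin m → ℝ) → ℝ}
    (hν : ν =ᵐ[volume] ν') {f f' : (Fin n → ℝ) × (Fin m → ℝ) → ℂ} (hf : f =ᵐ[volume] f')
    (I : Cube n) (η : Fin n → Fin 2) : phiTerm E ν f I η =ᵐ[volume] phiTerm E ν' f' I η := by
  have h1 := Measure.quasiMeasurePreserving_snd (μ := (volume : Measure (Fin n → ℝ)))
    (ν := (volume : Measure (Fin m → ℝ))) |>.ae (avg₁_congr hν I)
  rw [← Measure.volume_eq_prod] at h1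
  filter_upwards [h1] with z hz
  rw [phiTerm, phiTerm, dyadicMax_congr E (pair₁_congr hf _), hz]

theorem IsPhi.congr {D : Set (Cube n)} {E : Set (Cube m)} {S : Cube n → Finset (Fin n → Fin 2)}
    {p : ℝ} {lam lam' ν ν' : (Fin n → ℝ) × (Fin m → ℝ) → ℝ}
    {f f' : (Fin n → ℝ) × (Fin m → ℝ) → ℂ} {φ : (Fin n → ℝ) × (Fin m → ℝ) → ℝ}
    (h : IsPhi D E S p lam ν f φ) (hlam : lam =ᵐ[volume] lam') (hν : ν =ᵐ[volume] ν')
    (hf : f =ᵐ[volume] f') : IsPhi D E S p lam' ν' f' φ := by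
  obtain ⟨h1, h2⟩ := h
  rw [wMeasure_congr hlam] at h1 h2
  refine ⟨h1, h2.congr fun s => eLpNorm_congr_ae ?_⟩
  have h3 : ∀ᵐ z ∂(volume : Measure ((Fin n → ℝ) × (Fin m → ℝ))), ∀ I ∈ s, ∀ η ∈ S I,
      phiTerm E ν f I η z = phiTerm E ν' f' I η z :=
    (Finset.eventually_all _).2 fun I _ => (Finset.eventually_all _).2 fun η _ =>
      phiTerm_congr E hν hf I η
  filter_upwards [(withDensity_absolutelyContinuous _ _).ae_le h3] with z hz
  congr 1
  exact Finset.sum_congr rfl fun I hI => Finset.sum_congr rfl fun η hη => hz I hI η hη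

end Modifications

end BiParam

/-! ### The theorem for general data. -/

theorem lemma4p1 (n m : ℕ) (hn : 0 < n) (hm : 0 < m) (p : ℝ) (hp : 1 < p) :
    ∃ (C₁ : ℝ≥0∞ → ℝ≥0) (C₂ : ℝ≥0∞ → ℝ≥0∞ → ℝ≥0),
      ∀ (D : Set (BiParam.Cube n)) (E : Set (BiParam.Cube m)),
        BiParam.IsDyadicGrid D → BiParam.IsDyadicGrid E →
      ∀ S : BiParam.Cube n → Finset (Fin n → Fin 2), (∀ I, 0 ∉ S I) →
      ∀ μ lam : (Fin n → ℝ) × (Fin m → ℝ) → ℝ,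
        BiParam.IsApWeight p μ → BiParam.IsApWeight p lam →
      ∀ f : (Fin n → ℝ) × (Fin m → ℝ) → ℂ,
        MemLp f (ENNReal.ofReal p) (BiParam.wMeasure μ) →
      ∃ φ : (Fin n → ℝ) × (Fin m → ℝ) → ℝ,
        BiParam.IsPhi D E S p lam (BiParam.bloomWeight p μ lam) f φ ∧
        eLpNorm φ (ENNReal.ofReal p) (BiParam.wMeasure lam) ≤
          C₂ (BiParam.apConst p μ) (BiParam.apConst p lam) *
            eLpNorm f (ENNReal.ofReal p) (BiParam.wMeasure μ) ∧
        ∀ b : (Fin n → ℝ) × (Fin m → ℝ) → ℂ,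
          BiParam.MemBmo (BiParam.bloomWeight p μ lam) b →
        ∀ I ∈ D, ∀ J ∈ E, ∀ η ∈ S I,
          IntegrableOn (fun x₂ => (BiParam.avg₁ b I x₂ - ⨍ y in BiParam.rect I J, b y) *
            BiParam.pair₁ f (BiParam.haar I η) x₂) J.toSet ∧
          ‖⨍ x₂ in J.toSet, (BiParam.avg₁ b I x₂ - ⨍ y in BiParam.rect I J, b y) *
              BiParam.pair₁ f (BiParam.haar I η) x₂‖ ≤
            C₁ (BiParam.apConst 2 (BiParam.bloomWeight p μ lam)) *
              (BiParam.bmoNorm (BiParam.bloomWeight p μ lam) b).toReal *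
              ∫ x, φ x * (BiParam.haar I η x.1 *
                J.toSet.indicator (fun _ => (volume.real J.toSet)⁻¹) x.2) := by
  have hp0 : 0 < p := one_pos.trans hp
  have hpq : p.HolderConjugate p.conjExponent := Real.HolderConjugate.conjExponent hp
  choose C hC using BiParam.exists_isPhi hn hm hp
  -- The constants must be functions on [0, ∞]; their values at ∞ play no role because all the
  -- characteristics that occur are finite.
  refine ⟨fun x => 2 ^ (m + 1) * (4 * x.toNNReal), fun x y => C x.toNNReal y.toNNReal,
    fun D E hD hE S hS μ lam hμ hlam f hf => ?_⟩
  obtain ⟨μ', hμm, hμ0, hμe⟩ := BiParam.exists_measurable_pos_ae_eq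
    hμ.locallyIntegrable.aestronglyMeasurable hμ.pos
  obtain ⟨lam', hlm, hl0, hle⟩ := BiParam.exists_measurable_pos_ae_eq
    hlam.locallyIntegrable.aestronglyMeasurable hlam.pos
  have hνe := BiParam.bloomWeight_congr p hμe hle
  rw [BiParam.apConst_congr p hμe, BiParam.apConst_congr p hle, BiParam.apConst_congr 2 hνe,
    BiParam.wMeasure_congr hμe, BiParam.wMeasure_congr hle]
  rw [BiParam.wMeasure_congr hμe] at hf
  have hμR := (hμ.congr hμe).rectAp hp hμm hμ0
  have hlR := (hlam.congr hle).rectAp hp hlm hl0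
  -- A Borel version of f for the weighted measure. The weight is positive everywhere, so it also
  -- agrees with f almost everywhere for Lebesgue measure.
  set f' := hf.1.mk f with hf'
  have hfm : Measurable f' := hf.1.stronglyMeasurable_mk.measurable
  have hfe : f =ᵐ[volume] f' :=
    BiParam.ae_of_ae_wMeasure hμm hμ0 hf.1.ae_eq_mk
  have hfn : eLpNorm f (ENNReal.ofReal p) (BiParam.wMeasure μ') =
      eLpNorm f' (ENNReal.ofReal p) (BiParam.wMeasure μ') := eLpNorm_congr_ae hf.1.ae_eq_mk
  obtain ⟨⟨φ, hφm, hφ, hφn⟩, hfin⟩ := hC (BiParam.apConst p μ').toNNReal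
    (BiParam.apConst p lam').toNNReal D E hD hE S hS μ' lam' hμm hlm hμ0 hl0
    (by rwa [ENNReal.coe_toNNReal hμR.const_ne_top])
    (by rwa [ENNReal.coe_toNNReal hlR.const_ne_top]) f' hfm (hfn ▸ hf.2.ne)
  refine ⟨φ, hφ.congr hle.symm hνe.symm hfe.symm, hfn ▸ hφn, fun b hb I hI J hJ η hη => ?_⟩
  have hνm := BiParam.measurable_bloomWeight (p := p) hμm hlm
  have hν0 : ∀ z, 0 < BiParam.bloomWeight p μ' lam' z := fun z =>
    mul_pos (Real.rpow_pos_of_pos (hμ0 z) _) (Real.rpow_pos_of_pos (hl0 z) _)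
  have hνR := hμR.bloom hpq hlR
  simp only [← BiParam.enorm_bloomWeight hμ0 hl0, Real.enorm_eq_ofReal (hν0 _).le] at hνR
  have hb' : BiParam.MemBmo (BiParam.bloomWeight p μ' lam') b :=
    ⟨hb.locallyIntegrable, BiParam.bmoNorm_congr hνe b ▸ hb.norm_lt_top⟩
  obtain ⟨h1, h2⟩ := hφ.integral_mul_testFn hpq hφm hlm hlR hνm hD hE hn hS hI hη J
  obtain ⟨h3, h4⟩ := BiParam.norm_average_mul_pair₁_le hm hD hE hνm hν0
    (hνR.self_apConst_two hν0) hfm hb' hI hJ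
    (BiParam.ae_maxCoef_lt_top hD hE.countable hp0 hμR.measurable hμR.ne_zero hfin hI hη) h1
  have hpe : (fun y => (BiParam.avg₁ b I y - ⨍ z in BiParam.rect I J, b z) *
      BiParam.pair₁ f' (BiParam.haar I η) y) =ᵐ[volume.restrict J.toSet]
      fun y => (BiParam.avg₁ b I y - ⨍ z in BiParam.rect I J, b z) *
        BiParam.pair₁ f (BiParam.haar I η) y :=
    ae_restrict_of_ae ((BiParam.pair₁_congr hfe (BiParam.haar I η)).mono fun y hy => by
      simp only [hy])
  refine ⟨h3.congr hpe, ?_⟩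
  rw [← average_congr hpe, BiParam.bmoNorm_congr hνe b]
  refine h4.trans (le_of_eq ?_)
  rw [← h2]
  simp only [BiParam.testFn, NNReal.coe_mul, NNReal.coe_pow, NNReal.coe_ofNat]
  rfl
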